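/- Let $d\ge 2$ be an integer, let $\mathbb F$ be a field, and for $n\ge 1$ let $\Delta_{n-1}$ be the simplex on the vertex set $[n]$. For $0\le p\le 1$ let $Y_d(n,p)$ be the probability space of all simplicial complexes $Y$ with $\Delta_{n-1}^{(d-1)}\subset Y\subset\Delta_{n-1}^{(d)}$ (that is, $Y$ lies between the $(d-1)$-skeleton and the $d$-skeleton of $\Delta_{n-1}$), with $$\Pr(Y)=p^{f_d(Y)}(1-p)^{\binom{n}{d+1}-f_d(Y)},$$ where $f_d(Y)$ is the number of $d$-simplices of $Y$. Let $\mathcal F_{n,d}$ be the family of all such $Y$ that do not contain the boundary of a $(d+1)$-simplex. A free face of $Y$ is a $(d-1)$-simplex contained in exactly one $d$-simplex of $Y$; $R(Y)$ is obtained from $Y$ by removing all free faces together with the $d$-simplices that contain them, and $Y$ is $d$-collapsible if the complex $R_\infty(Y)$ at which the sequence $Y,R(Y),R(R(Y)),\dots$ stabilizes has dimension less than $d$. Let $H_d(Y)$ be the $d$-th simplicial homology of $Y$ with coefficients in $\mathbb F$. Let $\gamma_d$ be the infimum of the set of all $\gamma\ge 0$ for which the equation $\exp(-\gamma(1-x)^d)=x$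 has a real solution $x<1$. Let $0\le c<\gamma_d$ be fixed. Then in the probability space $Y_d(n,\frac cn)$ $$\lim_{n\to\infty}\Pr\left[\,Y\text{ is }d\text{-collapsible}\mid Y\in\mathcal F_{n,d}\right]=1 .$$ As a consequence, $$\lim_{n\to\infty}\Pr\left[H_d(Y)=0\mid Y\in\mathcal F_{n,d}\right]=1$$ and $$\lim_{n\to\infty}\Pr\left[H_d(Y)=0\right]=\lim_{n\to\infty}\Pr\left[\mathcal F_{n,d}\right]=\exp\left(-\frac{c^{d+2}}{(d+2)!}\right).$$ -/

import Mathlib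

/-!
Subcomplexes of the simplex `Δ_{n-1}` on the vertex set `Fin n` are terms of
`PreAbstractSimplicialComplex (Fin n)`: downward closed families of nonempty subsets of `Fin n`.
A face with `i + 1` vertices has dimension `i`.
-/

namespace LinialMeshulam

noncomputable section

open scoped Classical in
/-- `Y(i)`: the set of `i`-dimensional simplices of `Y`. -/
def simplices {n : ℕ} (Y : PreAbstractSimplicialComplex (Fin n)) (i : ℕ) :
    Finset (Finset (Fin n)) :=
  Finset.univ.filter fun s => s ∈ Y ∧ s.card = i + 1

/-- There are finitely many complexes on `Fin n`. -/
theorem finite_complexes (n : ℕ) : Finite (PreAbstractSimplicialComplex (Fin n)) :=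
  Finite.of_injective (fun Y => Y.faces) fun _ _ h => PreAbstractSimplicialComplex.ext h

/-! ### The random complex -/

/-- `Y` contains the full `(d-1)`-dimensional skeleton of `Δ_{n-1}` and is contained in the
`d`-dimensional skeleton of `Δ_{n-1}`. -/
def IsBetweenSkeleta {n : ℕ} (d : ℕ) (Y : PreAbstractSimplicialComplex (Fin n)) : Prop :=
  (∀ s : Finset (Fin n), s.Nonempty → s.card ≤ d → s ∈ Y) ∧ ∀ s ∈ Y, s.card ≤ d + 1

/-- The sample space: all `Y` with `Δ_{n-1}^{(d-1)} ⊆ Y ⊆ Δ_{n-1}^{(d)}`. -/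
def sampleSpace (n d : ℕ) : Finset (PreAbstractSimplicialComplex (Fin n)) :=
  haveI := finite_complexes n
  (Set.toFinite {Y : PreAbstractSimplicialComplex (Fin n) | IsBetweenSkeleta d Y}).toFinset

/-- The probability of the single complex `Y` in `Y_d(n, p)`. -/
def weight {n : ℕ} (d : ℕ) (p : ℝ) (Y : PreAbstractSimplicialComplex (Fin n)) : ℝ :=
  p ^ (simplices Y d).card * (1 - p) ^ (n.choose (d + 1) - (simplices Y d).card)

open scoped Classical in
/-- The probability of the event `A` in the probability space `Y_d(n, p)`, `0 ≤ p ≤ 1`. -/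
def prob (n d : ℕ) (p : ℝ) (A : PreAbstractSimplicialComplex (Fin n) → Prop) : ℝ :=
  ∑ Y ∈ (sampleSpace n d).filter A, weight d p Y

/-- The conditional probability of `A` given `B` in `Y_d(n, p)`. -/
def condProb (n d : ℕ) (p : ℝ) (A B : PreAbstractSimplicialComplex (Fin n) → Prop) : ℝ :=
  prob n d p (fun Y => A Y ∧ B Y) / prob n d p B

/-- `Y` contains the boundary of some `(d+1)`-simplex of `Δ_{n-1}`. -/
def ContainsSimplexBoundary {n : ℕ} (d : ℕ) (Y : PreAbstractSimplicialComplex (Fin n)) : Prop :=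
  ∃ s : Finset (Fin n), s.card = d + 2 ∧ ∀ t : Finset (Fin n), t ⊂ s → t.Nonempty → t ∈ Y

/-! ### Collapsing -/

/-- The `(d-1)`-simplex `τ` is a free face of `Y`: it lies in a unique `d`-simplex of `Y`. -/
def IsFreeFace {n : ℕ} (d : ℕ) (Y : PreAbstractSimplicialComplex (Fin n))
    (τ : Finset (Fin n)) : Prop :=
  τ.card = d ∧ ∃! σ : Finset (Fin n), σ ∈ simplices Y d ∧ τ ⊆ σ

/-- The `d`-collapse step `R(Y)`: remove all free `(d-1)`-faces and the simplices that contain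
them. When `Y` has dimension at most `d`, the simplices that contain a free face `τ` are `τ`
itself and the unique `d`-simplex over it. -/
def collapseStep {n : ℕ} (d : ℕ) (Y : PreAbstractSimplicialComplex (Fin n)) :
    PreAbstractSimplicialComplex (Fin n) where
  faces := {s | s ∈ Y ∧ ∀ τ, IsFreeFace d Y τ → ¬ τ ⊆ s}
  isRelLowerSet_faces := by
    rintro s ⟨hs, hfree⟩
    obtain ⟨h1, h2⟩ := Y.isRelLowerSet_faces hs
    exact ⟨h1, fun t hts ht => ⟨h2 hts ht, fun τ hτ hτt => hfree τ hτ (hτt.trans hts)⟩⟩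

/-- `R_∞(Y)`: what is left of `Y` after all collapse steps. The `R_i(Y)` decrease, so this is
the value at which the sequence stabilizes. -/
def collapseLimit {n : ℕ} (d : ℕ) (Y : PreAbstractSimplicialComplex (Fin n)) :
    PreAbstractSimplicialComplex (Fin n) where
  faces := {s | ∀ i : ℕ, s ∈ (collapseStep d)^[i] Y}
  isRelLowerSet_faces := by
    intro s hs
    exact ⟨(Y.isRelLowerSet_faces (hs 0)).1, fun t hts ht i =>
      (((collapseStep d)^[i] Y).isRelLowerSet_faces (hs i)).2 hts ht⟩

/-- `Y` is `d`-collapsible: `dim R_∞(Y) < d`. -/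
def IsCollapsible {n : ℕ} (d : ℕ) (Y : PreAbstractSimplicialComplex (Fin n)) : Prop :=
  ∀ s ∈ collapseLimit d Y, s.card ≤ d

/-! ### Simplicial homology -/

/-- The coefficient of the face `t` in the boundary of the simplex `s = {v_0 < ⋯ < v_k}`: it is
`(-1)^j` when `t = s \ {v_j}`, and `0` when `t` is not a facet of `s`. -/
def incidence (F : Type*) [Field F] {n : ℕ} (s t : Finset (Fin n)) : F :=
  ∑ v ∈ s, if s.erase v = t then (-1) ^ (s.filter (· < v)).card else 0

/-- The space of `i`-chains of `Y` with coefficients in `F`. -/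
abbrev Chains (F : Type*) [Field F] {n : ℕ} (Y : PreAbstractSimplicialComplex (Fin n))
    (i : ℕ) : Type _ :=
  simplices Y i → F

/-- The boundary map from `(i+1)`-chains to `i`-chains. -/
def boundary (F : Type*) [Field F] {n : ℕ} (Y : PreAbstractSimplicialComplex (Fin n)) (i : ℕ) :
    Chains F Y (i + 1) →ₗ[F] Chains F Y i :=
  Matrix.mulVecLin (Matrix.of fun (t : simplices Y i) (s : simplices Y (i + 1)) =>
    incidence F s.1 t.1)

/-- The `i`-cycles of `Y`; every `0`-chain is a cycle. -/
def cycles (F : Type*) [Field F] {n : ℕ} (Y : PreAbstractSimplicialComplex (Fin n)) :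
    (i : ℕ) → Submodule F (Chains F Y i)
  | 0 => ⊤
  | i + 1 => LinearMap.ker (boundary F Y i)

/-- `H_i(Y; F)`: the `i`-cycles modulo the `i`-boundaries. -/
abbrev Homology (F : Type*) [Field F] {n : ℕ} (Y : PreAbstractSimplicialComplex (Fin n))
    (i : ℕ) : Type _ :=
  cycles F Y i ⧸ (LinearMap.range (boundary F Y i)).submoduleOf (cycles F Y i)

/-! ### The constant `γ_d` -/

/-- `γ_d`: the infimum of all `γ ≥ 0` for which `exp (-γ (1 - x) ^ d) - x = 0` has a solution
`x < 1`. -/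
def gammaConst (d : ℕ) : ℝ :=
  sInf {γ : ℝ | 0 ≤ γ ∧ ∃ x : ℝ, x < 1 ∧ Real.exp (-γ * (1 - x) ^ d) - x = 0}

end

end LinialMeshulam

namespace LinialMeshulam

open Finset

set_option linter.unusedSectionVars false

/-! ### Bernoulli random subsets of a finite set -/

section Bernoulli

variable {α : Type*} [DecidableEq α]

/-! Between the two skeleta a complex is the same as a random set `ω` of `d`-simplices, and the
rounds of collapsing act on `ω` by `survivors`. What never disappears is a core, a family in which
no facet is free; so a non-collapsible complex contains a minimal core. Three facts give the
theorem.

Few simplices survive (`eventually_bern_survivors_le`). Unless an unlikely coincidence occurs, a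
simplex that survives `r` rounds carries a tree of depth `r` with disjoint branches. The BK and
Harris inequalities bound its probability by the recursion `branchBound`, whose limit for `p = c /
n` is `1 - exp (-c * β ^ d)`. A positive limit of the iterates would give a solution `x < 1` of the
equation defining `γ_d`, so for `c < γ_d` the iterates tend to `0`. By Markov, at most `δ * n ^ d`
simplices survive enough rounds, with probability close to one.

No minimal core of size at most `δ * n ^ d` avoids all simplex boundaries
(`exists_tendsto_bern_core`). A minimal core is explored by attaching a simplex to a free facet
determined by what is already present, so only the new vertex is a choice. A first moment bound
suffices if many steps are marked, that is, have few admissible vertices. Up to logarithmic size,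
marked steps reuse an old vertex; there are at least `d + 1` of them because such a core has more
simplices than vertices (`IsCore.card_sup_lt`). For larger cores, marked steps make a face heavy by
adding a vertex to a light face. A step that is neither marked nor at a scattered facet increases
the number of free facets without heavy proper faces, and this number is zero at the end. Scattered
facets are rare, and at one of boundedly many scales heavy faces cost little, so a positive fraction
of the steps is marked (`IsMinCore.exists_scale`).

The probability of having no simplex boundary has the Poisson limit: Harris gives the lower bound
and a bounded-dependence argument the upper one (`tendsto_bern_noBoundary`). Finally, collapsibility
forces `H_d = 0`, and a simplex boundary is a nonzero cycle, so the event `H_d = 0` lies between two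
events with the same limiting probability. -/

/-- The expectation of `f` at the random subset of `G` that contains each element with
probability `p` independently. -/
noncomputable def expect (p : ℝ) (G : Finset α) (f : Finset α → ℝ) : ℝ :=
  ∑ ω ∈ G.powerset, p ^ ω.card * (1 - p) ^ (G.card - ω.card) * f ω

/-- The probability that the random subset of `G` lies in `A`. -/
noncomputable def bern (p : ℝ) (G : Finset α) (A : Set (Finset α)) : ℝ :=
  expect p G (A.indicator 1)

variable {p : ℝ} {G : Finset α}

theorem expect_empty (f : Finset α → ℝ) : expect p ∅ f = f ∅ := by
  simp [expect]

theorem expect_insert {e : α} (he : e ∉ G) (f : Finset α → ℝ) :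
    expect p (insert e G) f =
      (1 - p) * expect p G f + p * expect p G (fun ω => f (insert e ω)) := by
  unfold expect
  rw [sum_powerset_insert he, mul_sum, mul_sum]
  congr 1
  · refine sum_congr rfl fun ω hω => ?_
    have h1 : ω.card ≤ G.card := card_le_card (mem_powerset.1 hω)
    rw [card_insert_of_notMem he, Nat.succ_sub h1, pow_succ]
    ring
  · refine sum_congr rfl fun ω hω => ?_
    have h1 : e ∉ ω := fun h => he (mem_powerset.1 hω h)
    rw [card_insert_of_notMem he, card_insert_of_notMem h1, Nat.add_sub_add_right, pow_succ]
    ring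

theorem expect_add (f g : Finset α → ℝ) :
    expect p G (fun ω => f ω + g ω) = expect p G f + expect p G g := by
  simp only [expect, mul_add, sum_add_distrib]

theorem expect_const_mul (a : ℝ) (f : Finset α → ℝ) :
    expect p G (fun ω => a * f ω) = a * expect p G f := by
  simp only [expect, mul_sum]
  exact sum_congr rfl fun _ _ => by ring

theorem expect_sum {ι : Type*} (s : Finset ι) (f : ι → Finset α → ℝ) :
    expect p G (fun ω => ∑ i ∈ s, f i ω) = ∑ i ∈ s, expect p G (f i) := by
  simp only [expect, mul_sum]
  rw [sum_comm]

theorem expect_const (a : ℝ) : expect p G (fun _ => a) = a := by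
  induction G using Finset.induction_on with
  | empty => exact expect_empty _
  | insert e G he ih => rw [expect_insert he, ih]; ring

theorem expect_mono (h0 : 0 ≤ p) (h1 : p ≤ 1) {f g : Finset α → ℝ}
    (h : ∀ ω ⊆ G, f ω ≤ g ω) : expect p G f ≤ expect p G g := by
  refine sum_le_sum fun ω hω => ?_
  have : (0 : ℝ) ≤ 1 - p := by linarith
  exact mul_le_mul_of_nonneg_left (h ω (mem_powerset.1 hω)) (by positivity)

theorem expect_congr {f g : Finset α → ℝ} (h : ∀ ω ⊆ G, f ω = g ω) :
    expect p G f = expect p G g :=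
  sum_congr rfl fun ω hω => by rw [h ω (mem_powerset.1 hω)]

theorem expect_nonneg (h0 : 0 ≤ p) (h1 : p ≤ 1) {f : Finset α → ℝ} (h : ∀ ω ⊆ G, 0 ≤ f ω) :
    0 ≤ expect p G f := by
  have := expect_mono h0 h1 (f := fun _ => 0) h
  rwa [expect_const] at this

theorem indicator_one_nonneg (A : Set (Finset α)) (ω : Finset α) :
    (0 : ℝ) ≤ A.indicator 1 ω := Set.indicator_nonneg (fun _ _ => zero_le_one) ω

theorem indicator_one_le_one (A : Set (Finset α)) (ω : Finset α) :
    A.indicator (1 : Finset α → ℝ) ω ≤ 1 := Set.indicator_le_self' (by simp) ω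

theorem bern_empty (A : Set (Finset α)) : bern p ∅ A = A.indicator 1 ∅ := expect_empty _

theorem bern_insert {e : α} (he : e ∉ G) (A : Set (Finset α)) :
    bern p (insert e G) A = (1 - p) * bern p G A + p * bern p G {ω | insert e ω ∈ A} := by
  unfold bern
  rw [expect_insert he]
  rfl

theorem bern_nonneg (h0 : 0 ≤ p) (h1 : p ≤ 1) (A : Set (Finset α)) : 0 ≤ bern p G A :=
  expect_nonneg h0 h1 fun ω _ => indicator_one_nonneg A ω

theorem bern_le_one (h0 : 0 ≤ p) (h1 : p ≤ 1) (A : Set (Finset α)) : bern p G A ≤ 1 := by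
  have := expect_mono (G := G) h0 h1 (f := A.indicator 1) (g := fun _ => 1)
    fun ω _ => indicator_one_le_one A ω
  rwa [expect_const] at this

theorem bern_mono (h0 : 0 ≤ p) (h1 : p ≤ 1) {A B : Set (Finset α)}
    (h : ∀ ω ⊆ G, ω ∈ A → ω ∈ B) : bern p G A ≤ bern p G B := by
  classical
  refine expect_mono h0 h1 fun ω hω => ?_
  by_cases hA : ω ∈ A
  · simp [Set.indicator, hA, h ω hω hA]
  · simpa [Set.indicator, hA] using indicator_one_nonneg B ω

theorem bern_congr {A B : Set (Finset α)} (h : ∀ ω ⊆ G, ω ∈ A ↔ ω ∈ B) :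
    bern p G A = bern p G B := by
  classical
  exact expect_congr fun ω hω => by simp [Set.indicator, h ω hω]

theorem bern_compl (A : Set (Finset α)) : bern p G Aᶜ = 1 - bern p G A := by
  classical
  have : bern p G A + bern p G Aᶜ = 1 := by
    unfold bern
    rw [← expect_add, ← expect_const (p := p) (G := G) 1]
    exact expect_congr fun ω _ => by by_cases h : ω ∈ A <;> simp [Set.indicator, h]
  linarith

theorem bern_union_add_inter (A B : Set (Finset α)) :
    bern p G (A ∪ B) + bern p G (A ∩ B) = bern p G A + bern p G B := by
  classical
  unfold bern
  rw [← expect_add, ← expect_add]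
  refine expect_congr fun ω _ => ?_
  by_cases hA : ω ∈ A <;> by_cases hB : ω ∈ B <;> simp [Set.indicator, hA, hB]

theorem bern_union_le (h0 : 0 ≤ p) (h1 : p ≤ 1) (A B : Set (Finset α)) :
    bern p G (A ∪ B) ≤ bern p G A + bern p G B := by
  have := bern_union_add_inter (p := p) (G := G) A B
  linarith [bern_nonneg h0 h1 (G := G) (A ∩ B)]

theorem bern_le_sum (h0 : 0 ≤ p) (h1 : p ≤ 1) {ι : Type*} (s : Finset ι)
    (A : Set (Finset α)) (B : ι → Set (Finset α)) (h : ∀ ω ⊆ G, ω ∈ A → ∃ i ∈ s, ω ∈ B i) :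
    bern p G A ≤ ∑ i ∈ s, bern p G (B i) := by
  classical
  unfold bern
  rw [← expect_sum]
  refine expect_mono h0 h1 fun ω hω => ?_
  have hs : ∀ j ∈ s, (0 : ℝ) ≤ (B j).indicator 1 ω := fun j _ => indicator_one_nonneg _ ω
  by_cases hA : ω ∈ A
  · obtain ⟨i, hi, hB⟩ := h ω hω hA
    refine le_trans ?_ (single_le_sum hs hi)
    simp [Set.indicator, hA, hB]
  · simp [Set.indicator, hA]

theorem bern_markov (h0 : 0 ≤ p) (h1 : p ≤ 1) {f : Finset α → ℝ} (hf : ∀ ω ⊆ G, 0 ≤ f ω)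
    {t : ℝ} (ht : 0 < t) : bern p G {ω | t < f ω} ≤ expect p G f / t := by
  classical
  rw [le_div_iff₀ ht, mul_comm, bern, ← expect_const_mul]
  refine expect_mono h0 h1 fun ω hω => ?_
  by_cases h : t < f ω
  · simpa [Set.indicator, h] using h.le
  · simpa [Set.indicator, h] using hf ω hω

/-- An event that does not depend on the elements of `E` is independent of `E ⊆ ω`. -/
theorem bern_superset_inter {E : Finset α} (hE : E ⊆ G) (D : Set (Finset α))
    (hD : ∀ e ∈ E, ∀ ω, insert e ω ∈ D ↔ ω ∈ D) :
    bern p G ({ω | E ⊆ ω} ∩ D) = p ^ E.card * bern p G D := by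
  induction E using Finset.induction_on generalizing D with
  | empty => simp
  | insert e E he ih =>
    have hG : insert e (G.erase e) = G := insert_erase (hE (mem_insert_self _ _))
    have key : ∀ D' : Set (Finset α), (∀ ω, insert e ω ∈ D' ↔ ω ∈ D') →
        bern p G ({ω | e ∈ ω} ∩ D') = p * bern p G D' := by
      intro D' hD'
      have h1 : bern p (G.erase e) ({ω | e ∈ ω} ∩ D') = 0 := by
        rw [bern, ← expect_const (p := p) (G := G.erase e) 0]
        refine expect_congr fun ω hω => Set.indicator_of_notMem ?_ _
        exact fun h => notMem_erase e G (hω h.1)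
      have h2 : {ω | insert e ω ∈ {ω | e ∈ ω} ∩ D'} = D' := by
        ext ω; simp [hD']
      have h3 : {ω | insert e ω ∈ D'} = D' := by ext ω; simp [hD']
      rw [← hG, bern_insert (notMem_erase e G), bern_insert (notMem_erase e G), h1, h2, h3]
      ring
    have h1 : {ω | insert e E ⊆ ω} ∩ D = {ω | e ∈ ω} ∩ ({ω | E ⊆ ω} ∩ D) := by
      ext ω; simp [insert_subset_iff, and_assoc]
    rw [h1, key, ih ((subset_insert _ _).trans hE) D fun e' he' => hD e' (mem_insert_of_mem he'),
      card_insert_of_notMem he, pow_succ]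
    · ring
    · intro ω
      have : E ⊆ insert e ω ↔ E ⊆ ω := subset_insert_iff_of_notMem he
      simp [this, hD e (mem_insert_self _ _)]

theorem bern_superset {E : Finset α} (hE : E ⊆ G) :
    bern p G {ω | E ⊆ ω} = p ^ E.card := by
  have h := bern_superset_inter (p := p) hE Set.univ (by simp)
  have h2 : bern p G (Set.univ : Set (Finset α)) = 1 := by
    rw [bern, Set.indicator_univ]; exact expect_const 1
  rw [Set.inter_univ, h2, mul_one] at h
  exact h

/-! ### The Harris inequality -/

/-- Splitting off one element `e` adds to the covariance the term `p * (1 - p)` times the product of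
the two drops caused by `e`; both drops have the same sign. -/
theorem expect_mul_ge (h0 : 0 ≤ p) (h1 : p ≤ 1) {f g : Finset α → ℝ} (hf : Antitone f)
    (hg : Antitone g) : expect p G f * expect p G g ≤ expect p G (fun ω => f ω * g ω) := by
  induction G using Finset.induction_on generalizing f g with
  | empty => simp [expect_empty]
  | insert e G he ih =>
    have hins : Monotone fun ω : Finset α => insert e ω := fun a b h => insert_subset_insert e h
    have i0 := ih hf hg
    have i1 := ih (hf.comp_monotone hins) (hg.comp_monotone hins)
    have hf' := expect_mono (G := G) h0 h1 (f := fun ω => f (insert e ω)) (g := f)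
      fun ω _ => hf (subset_insert _ _)
    have hg' := expect_mono (G := G) h0 h1 (f := fun ω => g (insert e ω)) (g := g)
      fun ω _ => hg (subset_insert _ _)
    simp only [expect_insert he]
    simp only [Function.comp_def] at i1
    have hp : 0 ≤ p * (1 - p) := mul_nonneg h0 (by linarith)
    have := mul_nonneg hp (mul_nonneg (sub_nonneg.2 hf') (sub_nonneg.2 hg'))
    have j0 := mul_le_mul_of_nonneg_left i0 (by linarith : 0 ≤ 1 - p)
    have j1 := mul_le_mul_of_nonneg_left i1 h0
    nlinarith

theorem indicator_antitone {A : Set (Finset α)} (hA : IsLowerSet A) :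
    Antitone (A.indicator (1 : Finset α → ℝ)) := by
  classical
  intro a b hab
  by_cases hb : b ∈ A
  · simp [Set.indicator, hb, hA hab hb]
  · simpa [Set.indicator, hb] using indicator_one_nonneg A a

theorem bern_inter_ge (h0 : 0 ≤ p) (h1 : p ≤ 1) {A B : Set (Finset α)} (hA : IsLowerSet A)
    (hB : IsLowerSet B) : bern p G A * bern p G B ≤ bern p G (A ∩ B) := by
  classical
  refine (expect_mul_ge h0 h1 (indicator_antitone hA) (indicator_antitone hB)).trans_eq ?_
  refine expect_congr fun ω _ => ?_
  by_cases ha : ω ∈ A <;> by_cases hb : ω ∈ B <;> simp [Set.indicator, ha, hb]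

theorem bern_biInter_ge (h0 : 0 ≤ p) (h1 : p ≤ 1) {ι : Type*} (s : Finset ι)
    {A : ι → Set (Finset α)} (hA : ∀ i ∈ s, IsLowerSet (A i)) :
    ∏ i ∈ s, bern p G (A i) ≤ bern p G {ω | ∀ i ∈ s, ω ∈ A i} := by
  classical
  induction s using Finset.induction_on with
  | empty =>
    have : bern p G {ω | ∀ i ∈ (∅ : Finset ι), ω ∈ A i} = 1 := by
      simp only [notMem_empty, false_imp_iff, implies_true, Set.ofPred_true]
      rw [bern, Set.indicator_univ]; exact expect_const 1
    rw [this, prod_empty]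
  | insert i s hi ih =>
    rw [prod_insert hi]
    have hs : IsLowerSet {ω | ∀ i ∈ s, ω ∈ A i} := fun a b hab ha j hj =>
      hA j (mem_insert_of_mem hj) hab (ha j hj)
    have h2 := bern_inter_ge (G := G) h0 h1 (hA i (mem_insert_self _ _)) hs
    have h3 : A i ∩ {ω | ∀ i ∈ s, ω ∈ A i} = {ω | ∀ j ∈ insert i s, ω ∈ A j} := by
      ext ω; simp
    rw [h3] at h2
    exact (mul_le_mul_of_nonneg_left (ih fun j hj => hA j (mem_insert_of_mem hj))
      (bern_nonneg h0 h1 _)).trans h2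

/-! ### The van den Berg–Kesten inequality for increasing events -/

/-- `A` and `B` occur on disjoint subsets of `ω`. -/
def disjointOccur (A B : Set (Finset α)) : Set (Finset α) :=
  {ω | ∃ I J, Disjoint I J ∧ I ⊆ ω ∧ J ⊆ ω ∧ I ∈ A ∧ J ∈ B}

theorem disjointOccur_mono {A A' B B' : Set (Finset α)} (hA : A ⊆ A') (hB : B ⊆ B') :
    disjointOccur A B ⊆ disjointOccur A' B' :=
  fun _ ⟨I, J, h1, h2, h3, h4, h5⟩ => ⟨I, J, h1, h2, h3, hA h4, hB h5⟩

/-- Induction on the ground set. If `e` is present, it helps at most one of the two witnesses, so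
one of the two events can be relaxed to its section at `e`. The assumption `p ≤ 1 / 2` keeps this
elementary and is harmless for `p = c / n`. -/
theorem bern_disjointOccur_le (h0 : 0 ≤ p) (h1 : p ≤ 1 / 2) {A B : Set (Finset α)}
    (hA : IsUpperSet A) (hB : IsUpperSet B) :
    bern p G (disjointOccur A B) ≤ bern p G A * bern p G B := by
  have h1' : p ≤ 1 := by linarith
  induction G using Finset.induction_on generalizing A B with
  | empty =>
    classical
    simp only [bern_empty]
    by_cases h : (∅ : Finset α) ∈ disjointOccur A B
    · obtain ⟨I, J, -, hI, hJ, hIA, hJB⟩ := h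
      rw [subset_empty] at hI hJ
      subst hI hJ
      simpa [Set.indicator, hIA, hJB] using indicator_one_le_one _ _
    · rw [Set.indicator_of_notMem h]
      exact mul_nonneg (indicator_one_nonneg _ _) (indicator_one_nonneg _ _)
  | insert e G he ih =>
    set A' : Set (Finset α) := {ω | insert e ω ∈ A} with hA'
    set B' : Set (Finset α) := {ω | insert e ω ∈ B} with hB'
    have uA : IsUpperSet A' := fun a b hab h => hA (insert_subset_insert e hab) h
    have uB : IsUpperSet B' := fun a b hab h => hB (insert_subset_insert e hab) h
    have sA : A ⊆ A' := fun a h => hA (subset_insert e a) h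
    have sB : B ⊆ B' := fun a h => hB (subset_insert e a) h
    have hsplit : bern p G {ω | insert e ω ∈ disjointOccur A B} ≤
        bern p G (disjointOccur A' B ∪ disjointOccur A B') := by
      refine bern_mono h0 h1' ?_
      rintro ω hω ⟨I, J, hIJ, hI, hJ, hIA, hJB⟩
      have sub : ∀ {K : Finset α}, K ⊆ insert e ω → K.erase e ⊆ ω := fun h =>
        subset_insert_iff.1 h
      have hins : ∀ {K : Finset α}, K ⊆ insert e (K.erase e) := fun {K} x hx => by
        by_cases h : x = e <;> simp [h, hx]
      by_cases heI : e ∈ I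
      · have heJ : e ∉ J := fun h => disjoint_left.1 hIJ heI h
        refine Or.inl ⟨I.erase e, J, hIJ.mono_left (erase_subset _ _), sub hI, ?_,
          hA hins hIA, hJB⟩
        rw [← erase_eq_of_notMem heJ]
        exact sub hJ
      · refine Or.inr ⟨I, J.erase e, hIJ.mono_right (erase_subset _ _), ?_, sub hJ, hIA,
          hB hins hJB⟩
        rw [← erase_eq_of_notMem heI]
        exact sub hI
    -- The original disjoint occurrence implies both relaxed ones, so inclusion-exclusion returns
    -- one copy of its probability.
    have hinter : bern p G (disjointOccur A B) ≤
        bern p G (disjointOccur A' B ∩ disjointOccur A B') :=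
      bern_mono h0 h1' fun ω _ h =>
        ⟨disjointOccur_mono sA le_rfl h, disjointOccur_mono le_rfl sB h⟩
    have hun := bern_union_add_inter (p := p) (G := G) (disjointOccur A' B) (disjointOccur A B')
    rw [bern_insert he, bern_insert he, bern_insert he]
    have i00 := ih hA hB
    have i10 := ih uA hB
    have i01 := ih hA uB
    have a01 := bern_mono (G := G) h0 h1' fun ω _ h => sA (a := ω) h
    have b01 := bern_mono (G := G) h0 h1' fun ω _ h => sB (a := ω) h
    have hX : bern p G {ω | insert e ω ∈ disjointOccur A B} ≤
        bern p G A' * bern p G B + bern p G A * bern p G B' - bern p G (disjointOccur A B) := by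
      linarith
    have j1 := mul_le_mul_of_nonneg_left hX h0
    -- The returned copy turns the coefficient `1 - p` into `1 - 2 * p`, whose sign is where `p ≤ 1
    -- / 2` enters. The remaining gap to the product is `p ^ 2` times the product of the two
    -- increments.
    have j0 := mul_le_mul_of_nonneg_left i00 (by linarith : 0 ≤ 1 - 2 * p)
    have j2 := mul_nonneg (mul_nonneg h0 h0)
      (mul_nonneg (sub_nonneg.2 a01) (sub_nonneg.2 b01))
    nlinarith

/-- The events `A i`, `i ∈ s`, occur on pairwise disjoint subsets of `ω`. -/
def disjointOccurFamily {ι : Type*} (s : Finset ι) (A : ι → Set (Finset α)) :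
    Set (Finset α) :=
  {ω | ∃ W : ι → Finset α, (s : Set ι).PairwiseDisjoint W ∧ ∀ i ∈ s, W i ⊆ ω ∧ W i ∈ A i}

theorem isUpperSet_disjointOccurFamily {ι : Type*} (s : Finset ι) (A : ι → Set (Finset α)) :
    IsUpperSet (disjointOccurFamily s A) :=
  fun _ _ hab ⟨W, h1, h2⟩ => ⟨W, h1, fun i hi => ⟨(h2 i hi).1.trans hab, (h2 i hi).2⟩⟩

theorem isUpperSet_disjointOccur (A B : Set (Finset α)) : IsUpperSet (disjointOccur A B) :=
  fun _ _ hab ⟨I, J, h1, h2, h3, h4⟩ => ⟨I, J, h1, h2.trans hab, h3.trans hab, h4⟩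

theorem bern_disjointOccurFamily_le (h0 : 0 ≤ p) (h1 : p ≤ 1 / 2) {ι : Type*} (s : Finset ι)
    {A : ι → Set (Finset α)} (hA : ∀ i ∈ s, IsUpperSet (A i)) :
    bern p G (disjointOccurFamily s A) ≤ ∏ i ∈ s, bern p G (A i) := by
  classical
  have h1' : p ≤ 1 := by linarith
  induction s using Finset.induction_on with
  | empty => simpa using bern_le_one h0 h1' _
  | insert i s hi ih =>
    rw [prod_insert hi]
    have hs : ∀ j ∈ s, IsUpperSet (A j) := fun j hj => hA j (mem_insert_of_mem hj)
    have step : bern p G (disjointOccurFamily (insert i s) A) ≤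
        bern p G (disjointOccur (A i) (disjointOccurFamily s A)) := by
      refine bern_mono h0 h1' ?_
      rintro ω - ⟨W, hW, h⟩
      refine ⟨W i, s.biUnion W, ?_, (h i (mem_insert_self _ _)).1, ?_,
        (h i (mem_insert_self _ _)).2, W, ?_, fun j hj =>
          ⟨subset_biUnion_of_mem W hj, (h j (mem_insert_of_mem hj)).2⟩⟩
      · rw [disjoint_biUnion_right]
        exact fun j hj => hW (by simp) (by simp [hj]) (fun h => hi (h ▸ hj))
      · exact biUnion_subset.2 fun j hj => (h j (mem_insert_of_mem hj)).1
      · exact hW.subset (by simp)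
    exact (step.trans (bern_disjointOccur_le h0 h1 (hA i (mem_insert_self _ _))
      (isUpperSet_disjointOccurFamily s A))).trans
      (mul_le_mul_of_nonneg_left (ih hs) (bern_nonneg h0 h1' _))

end Bernoulli

/-! ### Survival of a simplex under repeated collapsing -/

section Survival

variable {n d : ℕ} {p : ℝ}

/-- The potential `d`-simplices of a complex on `Fin n`. -/
def topFaces (n d : ℕ) : Finset (Finset (Fin n)) := powersetCard (d + 1) univ

theorem mem_topFaces {s : Finset (Fin n)} : s ∈ topFaces n d ↔ s.card = d + 1 := by
  simp [topFaces, mem_powersetCard]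

theorem card_topFaces_le (n d : ℕ) : (topFaces n d).card ≤ n ^ (d + 1) := by
  rw [topFaces, card_powersetCard, card_univ, Fintype.card_fin]
  exact Nat.choose_le_pow _ _

/-- The members of `ω` that have no free facet. -/
def survivors (ω : Finset (Finset (Fin n))) : Finset (Finset (Fin n)) :=
  ω.filter fun σ => ∀ v ∈ σ, ∃ σ' ∈ ω, σ' ≠ σ ∧ σ.erase v ⊆ σ'

theorem survivors_subset (ω : Finset (Finset (Fin n))) : survivors ω ⊆ ω := filter_subset _ _

theorem iterate_survivors_subset (ω : Finset (Finset (Fin n))) (r : ℕ) :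
    survivors^[r] ω ⊆ ω := by
  induction r with
  | zero => exact subset_rfl
  | succ r ih =>
    rw [Function.iterate_succ_apply']
    exact (survivors_subset _).trans ih

/-- The event that a tree of depth `r` with disjoint branches hangs on the face `τ`. -/
def branch : ℕ → Finset (Fin n) → Set (Finset (Finset (Fin n)))
  | 0, _ => Set.univ
  | r + 1, τ => {ω | ∃ x ∉ τ, ω ∈ disjointOccur {ω | {insert x τ} ⊆ ω}
      (disjointOccurFamily τ fun v => branch r ((insert x τ).erase v))}

theorem isUpperSet_branch (r : ℕ) (τ : Finset (Fin n)) : IsUpperSet (branch r τ) := by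
  cases r with
  | zero => exact isUpperSet_univ
  | succ r =>
    rintro a b hab ⟨x, hx, h⟩
    exact ⟨x, hx, isUpperSet_disjointOccur _ _ hab h⟩

/-- The recursive bound for the probability of `branch`. -/
noncomputable def branchBound (n d : ℕ) (p : ℝ) : ℕ → ℝ
  | 0 => 1
  | r + 1 => 1 - (1 - p * branchBound n d p r ^ d) ^ n

theorem branchBound_mem (h0 : 0 ≤ p) (h1 : p ≤ 1) (r : ℕ) :
    0 ≤ branchBound n d p r ∧ branchBound n d p r ≤ 1 := by
  induction r with
  | zero => simp [branchBound]
  | succ r ih =>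
    have hq : branchBound n d p r ^ d ≤ 1 := pow_le_one₀ ih.1 ih.2
    have hq0 : 0 ≤ branchBound n d p r ^ d := pow_nonneg ih.1 _
    have ha : 0 ≤ 1 - p * branchBound n d p r ^ d := by nlinarith
    have hb : 1 - p * branchBound n d p r ^ d ≤ 1 := by nlinarith
    have := pow_nonneg ha n
    have := pow_le_one₀ (n := n) ha hb
    simp only [branchBound]
    constructor <;> linarith

/-- For a fixed new vertex, BK multiplies the probabilities of the simplex and of its `d` branches.
Different new vertices are not independent, but failure is a decreasing event for each of them, so
Harris bounds the probability that all fail from below. -/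
theorem bern_branch_le (h0 : 0 ≤ p) (h1 : p ≤ 1 / 2) (r : ℕ) {τ : Finset (Fin n)}
    (hτ : τ.card = d) : bern p (topFaces n d) (branch r τ) ≤ branchBound n d p r := by
  have h1' : p ≤ 1 := by linarith
  induction r generalizing τ with
  | zero => exact bern_le_one h0 h1' _
  | succ r ih =>
    obtain ⟨q0, q1⟩ := branchBound_mem (n := n) (d := d) h0 h1' r
    set q := branchBound n d p r with hq
    have hqd : q ^ d ≤ 1 := pow_le_one₀ q0 q1
    have hqd0 : 0 ≤ q ^ d := pow_nonneg q0 _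
    have ha : 0 ≤ 1 - p * q ^ d := by nlinarith
    have hb : 1 - p * q ^ d ≤ 1 := by nlinarith
    set A : Fin n → Set (Finset (Finset (Fin n))) := fun x =>
      disjointOccur {ω | {insert x τ} ⊆ ω}
        (disjointOccurFamily τ fun v => branch r ((insert x τ).erase v)) with hA
    have hAx : ∀ x ∈ univ \ τ, 1 - p * q ^ d ≤ bern p (topFaces n d) (A x)ᶜ := by
      intro x hx
      have hxτ : x ∉ τ := (mem_sdiff.1 hx).2
      have hcard : (insert x τ).card = d + 1 := by rw [card_insert_of_notMem hxτ, hτ]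
      have e1 : bern p (topFaces n d) {ω | {insert x τ} ⊆ ω} = p := by
        rw [bern_superset (by simpa using mem_topFaces.2 hcard), card_singleton, pow_one]
      have e2 : bern p (topFaces n d)
          (disjointOccurFamily τ fun v => branch r ((insert x τ).erase v)) ≤ q ^ d := by
        refine (bern_disjointOccurFamily_le h0 h1 τ fun v _ => isUpperSet_branch r _).trans ?_
        rw [← hτ, ← prod_const]
        refine prod_le_prod (fun v _ => bern_nonneg h0 h1' _) fun v hv => ?_
        rw [hq, hτ]
        exact ih (by rw [card_erase_of_mem (mem_insert_of_mem hv), hcard]; rfl)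
      have e3 := bern_disjointOccur_le (G := topFaces n d) h0 h1
        (A := {ω | {insert x τ} ⊆ ω}) (fun a b hab h => h.trans hab)
        (isUpperSet_disjointOccurFamily τ fun v => branch r ((insert x τ).erase v))
      rw [bern_compl]
      rw [e1] at e3
      have := mul_le_mul_of_nonneg_left e2 h0
      linarith
    have hinter := bern_biInter_ge (G := topFaces n d) h0 h1' (univ \ τ)
      (A := fun x => (A x)ᶜ) fun x _ => (isUpperSet_disjointOccur _ _).compl
    have hset : {ω | ∀ x ∈ univ \ τ, ω ∈ (A x)ᶜ} = (branch (r + 1) τ)ᶜ := by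
      ext ω; simp [branch, hA]
    rw [hset, bern_compl] at hinter
    have hprod : (1 - p * q ^ d) ^ n ≤ ∏ x ∈ univ \ τ, bern p (topFaces n d) (A x)ᶜ := by
      calc (1 - p * q ^ d) ^ n ≤ (1 - p * q ^ d) ^ (univ \ τ).card :=
            pow_le_pow_of_le_one ha hb ((card_le_univ _).trans_eq (Fintype.card_fin n))
        _ = ∏ x ∈ univ \ τ, (1 - p * q ^ d) := by rw [prod_const]
        _ ≤ _ := prod_le_prod (fun _ _ => ha) hAx
    simp only [branchBound]
    linarith

/-! ### Tree-like sets of simplices -/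

/-- The sets of `k + 1` simplices grown from `σ₀` by adding a simplex over a facet of an earlier
one, with a new vertex in each step. -/
def treeSets (σ₀ : Finset (Fin n)) : ℕ → Finset (Finset (Finset (Fin n)))
  | 0 => {{σ₀}}
  | k + 1 => (treeSets σ₀ k).biUnion fun S => S.biUnion fun s => s.biUnion fun v =>
      (univ.filter fun x => x ∉ S.sup id).image fun x => insert (insert x (s.erase v)) S

theorem mem_treeSets_succ {σ₀ : Finset (Fin n)} {k : ℕ} {S : Finset (Finset (Fin n))} :
    S ∈ treeSets σ₀ (k + 1) ↔ ∃ S' ∈ treeSets σ₀ k, ∃ s ∈ S', ∃ v ∈ s, ∃ x ∉ S'.sup id,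
      insert (insert x (s.erase v)) S' = S := by
  simp [treeSets]

theorem subset_sup_id {S : Finset (Finset (Fin n))} {s : Finset (Fin n)} (hs : s ∈ S) :
    s ⊆ S.sup id := le_sup (f := id) hs

theorem sup_id_mono {S S' : Finset (Finset (Fin n))} (h : S ⊆ S') : S.sup id ⊆ S'.sup id :=
  sup_mono h

theorem treeSets_spec {σ₀ : Finset (Fin n)} (hσ : σ₀.card = d + 1) {k : ℕ}
    {S : Finset (Finset (Fin n))} (hS : S ∈ treeSets σ₀ k) :
    S.card = k + 1 ∧ S ⊆ topFaces n d := by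
  induction k generalizing S with
  | zero =>
    simp only [treeSets, mem_singleton] at hS
    subst hS
    simpa [mem_topFaces] using hσ
  | succ k ih =>
    obtain ⟨S', hS', s, hs, v, hv, x, hx, rfl⟩ := mem_treeSets_succ.1 hS
    obtain ⟨h1, h2⟩ := ih hS'
    have hxs : x ∉ s := fun h => hx (subset_sup_id hs h)
    have hnew : insert x (s.erase v) ∉ S' := fun h =>
      hx (subset_sup_id h (mem_insert_self _ _))
    refine ⟨by rw [card_insert_of_notMem hnew, h1], insert_subset ?_ h2⟩
    have := mem_topFaces.1 (h2 hs)
    rw [mem_topFaces, card_insert_of_notMem (fun h => hxs (mem_of_mem_erase h)),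
      card_erase_of_mem hv, this]
    rfl

/-- Each growth step chooses one of at most `N` simplices, one of its `d + 1` facets, and a vertex.
-/
theorem card_treeSets_le {σ₀ : Finset (Fin n)} (hσ : σ₀.card = d + 1) {k N : ℕ} (hk : k < N) :
    (treeSets σ₀ k).card ≤ (N * (d + 1) * n) ^ k := by
  induction k with
  | zero => simp [treeSets]
  | succ k ih =>
    rw [pow_succ]
    refine (card_biUnion_le_card_mul _ _ (N * (d + 1) * n) fun S hS => ?_).trans
      (Nat.mul_le_mul_right _ (ih (by omega)))
    obtain ⟨h1, h2⟩ := treeSets_spec hσ hS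
    rw [mul_assoc]
    refine (card_biUnion_le_card_mul _ _ ((d + 1) * n) fun s hs => ?_).trans
      (Nat.mul_le_mul_right _ (by omega))
    refine (card_biUnion_le_card_mul _ _ n fun v _ => ?_).trans_eq
      (by rw [mem_topFaces.1 (h2 hs)])
    exact card_image_le.trans ((card_le_univ _).trans_eq (Fintype.card_fin n))

/-- `ω` contains a small tree-like set grown from `σ₀` and a further simplex on its vertices. -/
def coincidence (σ₀ : Finset (Fin n)) (N : ℕ) : Set (Finset (Finset (Fin n))) :=
  {ω | ∃ k < N, ∃ S ∈ treeSets σ₀ k, S ⊆ ω ∧ ∃ s ∈ ω, s ⊆ S.sup id ∧ s ∉ S}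

theorem card_sup_id_le {S : Finset (Finset (Fin n))} (hS : S ⊆ topFaces n d) :
    (S.sup id).card ≤ S.card * (d + 1) := by
  rw [sup_eq_biUnion]
  exact card_biUnion_le_card_mul _ _ _ fun s hs => (mem_topFaces.1 (hS hs)).le

/-- A tree with `k + 1` simplices has about `n ^ k` positions, while together with the extra simplex
it costs `p ^ (k + 2)`; the extra simplex has boundedly many positions. For `n * p` bounded this
leaves `O(p ^ 2)`, negligible against `p`. -/
theorem bern_coincidence_le (h0 : 0 ≤ p) (h1 : p ≤ 1) {σ₀ : Finset (Fin n)}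
    (hσ : σ₀.card = d + 1) (N : ℕ) : bern p (topFaces n d) (coincidence σ₀ N) ≤
      (∑ k ∈ range N, (N * (d + 1) * (n * p)) ^ k) * (N * (d + 1)) ^ (d + 1) * p ^ 2 := by
  have e1 : bern p (topFaces n d) (coincidence σ₀ N) ≤
      ∑ k ∈ range N, bern p (topFaces n d)
        {ω | ∃ S ∈ treeSets σ₀ k, S ⊆ ω ∧ ∃ s ∈ ω, s ⊆ S.sup id ∧ s ∉ S} := by
    refine bern_le_sum h0 h1 _ _ _ ?_
    rintro ω - ⟨k, hk, h⟩
    exact ⟨k, mem_range.2 hk, h⟩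
  refine e1.trans ?_
  rw [mul_assoc, sum_mul]
  refine sum_le_sum fun k hk => ?_
  have hk := mem_range.1 hk
  have e2 : ∀ S ∈ treeSets σ₀ k,
      bern p (topFaces n d) {ω | S ⊆ ω ∧ ∃ s ∈ ω, s ⊆ S.sup id ∧ s ∉ S} ≤
        (N * (d + 1)) ^ (d + 1) * p ^ (k + 2) := by
    intro S hS
    obtain ⟨h2, h3⟩ := treeSets_spec hσ hS
    have e3 := bern_le_sum (G := topFaces n d) h0 h1 (powersetCard (d + 1) (S.sup id) \ S)
      {ω | S ⊆ ω ∧ ∃ s ∈ ω, s ⊆ S.sup id ∧ s ∉ S} (fun s => {ω | insert s S ⊆ ω}) ?_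
    · refine e3.trans ?_
      have e4 : ∀ s ∈ powersetCard (d + 1) (S.sup id) \ S,
          bern p (topFaces n d) {ω | insert s S ⊆ ω} = p ^ (k + 2) := by
        intro s hs
        rw [mem_sdiff, mem_powersetCard] at hs
        rw [bern_superset (insert_subset (mem_topFaces.2 hs.1.2) h3),
          card_insert_of_notMem hs.2, h2]
      rw [sum_congr rfl e4, sum_const, nsmul_eq_mul]
      refine mul_le_mul_of_nonneg_right ?_ (by positivity)
      have : (powersetCard (d + 1) (S.sup id) \ S).card ≤ (N * (d + 1)) ^ (d + 1) := by
        refine (card_le_card sdiff_subset).trans ?_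
        rw [card_powersetCard]
        refine (Nat.choose_le_pow _ _).trans (Nat.pow_le_pow_left ?_ _)
        refine (card_sup_id_le h3).trans (Nat.mul_le_mul_right _ (by omega))
      exact_mod_cast this
    · rintro ω hω ⟨h4, s, hs, h5, h6⟩
      exact ⟨s, mem_sdiff.2 ⟨mem_powersetCard.2 ⟨h5, mem_topFaces.1 (hω hs)⟩, h6⟩,
        insert_subset hs h4⟩
  refine (bern_le_sum h0 h1 (treeSets σ₀ k) _
    (fun S => {ω | S ⊆ ω ∧ ∃ s ∈ ω, s ⊆ S.sup id ∧ s ∉ S}) ?_).trans ?_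
  · rintro ω - ⟨S, hS, h⟩
    exact ⟨S, hS, h⟩
  · refine (sum_le_sum e2).trans ?_
    rw [sum_const, nsmul_eq_mul]
    have hc : ((treeSets σ₀ k).card : ℝ) ≤ (N * (d + 1) * n) ^ k := by
      exact_mod_cast card_treeSets_le hσ hk
    calc ((treeSets σ₀ k).card : ℝ) * ((N * (d + 1)) ^ (d + 1) * p ^ (k + 2))
        ≤ (N * (d + 1) * n) ^ k * ((N * (d + 1)) ^ (d + 1) * p ^ (k + 2)) :=
          mul_le_mul_of_nonneg_right hc (by positivity)
      _ = _ := by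
        rw [← mul_assoc ((N : ℝ) * (d + 1)) (n : ℝ) p, mul_pow _ p k, pow_add]
        ring_nf

/-- The number of simplices in a full tree of depth `r`. -/
def branchSize (d : ℕ) : ℕ → ℕ
  | 0 => 0
  | r + 1 => 1 + d * branchSize d r

/-- Each survivor has a further simplex over every facet, itself surviving one round less. Without a
coincidence this simplex brings a new vertex, so the tree can be grown facet by facet. The last
clause of the conclusion says that a finished branch touches old `d`-sets only at its root; this
lets the siblings be built one after another. -/
theorem exists_branch {ω : Finset (Finset (Fin n))} (hω : ω ⊆ topFaces n d)
    {σ₀ : Finset (Fin n)} {N : ℕ} (hno : ω ∉ coincidence σ₀ N) (r : ℕ) :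
    ∀ (k : ℕ) (S : Finset (Finset (Fin n))) (σ : Finset (Fin n)) (v : Fin n),
      S ∈ treeSets σ₀ k → S ⊆ ω → σ ∈ S → σ ∈ survivors^[r] ω → v ∈ σ →
      (∀ s ∈ S, σ.erase v ⊆ s → s = σ) → k + branchSize d r ≤ N →
      ∃ W k', W ∈ branch r (σ.erase v) ∧ W ⊆ ω ∧ Disjoint S W ∧ S ∪ W ∈ treeSets σ₀ k' ∧
        k' ≤ k + branchSize d r ∧
        ∀ s ∈ W, ∀ τ' : Finset (Fin n), τ'.card = d → τ' ⊆ S.sup id → τ' ⊆ s →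
          τ' = σ.erase v := by
  induction r with
  | zero =>
    intro k S σ v hS _ _ _ _ _ _
    exact ⟨∅, k, trivial, by simp, by simp, by simpa using hS, by simp, by simp⟩
  | succ r ih =>
    intro k S σ v hS hSω hσ hsurv hv huniq hN
    rw [Function.iterate_succ_apply'] at hsurv
    obtain ⟨σ', hσ', hne, hsub⟩ := (mem_filter.1 hsurv).2 v hv
    set τ := σ.erase v with hτ
    have hτc : τ.card = d := by
      rw [hτ, card_erase_of_mem hv, mem_topFaces.1 (hω (hSω hσ))]; rfl
    have hσ'ω : σ' ∈ ω := iterate_survivors_subset _ _ hσ'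
    have hσ'c : σ'.card = d + 1 := mem_topFaces.1 (hω hσ'ω)
    have hσ'S : σ' ∉ S := fun h => hne (huniq σ' h hsub)
    simp only [branchSize] at hN
    -- A new simplex on old vertices would be a coincidence; the size bound leaves room since
    -- `branchSize` of a successor is at least one.
    have hnot : ¬ σ' ⊆ S.sup id := fun h =>
      hno ⟨k, by omega, S, hS, hSω, σ', hσ'ω, h, hσ'S⟩
    have hτS : τ ⊆ S.sup id := (erase_subset _ _).trans (subset_sup_id hσ)
    obtain ⟨x, hxσ', hxS⟩ := not_subset.1 hnot
    have hxτ : x ∉ τ := fun h => hxS (hτS h)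
    have hσ'eq : insert x τ = σ' :=
      eq_of_subset_of_card_le (insert_subset hxσ' hsub)
        (by rw [card_insert_of_notMem hxτ, hτc, hσ'c])
    have hS' : insert σ' S ∈ treeSets σ₀ (k + 1) :=
      mem_treeSets_succ.2 ⟨S, hS, σ, hσ, v, hv, x, hxS, by rw [← hσ'eq]⟩
    have hxmem : ∀ u ∈ τ, x ∈ σ'.erase u := fun u hu =>
      mem_erase.2 ⟨fun h => hxτ (h ▸ hu), hxσ'⟩
    have inner : ∀ t : Finset (Fin n), t ⊆ τ → ∃ (W : Fin n → Finset (Finset (Fin n))) (k' : ℕ),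
        (t : Set (Fin n)).PairwiseDisjoint W ∧
        (∀ u ∈ t, W u ⊆ ω ∧ W u ∈ branch r (σ'.erase u)) ∧
        Disjoint (insert σ' S) (t.biUnion W) ∧
        insert σ' S ∪ t.biUnion W ∈ treeSets σ₀ k' ∧ k' ≤ k + 1 + t.card * branchSize d r ∧
        ∀ s ∈ t.biUnion W, ∀ τ' : Finset (Fin n), τ'.card = d → τ' ⊆ (insert σ' S).sup id →
          τ' ⊆ s → ∃ u ∈ t, τ' = σ'.erase u := by
      intro t
      induction t using Finset.induction_on with
      | empty => intro _; exact ⟨fun _ => ∅, k + 1, by simp, by simp, by simp, by simpa using hS',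
          by simp, by simp⟩
      | insert u t hu iht =>
        intro hsubt
        have huτ : u ∈ τ := hsubt (mem_insert_self _ _)
        obtain ⟨W, k', hW1, hW2, hW3, hW4, hW5, hW6⟩ :=
          iht ((subset_insert _ _).trans hsubt)
        have hcardt : (insert u t).card ≤ d := (card_le_card hsubt).trans hτc.le
        rw [card_insert_of_notMem hu] at hcardt
        have hmul : t.card * branchSize d r + branchSize d r ≤ d * branchSize d r := by
          rw [← Nat.succ_mul]; exact Nat.mul_le_mul_right _ hcardt
        have huσ' : u ∈ σ' := hsub huτ
        -- Old simplices miss the new vertex `x`, and earlier siblings meet `σ'` in a `d`-set only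
        -- in their own root facet, which differs from the one at `u`.
        have huni : ∀ s ∈ insert σ' S ∪ t.biUnion W, σ'.erase u ⊆ s → s = σ' := by
          intro s hs hss
          rcases mem_union.1 hs with hs | hs
          · rcases mem_insert.1 hs with h | hs
            · exact h
            · exact absurd (subset_sup_id hs (hss (hxmem u huτ))) hxS
          · obtain ⟨w, hw, h⟩ := hW6 s hs (σ'.erase u)
              (by rw [card_erase_of_mem huσ', hσ'c]; rfl)
              ((erase_subset _ _).trans (subset_sup_id (mem_insert_self _ _))) hss
            refine absurd ?_ hu
            have : u ∉ σ'.erase w := h ▸ notMem_erase u σ'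
            have huw : u = w := by
              by_contra hne'
              exact this (mem_erase.2 ⟨hne', huσ'⟩)
            exact huw ▸ hw
        obtain ⟨Wu, k'', g1, g2, g3, g4, g5, g6⟩ := ih k' (insert σ' S ∪ t.biUnion W) σ' u hW4
          (union_subset (insert_subset hσ'ω hSω) (biUnion_subset.2 fun j hj => (hW2 j hj).1))
          (by simp) hσ' huσ' huni (by omega)
        · refine ⟨fun w => if w = u then Wu else W w, k'', ?_⟩
          have hfun : ∀ w ∈ t, (if w = u then Wu else W w) = W w := fun w hw =>
            if_neg (by rintro rfl; exact hu hw)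
          have hbi : (insert u t).biUnion (fun w => if w = u then Wu else W w) =
              Wu ∪ t.biUnion W := by
            rw [biUnion_insert, if_pos rfl, biUnion_congr rfl hfun]
          rw [hbi]
          refine ⟨?_, ?_, ?_, ?_, ?_, ?_⟩
          · rw [coe_insert]
            refine Set.PairwiseDisjoint.insert ?_ ?_
            · intro a ha b hb hab
              have := hW1 ha hb hab
              simp only [Function.onFun] at this ⊢
              rwa [hfun a ha, hfun b hb]
            · intro j hj _
              rw [if_pos rfl, hfun j hj]
              exact (g3.mono_left 
                ((subset_biUnion_of_mem W hj).trans subset_union_right)).symm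
          · intro w hw
            rcases mem_insert.1 hw with rfl | hw
            · simpa using ⟨g2, g1⟩
            · simp only [hfun w hw]; exact hW2 w hw
          · rw [disjoint_union_right]
            exact ⟨g3.mono_left subset_union_left, hW3⟩
          · convert g4 using 1
            rw [union_assoc, union_comm Wu]
          · rw [card_insert_of_notMem hu, Nat.succ_mul]; omega
          · intro s hs τ' hc hτ'S hτ's
            rcases mem_union.1 hs with hs | hs
            · exact ⟨u, mem_insert_self _ _, g6 s hs τ' hc
                (hτ'S.trans (sup_id_mono subset_union_left)) hτ's⟩
            · obtain ⟨w, hw, h⟩ := hW6 s hs τ' hc hτ'S hτ's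
              exact ⟨w, mem_insert_of_mem hw, h⟩
    obtain ⟨W, k', hW1, hW2, hW3, hW4, hW5, hW6⟩ := inner τ subset_rfl
    refine ⟨insert σ' (τ.biUnion W), k', ?_, ?_, ?_, ?_, ?_, ?_⟩
    · refine ⟨x, hxτ, {σ'}, τ.biUnion W, ?_, by simp, subset_insert _ _, ?_, W, hW1, ?_⟩
      · rw [disjoint_singleton_left]
        exact fun h => disjoint_left.1 hW3 (mem_insert_self _ _) h
      · simp [hσ'eq]
      · intro u hu
        rw [hσ'eq]
        exact ⟨subset_biUnion_of_mem W hu, (hW2 u hu).2⟩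
    · exact insert_subset hσ'ω (biUnion_subset.2 fun j hj => (hW2 j hj).1)
    · rw [disjoint_insert_right]
      exact ⟨hσ'S, hW3.mono_left (subset_insert _ _)⟩
    · convert hW4 using 1
      rw [union_insert, insert_union]
    · rw [hτc] at hW5
      simp only [branchSize]
      omega
    · intro s hs τ' hc hτ'S hτ's
      -- Every sub-branch is rooted at a facet of `σ'` containing the new vertex `x`, hence contains
      -- no `d`-set of old vertices.
      have hxτ' : x ∉ τ' := fun h => hxS (hτ'S h)
      rcases mem_insert.1 hs with rfl | hs
      · refine eq_of_subset_of_card_le ?_ (by rw [hτc, hc])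
        rw [← hσ'eq] at hτ's
        exact (subset_insert_iff_of_notMem hxτ').1 hτ's
      · obtain ⟨u, hu, h⟩ := hW6 s hs τ' hc (hτ'S.trans (sup_id_mono (subset_insert _ _))) hτ's
        exact absurd (h ▸ hxmem u hu) hxτ'

/-- One facet `v` of `σ` suffices: BK separates the presence of `σ` from the tree hanging on that
facet, giving the factor `p`. -/
theorem bern_survives_le (h0 : 0 ≤ p) (h1 : p ≤ 1 / 2) {σ : Finset (Fin n)}
    (hσ : σ.card = d + 1) (r : ℕ) :
    bern p (topFaces n d) {ω | σ ∈ survivors^[r] ω} ≤ p * branchBound n d p r +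
      bern p (topFaces n d) (coincidence σ (branchSize d r)) := by
  have h1' : p ≤ 1 := by linarith
  obtain ⟨v, hv⟩ : σ.Nonempty := card_pos.1 (by omega)
  have key : bern p (topFaces n d) {ω | σ ∈ survivors^[r] ω} ≤ bern p (topFaces n d)
      (disjointOccur {ω | {σ} ⊆ ω} (branch r (σ.erase v)) ∪ coincidence σ (branchSize d r)) := by
    refine bern_mono h0 h1' fun ω hω hs => ?_
    by_cases hno : ω ∈ coincidence σ (branchSize d r)
    · exact Or.inr hno
    · have hσω : σ ∈ ω := iterate_survivors_subset _ _ hs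
      obtain ⟨W, -, hW1, hW2, hW3, -⟩ := exists_branch hω hno r 0 {σ} σ v (by simp [treeSets])
        (by simpa using hσω) (by simp) hs hv (by simp) (by simp)
      exact Or.inl ⟨{σ}, W, hW3, by simpa using hσω, hW2, by simp, hW1⟩
  refine key.trans ((bern_union_le h0 h1' _ _).trans ?_)
  have e1 : bern p (topFaces n d) {ω | {σ} ⊆ ω} = p := by
    rw [bern_superset (by simpa using mem_topFaces.2 hσ), card_singleton, pow_one]
  have e2 := bern_disjointOccur_le (G := topFaces n d) h0 h1
    (A := {ω | {σ} ⊆ ω}) (fun a b hab h => h.trans hab) (isUpperSet_branch r (σ.erase v))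
  rw [e1] at e2
  have e3 := mul_le_mul_of_nonneg_left (bern_branch_le h0 h1 r (n := n) (d := d)
    (τ := σ.erase v) (by rw [card_erase_of_mem hv, hσ]; rfl)) h0
  linarith

/-- The expected number of simplices that survive `r` rounds. -/
theorem expect_card_survivors_le (h0 : 0 ≤ p) (h1 : p ≤ 1 / 2) (r : ℕ) :
    expect p (topFaces n d) (fun ω => ((survivors^[r] ω).card : ℝ)) ≤
      n ^ (d + 1) * (p * branchBound n d p r +
        (∑ k ∈ range (branchSize d r), (branchSize d r * (d + 1) * (n * p)) ^ k) *
          (branchSize d r * (d + 1)) ^ (d + 1) * p ^ 2) := by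
  classical
  have h1' : p ≤ 1 := by linarith
  have e1 : expect p (topFaces n d) (fun ω => ((survivors^[r] ω).card : ℝ)) =
      ∑ σ ∈ topFaces n d, bern p (topFaces n d) {ω | σ ∈ survivors^[r] ω} := by
    unfold bern
    rw [← expect_sum]
    refine expect_congr fun ω hω => ?_
    simp only [Set.indicator, Set.mem_ofPred_eq, Pi.one_apply]
    rw [sum_boole]
    congr 2
    ext σ
    simp only [mem_filter, iff_and_self]
    exact fun h => hω (iterate_survivors_subset _ _ h)
  rw [e1]
  refine (sum_le_card_nsmul _ _ _ fun σ hσ => (bern_survives_le h0 h1 (mem_topFaces.1 hσ) r).trans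
    (add_le_add_right (bern_coincidence_le h0 h1' (mem_topFaces.1 hσ) _) _)).trans ?_
  rw [nsmul_eq_mul]
  refine mul_le_mul_of_nonneg_right ?_ ?_
  · exact_mod_cast card_topFaces_le n d
  · have := (branchBound_mem (n := n) (d := d) h0 h1' r).1
    positivity

end Survival

/-! ### Cores -/

section Cores

variable {n d : ℕ} {p : ℝ}

/-- Every facet of a member of `K` lies in a further member of `K`. -/
def IsCore (K : Finset (Finset (Fin n))) : Prop :=
  ∀ σ ∈ K, ∀ v ∈ σ, ∃ σ' ∈ K, σ' ≠ σ ∧ σ.erase v ⊆ σ'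

/-- A nonempty core that contains no smaller nonempty core. -/
def IsMinCore (K : Finset (Finset (Fin n))) : Prop :=
  K.Nonempty ∧ IsCore K ∧ ∀ K' ⊆ K, K'.Nonempty → IsCore K' → K' = K

theorem IsCore.exists_isMinCore {K : Finset (Finset (Fin n))} (hne : K.Nonempty)
    (hK : IsCore K) : ∃ K' ⊆ K, IsMinCore K' := by
  induction K using Finset.strongInduction with
  | H K ih =>
    by_cases h : ∀ K' ⊆ K, K'.Nonempty → IsCore K' → K' = K
    · exact ⟨K, subset_rfl, hne, hK, h⟩
    · push Not at h
      obtain ⟨K', hsub, hne', hK', hneq⟩ := h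
      obtain ⟨K'', h1, h2⟩ := ih K' (hsub.ssubset_of_ne hneq) hne' hK'
      exact ⟨K'', h1.trans hsub, h2⟩

/-- All facets of some set of `d + 2` vertices belong to `K`. -/
def HasSimplexBoundary (d : ℕ) (K : Finset (Finset (Fin n))) : Prop :=
  ∃ T : Finset (Fin n), T.card = d + 2 ∧ ∀ v ∈ T, T.erase v ∈ K

/-- For each simplex `s` of a core, choose the further simplices over its facets. -/
theorem IsCore.exists_neighbours {K : Finset (Finset (Fin n))} (hK : IsCore K)
    (hKt : K ⊆ topFaces n d) {s : Finset (Fin n)} (hs : s ∈ K) :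
    ∃ g : Fin n → Finset (Fin n), (∀ v ∈ s, g v ∈ K ∧ s.erase v ⊆ g v ∧ v ∉ g v) ∧
      Set.InjOn g s := by
  have h : ∀ v, ∃ t, v ∈ s → t ∈ K ∧ s.erase v ⊆ t ∧ v ∉ t := by
    intro v
    by_cases hv : v ∈ s
    · obtain ⟨t, ht, hne, hsub⟩ := hK s hs v hv
      refine ⟨t, fun _ => ⟨ht, hsub, fun hvt => hne ?_⟩⟩
      refine (eq_of_subset_of_card_le (fun u hu => ?_) ?_).symm
      · by_cases huv : u = v
        · exact huv ▸ hvt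
        · exact hsub (mem_erase.2 ⟨huv, hu⟩)
      · rw [mem_topFaces.1 (hKt ht), mem_topFaces.1 (hKt hs)]
    · exact ⟨∅, fun h => absurd h hv⟩
  choose g hg using h
  refine ⟨g, hg, fun v hv v' hv' heq => ?_⟩
  by_contra hne
  exact (hg v hv).2.2 (heq ▸ (hg v' hv').2.1 (mem_erase.2 ⟨hne, hv⟩))

/-- In a core every vertex lies in at least `d + 1` simplices: one simplex `s` and its neighbours
over the facets through the vertex. Double counting then gives at least as many simplices as
vertices. With equality every star is exactly of this form, which forces the neighbours of `s` to
share one apex, so a simplex boundary appears. -/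
theorem IsCore.card_sup_lt {K : Finset (Finset (Fin n))} (hd : 2 ≤ d) (hK : IsCore K)
    (hne : K.Nonempty) (hKt : K ⊆ topFaces n d) (hb : ¬ HasSimplexBoundary d K) :
    (K.sup id).card < K.card := by
  by_contra hle
  rw [not_lt] at hle
  have hstar : ∀ s ∈ K, ∀ g : Fin n → Finset (Fin n),
      (∀ v ∈ s, g v ∈ K ∧ s.erase v ⊆ g v ∧ v ∉ g v) → Set.InjOn g s → ∀ w ∈ s,
      insert s ((s.erase w).image g) ⊆ K.filter (fun t => w ∈ t) ∧
        (insert s ((s.erase w).image g)).card = d + 1 := by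
    intro s hs g hg hinj w hw
    constructor
    · refine insert_subset (mem_filter.2 ⟨hs, hw⟩) fun t ht => ?_
      obtain ⟨v, hv, rfl⟩ := mem_image.1 ht
      obtain ⟨hvw, hvs⟩ := mem_erase.1 hv
      exact mem_filter.2 ⟨(hg v hvs).1, (hg v hvs).2.1 (mem_erase.2 ⟨Ne.symm hvw, hw⟩)⟩
    · rw [card_insert_of_notMem, card_image_of_injOn (hinj.mono (by simp)),
        card_erase_of_mem hw, mem_topFaces.1 (hKt hs)]
      · rfl
      · rw [mem_image]
        rintro ⟨v, hv, heq⟩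
        have hvs := mem_of_mem_erase hv
        exact (hg v hvs).2.2 (heq ▸ hvs)
  have hdeg : ∀ w ∈ K.sup id, d + 1 ≤ (K.filter (fun t => w ∈ t)).card := by
    intro w hw
    rw [sup_eq_biUnion, mem_biUnion] at hw
    obtain ⟨s, hs, hws⟩ := hw
    obtain ⟨g, hg, hinj⟩ := hK.exists_neighbours hKt hs
    obtain ⟨h1, h2⟩ := hstar s hs g hg hinj w hws
    exact h2.symm.le.trans (card_le_card h1)
  have hcount : ∑ w ∈ K.sup id, (K.filter (fun t => w ∈ t)).card = K.card * (d + 1) := by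
    have h := sum_card_bipartiteAbove_eq_sum_card_bipartiteBelow
      (s := K.sup id) (t := K) (fun (w : Fin n) (t : Finset (Fin n)) => w ∈ t)
    simp only [bipartiteAbove, bipartiteBelow] at h
    rw [h, ← smul_eq_mul, ← sum_const]
    refine sum_congr rfl fun t ht => ?_
    rw [← mem_topFaces.1 (hKt ht)]
    congr 1
    ext w
    simp only [mem_filter, and_iff_right_iff_imp]
    exact fun h => subset_sup_id ht h
  have hall : ∀ w ∈ K.sup id, d + 1 = (K.filter (fun t => w ∈ t)).card := by
    refine (sum_eq_sum_iff_of_le hdeg).1 (le_antisymm (sum_le_sum hdeg) ?_)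
    rw [hcount, sum_const, smul_eq_mul]
    exact Nat.mul_le_mul_right _ hle
  obtain ⟨s, hs⟩ := hne
  have hsc := mem_topFaces.1 (hKt hs)
  obtain ⟨g, hg, hinj⟩ := hK.exists_neighbours hKt hs
  have hin : ∀ w ∈ s, ∀ t ∈ K, w ∈ t → t = s ∨ ∃ u ∈ s, t = g u := by
    intro w hw t ht hwt
    obtain ⟨h1, h2⟩ := hstar s hs g hg hinj w hw
    have heq := eq_of_subset_of_card_le h1 (by rw [h2, ← hall w (subset_sup_id hs hw)])
    have : t ∈ insert s ((s.erase w).image g) := by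
      rw [heq]; exact mem_filter.2 ⟨ht, hwt⟩
    rcases mem_insert.1 this with h | h
    · exact Or.inl h
    · obtain ⟨u, hu, rfl⟩ := mem_image.1 h
      exact Or.inr ⟨u, mem_of_mem_erase hu, rfl⟩
  have hapex : ∀ v ∈ s, ∀ v' ∈ s, ∀ y ∈ g v, y ∉ s → y ∈ g v' := by
    intro v hv v' hv' y hy hys
    by_cases hvv : v = v'
    · exact hvv ▸ hy
    -- A third vertex of `s` exists because `d ≥ 2`. Its star confines the next simplex `t` over a
    -- facet through `y` to `s` and its neighbours, and only the neighbour opposite `v'` is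
    -- possible.
    obtain ⟨w, hw⟩ : ((s.erase v).erase v').Nonempty := by
      rw [← card_pos, card_erase_of_mem (mem_erase.2 ⟨Ne.symm hvv, hv'⟩),
        card_erase_of_mem hv, hsc]
      omega
    have hwv' := (mem_erase.1 hw).1
    have hwv := (mem_erase.1 (mem_erase.1 hw).2)
    have hv'g : v' ∈ g v := (hg v hv).2.1 (mem_erase.2 ⟨Ne.symm hvv, hv'⟩)
    obtain ⟨t, ht, htne, hsub⟩ := hK (g v) (hg v hv).1 v' hv'g
    have hwt : w ∈ t := hsub (mem_erase.2 ⟨hwv', (hg v hv).2.1 (mem_erase.2 hwv)⟩)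
    have hyt : y ∈ t := hsub (mem_erase.2 ⟨fun h => hys (h ▸ hv'), hy⟩)
    rcases hin w hwv.2 t ht hwt with rfl | ⟨u, hu, rfl⟩
    · exact absurd hyt hys
    · have huv : u ≠ v := fun h => htne (h ▸ rfl)
      by_cases huv' : u = v'
      · exact huv' ▸ hyt
      · exact absurd (hsub (mem_erase.2 ⟨huv', (hg v hv).2.1 (mem_erase.2 ⟨huv, hu⟩)⟩))
          (hg u hu).2.2
  obtain ⟨v₀, hv₀⟩ : s.Nonempty := card_pos.1 (by omega)
  obtain ⟨y, hy, hys⟩ : ∃ y ∈ g v₀, y ∉ s := by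
    by_contra hcon
    push Not at hcon
    have : g v₀ = s := eq_of_subset_of_card_le hcon
      (by rw [hsc, mem_topFaces.1 (hKt (hg v₀ hv₀).1)])
    exact (hg v₀ hv₀).2.2 (this ▸ hv₀)
  refine hb ⟨insert y s, by rw [card_insert_of_notMem hys, hsc], fun v hv => ?_⟩
  rcases mem_insert.1 hv with rfl | hv
  · rwa [erase_insert hys]
  · have hyv : y ≠ v := fun h => hys (h ▸ hv)
    rw [erase_insert_of_ne hyv]
    have : insert y (s.erase v) = g v := by
      refine eq_of_subset_of_card_le
        (insert_subset (hapex v₀ hv₀ v hv y hy hys) (hg v hv).2.1) ?_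
      rw [card_insert_of_notMem (fun h => hys (mem_of_mem_erase h)), card_erase_of_mem hv, hsc,
        mem_topFaces.1 (hKt (hg v hv).1)]
      rfl
    rw [this]
    exact (hg v hv).1

/-! ### Exploring a minimal core -/

/-- `τ` is a facet of exactly one member of `S`. -/
def IsFreeFacet (S : Finset (Finset (Fin n))) (τ : Finset (Fin n)) : Prop :=
  ∃ σ ∈ S, ∃ v ∈ σ, τ = σ.erase v ∧ ∀ σ' ∈ S, τ ⊆ σ' → σ' = σ

open scoped Classical in
/-- A chosen free facet of `S`. -/
noncomputable def freeFacet (S : Finset (Finset (Fin n))) : Finset (Fin n) :=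
  if h : ∃ τ, IsFreeFacet S τ then h.choose else ∅

/-- Attach to the chosen free facet the simplex with the further vertex `x`. -/
noncomputable def attach (S : Finset (Finset (Fin n))) (x : Fin n) :
    Finset (Finset (Fin n)) := insert (insert x (freeFacet S)) S

theorem isFreeFacet_freeFacet {S : Finset (Finset (Fin n))}
    (hS : ¬ IsCore S) : IsFreeFacet S (freeFacet S) := by
  have h : ∃ τ, IsFreeFacet S τ := by
    unfold IsCore at hS
    push Not at hS
    obtain ⟨σ, hσ, v, hv, h⟩ := hS
    refine ⟨σ.erase v, σ, hσ, v, hv, rfl, fun σ' hσ' hsub => ?_⟩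
    by_contra hcon
    exact h σ' hσ' hcon hsub
  rw [freeFacet, dif_pos h]
  exact h.choose_spec

/-- `S 0 ⊂ S 1 ⊂ ⋯` exhausts `K` by attaching the vertices `x 0, x 1, …`. -/
structure IsTrace (d : ℕ) (K : Finset (Finset (Fin n))) (S : ℕ → Finset (Finset (Fin n)))
    (x : ℕ → Fin n) : Prop where
  start : ∃ σ ∈ K, S 0 = {σ}
  sub : ∀ i < K.card, S i ⊆ K ∧ (S i).card = i + 1
  step : ∀ i, i + 1 < K.card → IsFreeFacet (S i) (freeFacet (S i)) ∧
    (freeFacet (S i)).card = d ∧ x i ∉ freeFacet (S i) ∧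
    insert (x i) (freeFacet (S i)) ∉ S i ∧ S (i + 1) = attach (S i) (x i)

theorem IsTrace.last {K : Finset (Finset (Fin n))} {S : ℕ → Finset (Finset (Fin n))}
    {x : ℕ → Fin n} (h : IsTrace d K S x) : S (K.card - 1) = K := by
  have hpos : 0 < K.card := by
    obtain ⟨σ, hσ, -⟩ := h.start
    exact card_pos.2 ⟨σ, hσ⟩
  obtain ⟨h1, h2⟩ := h.sub (K.card - 1) (by omega)
  exact eq_of_subset_of_card_le h1 (by omega)

/-- Minimality is used exactly here: a nonempty proper subfamily is not a core, so it has a free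
facet, over which the whole core must contain another simplex. -/
theorem IsMinCore.exists_attach {K S : Finset (Finset (Fin n))} (hK : IsMinCore K)
    (hKt : K ⊆ topFaces n d) (hne : S.Nonempty) (hS : S ⊂ K) :
    IsFreeFacet S (freeFacet S) ∧ (freeFacet S).card = d ∧
      ∃ x ∉ freeFacet S, insert x (freeFacet S) ∈ K \ S := by
  have hfree := isFreeFacet_freeFacet fun h => hS.ne (hK.2.2 S hS.subset hne h)
  obtain ⟨σ, hσ, v, hv, hτ, huniq⟩ := id hfree
  have hcard : (freeFacet S).card = d := by
    rw [hτ, card_erase_of_mem hv, mem_topFaces.1 (hKt (hS.subset hσ))]; rfl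
  refine ⟨hfree, hcard, ?_⟩
  obtain ⟨σ', hσ', hne', hsub⟩ := hK.2.1 σ (hS.subset hσ) v hv
  rw [← hτ] at hsub
  have hc' := mem_topFaces.1 (hKt hσ')
  obtain ⟨x, hx, hxτ⟩ : ∃ x ∈ σ', x ∉ freeFacet S := by
    by_contra hcon
    push Not at hcon
    have := card_le_card (show σ' ⊆ freeFacet S from hcon)
    omega
  have heq : insert x (freeFacet S) = σ' :=
    eq_of_subset_of_card_le (insert_subset hx hsub)
      (by rw [card_insert_of_notMem hxτ, hcard, hc'])
  exact ⟨x, hxτ, by rw [heq, mem_sdiff]; exact ⟨hσ', fun h => hne' (huniq σ' h hsub)⟩⟩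

theorem IsMinCore.exists_isTrace {K : Finset (Finset (Fin n))} (hK : IsMinCore K)
    (hKt : K ⊆ topFaces n d) : ∃ S x, IsTrace d K S x := by
  classical
  obtain ⟨σ₀, hσ₀⟩ := hK.1
  have hn : Nonempty (Fin n) := by
    by_contra hcon
    rw [not_nonempty_iff] at hcon
    have := mem_topFaces.1 (hKt hσ₀)
    rw [Finset.eq_empty_of_isEmpty σ₀] at this
    simp at this
  have hx : ∀ S : Finset (Finset (Fin n)), ∃ x, S.Nonempty → S ⊂ K →
      x ∉ freeFacet S ∧ insert x (freeFacet S) ∈ K \ S := by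
    intro S
    by_cases h : S.Nonempty ∧ S ⊂ K
    · obtain ⟨-, -, x, h1, h2⟩ := hK.exists_attach hKt h.1 h.2
      exact ⟨x, fun _ _ => ⟨h1, h2⟩⟩
    · exact ⟨Classical.arbitrary _, fun h1 h2 => absurd ⟨h1, h2⟩ h⟩
  choose X hX using hx
  -- The next vertex is a function of the current family alone, so the exploration is an iteration.
  set S : ℕ → Finset (Finset (Fin n)) := fun i => (fun T => attach T (X T))^[i] {σ₀} with hS
  have hsucc : ∀ i, S (i + 1) = attach (S i) (X (S i)) := fun i =>
    Function.iterate_succ_apply' _ _ _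
  have hprop : ∀ T : Finset (Finset (Fin n)), T ⊆ K → T.card < K.card → T ⊂ K :=
    fun T h1 h2 => h1.ssubset_of_ne fun h => by rw [h] at h2; omega
  have hsub : ∀ i < K.card, S i ⊆ K ∧ (S i).card = i + 1 := by
    intro i
    induction i with
    | zero => intro _; simpa [hS] using hσ₀
    | succ i ih =>
      intro hi
      obtain ⟨h1, h2⟩ := ih (by omega)
      have hne : (S i).Nonempty := card_pos.1 (by omega)
      obtain ⟨-, h3⟩ := hX (S i) hne (hprop _ h1 (by omega))
      rw [mem_sdiff] at h3
      rw [hsucc, attach, card_insert_of_notMem h3.2, h2]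
      exact ⟨insert_subset h3.1 h1, rfl⟩
  refine ⟨S, fun i => X (S i), ⟨σ₀, hσ₀, rfl⟩, hsub, fun i hi => ?_⟩
  obtain ⟨h1, h2⟩ := hsub i (by omega)
  have hne : (S i).Nonempty := card_pos.1 (by omega)
  have hss := hprop _ h1 (by omega)
  obtain ⟨h3, h4⟩ := hX (S i) hne hss
  obtain ⟨h5, h6, -⟩ := hK.exists_attach hKt hne hss
  exact ⟨h5, h6, h3, (mem_sdiff.1 h4).2, hsucc i⟩

open scoped Classical in
/-- What can be reached from `S` in `r` steps, at least `q` of which are marked by `P`. -/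
noncomputable def reach (P : Finset (Finset (Fin n)) → Fin n → Prop) :
    ℕ → ℕ → Finset (Finset (Fin n)) → Finset (Finset (Finset (Fin n)))
  | 0, 0, S => {S}
  | 0, _ + 1, _ => ∅
  | r + 1, q, S => ((univ.filter fun x => ¬ P S x).biUnion fun x => reach P r q (attach S x)) ∪
      (univ.filter fun x => P S x).biUnion fun x => reach P r (q - 1) (attach S x)

-- The base `2 * n` pays for deciding whether a step is marked and for the vertex; each marked step
-- saves a factor `κ`.
open scoped Classical in
theorem card_reach_le {P : Finset (Finset (Fin n)) → Fin n → Prop} {κ : ℝ} (hκ0 : 0 ≤ κ)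
    (hκ1 : κ ≤ 1) {m : ℕ}
    (hP : ∀ S : Finset (Finset (Fin n)), S.card ≤ m →
      ((univ.filter fun x => P S x).card : ℝ) ≤ κ * n) (r q : ℕ)
    (S : Finset (Finset (Fin n))) (hS : S.card + r ≤ m) :
    ((reach P r q S).card : ℝ) ≤ (2 * n) ^ r * κ ^ q := by
  induction r generalizing q S with
  | zero =>
    cases q with
    | zero => simp [reach]
    | succ q => simpa [reach] using pow_nonneg hκ0 _
  | succ r ih =>
    have hatt : ∀ x, (attach S x).card + r ≤ m := fun x => by
      have := card_insert_le (insert x (freeFacet S)) S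
      simp only [attach]
      omega
    have h1 : (((univ.filter fun x => ¬ P S x).biUnion
        fun x => reach P r q (attach S x)).card : ℝ) ≤ n * ((2 * n) ^ r * κ ^ q) := by
      have hc : (((univ.filter fun x => ¬ P S x).biUnion
          fun x => reach P r q (attach S x)).card : ℝ) ≤
          ∑ x ∈ univ.filter fun x => ¬ P S x, ((reach P r q (attach S x)).card : ℝ) := by
        exact_mod_cast card_biUnion_le
      refine hc.trans ((sum_le_card_nsmul _ _ _ fun x _ => ih q _ (hatt x)).trans ?_)
      rw [nsmul_eq_mul]
      refine mul_le_mul_of_nonneg_right ?_ (by positivity)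
      exact_mod_cast (card_le_univ _).trans_eq (Fintype.card_fin n)
    have h2 : (((univ.filter fun x => P S x).biUnion
        fun x => reach P r (q - 1) (attach S x)).card : ℝ) ≤ n * ((2 * n) ^ r * κ ^ q) := by
      have hc : (((univ.filter fun x => P S x).biUnion
          fun x => reach P r (q - 1) (attach S x)).card : ℝ) ≤
          ∑ x ∈ univ.filter fun x => P S x, ((reach P r (q - 1) (attach S x)).card : ℝ) := by
        exact_mod_cast card_biUnion_le
      refine hc.trans ((sum_le_card_nsmul _ _ _ fun x _ => ih (q - 1) _ (hatt x)).trans ?_)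
      rw [nsmul_eq_mul]
      refine (mul_le_mul_of_nonneg_right (hP S (by omega)) (by positivity)).trans ?_
      -- At `q = 0` the truncated `q - 1` is again zero, and the inequality is then just `κ ≤ 1`.
      have : κ * κ ^ (q - 1) ≤ κ ^ q := by
        cases q with
        | zero => simpa using hκ1
        | succ q => rw [pow_succ']; rfl
      calc κ * n * ((2 * n) ^ r * κ ^ (q - 1)) = n * ((2 * n) ^ r * (κ * κ ^ (q - 1))) := by ring
        _ ≤ _ := by gcongr
    simp only [reach]
    refine (Nat.cast_le.2 (card_union_le _ _)).trans ?_
    rw [Nat.cast_add]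
    exact (add_le_add h1 h2).trans_eq (by ring)

open scoped Classical in
theorem mem_reach {P : Finset (Finset (Fin n)) → Fin n → Prop}
    {S : ℕ → Finset (Finset (Fin n))} {x : ℕ → Fin n} (r : ℕ) (i q : ℕ)
    (hstep : ∀ j, i ≤ j → j < i + r → S (j + 1) = attach (S j) (x j))
    (hq : q ≤ ((Ico i (i + r)).filter fun j => P (S j) (x j)).card) :
    S (i + r) ∈ reach P r q (S i) := by
  induction r generalizing i q with
  | zero =>
    have : q = 0 := by simpa using hq
    subst this
    simp [reach]
  | succ r ih =>
    have hI : Ico i (i + (r + 1)) = insert i (Ico (i + 1) (i + 1 + r)) := by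
      ext j; simp only [mem_Ico, mem_insert]; omega
    have hni : i ∉ (Ico (i + 1) (i + 1 + r)).filter fun j => P (S j) (x j) := by simp
    have heq : i + (r + 1) = i + 1 + r := by omega
    have h0 := hstep i le_rfl (by omega)
    rw [hI, filter_insert] at hq
    simp only [reach, mem_union, mem_biUnion, mem_filter, mem_univ, true_and]
    have hstep' : ∀ j, i + 1 ≤ j → j < i + 1 + r → S (j + 1) = attach (S j) (x j) :=
      fun j h1 h2 => hstep j (by omega) (by omega)
    by_cases hP : P (S i) (x i)
    · rw [if_pos hP, card_insert_of_notMem hni] at hq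
      refine Or.inr ⟨x i, hP, ?_⟩
      rw [← h0, heq]
      exact ih (i + 1) (q - 1) hstep' (by omega)
    · rw [if_neg hP] at hq
      refine Or.inl ⟨x i, hP, ?_⟩
      rw [← h0, heq]
      exact ih (i + 1) q hstep' hq

open scoped Classical in
/-- First moment bound for minimal cores with many marked steps. -/
theorem bern_minCore_le (h0 : 0 ≤ p) (h1 : p ≤ 1)
    {P : Finset (Finset (Fin n)) → Fin n → Prop} {κ : ℝ} (hκ0 : 0 ≤ κ) (hκ1 : κ ≤ 1) {m : ℕ}
    (hP : ∀ S : Finset (Finset (Fin n)), S.card ≤ m →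
      ((univ.filter fun x => P S x).card : ℝ) ≤ κ * n) (q : ℕ)
    (C : Set (Finset (Finset (Fin n))))
    (hC : ∀ K ∈ C, K ⊆ topFaces n d → IsMinCore K → K.card = m → ∃ S x, IsTrace d K S x ∧
      q ≤ ((range (m - 1)).filter fun j => P (S j) (x j)).card) :
    bern p (topFaces n d) {ω | ∃ K ⊆ ω, IsMinCore K ∧ K.card = m ∧ K ∈ C} ≤
      n ^ (d + 1) * ((2 * n) ^ (m - 1) * κ ^ q * p ^ m) := by
  -- Minimal cores are nonempty, so for `m = 0` the event is covered by an empty union.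
  rcases Nat.eq_zero_or_pos m with rfl | hm
  · have hz : bern p (topFaces n d) {ω | ∃ K ⊆ ω, IsMinCore K ∧ K.card = 0 ∧ K ∈ C} ≤
        ∑ i ∈ (∅ : Finset ℕ), bern p (topFaces n d) ((fun _ => Set.univ) i) := by
      refine bern_le_sum h0 h1 _ _ _ ?_
      rintro ω - ⟨K, -, hK, hc, -⟩
      exact absurd (card_eq_zero.1 hc) hK.1.ne_empty
    rw [sum_empty] at hz
    exact hz.trans (by positivity)
  have e1 : bern p (topFaces n d) {ω | ∃ K ⊆ ω, IsMinCore K ∧ K.card = m ∧ K ∈ C} ≤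
      ∑ σ ∈ topFaces n d, ∑ K ∈ (reach P (m - 1) q {σ}).filter
        (fun K => K ⊆ topFaces n d ∧ K.card = m), bern p (topFaces n d) {ω | K ⊆ ω} := by
    refine (bern_le_sum h0 h1 (topFaces n d) _ (fun σ => {ω | ∃ K ∈ (reach P (m - 1) q
      {σ}).filter (fun K => K ⊆ topFaces n d ∧ K.card = m), K ⊆ ω}) ?_).trans ?_
    · rintro ω hω ⟨K, hKω, hK, hc, hKC⟩
      have hKt := hKω.trans hω
      obtain ⟨S, x, hT, hq⟩ := hC K hKC hKt hK hc
      obtain ⟨σ, hσ, hS0⟩ := hT.start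
      refine ⟨σ, hKt hσ, K, mem_filter.2 ⟨?_, hKt, hc⟩, hKω⟩
      have := mem_reach (P := P) (S := S) (x := x) (m - 1) 0 q
        (fun j _ hj => (hT.step j (by omega)).2.2.2.2) (by rw [zero_add, ← range_eq_Ico]; exact hq)
      rwa [zero_add, hS0, ← hc, hT.last, hc] at this
    · refine sum_le_sum fun σ _ => bern_le_sum h0 h1 _ _ _ ?_
      rintro ω - ⟨K, hK, h⟩
      exact ⟨K, hK, h⟩
  refine e1.trans ?_
  have e2 : ∀ σ ∈ topFaces n d, ∑ K ∈ (reach P (m - 1) q {σ}).filter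
      (fun K => K ⊆ topFaces n d ∧ K.card = m), bern p (topFaces n d) {ω | K ⊆ ω} ≤
      (2 * n) ^ (m - 1) * κ ^ q * p ^ m := by
    intro σ _
    have e3 : ∀ K ∈ (reach P (m - 1) q {σ}).filter
        (fun K => K ⊆ topFaces n d ∧ K.card = m),
        bern p (topFaces n d) {ω | K ⊆ ω} = p ^ m := by
      intro K hK
      obtain ⟨-, h2, h3⟩ := mem_filter.1 hK
      rw [bern_superset h2, h3]
    rw [sum_congr rfl e3, sum_const, nsmul_eq_mul]
    refine mul_le_mul_of_nonneg_right ?_ (by positivity)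
    refine le_trans ?_ (card_reach_le hκ0 hκ1 hP (m - 1) q {σ} (by rw [card_singleton]; omega))
    exact_mod_cast card_filter_le _ _
  refine (sum_le_card_nsmul _ _ _ e2).trans ?_
  rw [nsmul_eq_mul]
  refine mul_le_mul_of_nonneg_right ?_ (by positivity)
  exact_mod_cast card_topFaces_le n d

/-! ### Small cores -/

theorem IsFreeFacet.subset_sup {S : Finset (Finset (Fin n))} {τ : Finset (Fin n)}
    (h : IsFreeFacet S τ) : τ ⊆ S.sup id := by
  obtain ⟨σ, hσ, v, -, rfl, -⟩ := h
  exact (erase_subset _ _).trans (subset_sup_id hσ)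

-- The start has `d + 1` vertices and each step adds one vertex unless it reuses an old one. A core
-- with more simplices than vertices therefore needs at least `d + 1` reuses.
open scoped Classical in
theorem IsTrace.card_old_vertices {K : Finset (Finset (Fin n))} (hd : 2 ≤ d)
    (hK : IsMinCore K) (hKt : K ⊆ topFaces n d) (hb : ¬ HasSimplexBoundary d K)
    {S : ℕ → Finset (Finset (Fin n))} {x : ℕ → Fin n} (hT : IsTrace d K S x) :
    d + 1 ≤ ((range (K.card - 1)).filter fun j => x j ∈ (S j).sup id).card := by
  have key : ∀ i < K.card, ((S i).sup id).card +
      ((range i).filter fun j => x j ∈ (S j).sup id).card = d + 1 + i := by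
    intro i
    induction i with
    | zero =>
      intro _
      obtain ⟨σ, hσ, h⟩ := hT.start
      rw [h]
      simpa using mem_topFaces.1 (hKt hσ)
    | succ i ih =>
      intro hi
      have h1 := ih (by omega)
      obtain ⟨hfree, -, -, -, hS⟩ := hT.step i hi
      have hsup : (S (i + 1)).sup id = insert (x i) ((S i).sup id) := by
        rw [hS, attach, sup_insert]
        simp only [id, sup_eq_union]
        rw [insert_union, union_eq_right.2 hfree.subset_sup]
      rw [hsup, range_add_one, filter_insert]
      by_cases hx : x i ∈ (S i).sup id
      · rw [if_pos hx, insert_eq_of_mem hx, card_insert_of_notMem (s := filter _ _) (by simp)]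
        omega
      · rw [if_neg hx, card_insert_of_notMem hx]
        omega
  have hpos := card_pos.2 hK.1
  have h1 := key (K.card - 1) (by omega)
  rw [hT.last] at h1
  have h2 := hK.2.1.card_sup_lt hd hK.1 hKt hb
  omega

/-- There are at most `M * (d + 1)` old vertices, and the `d + 1` forced reuses each gain this
number divided by `n`. Together they cancel the `n ^ (d + 1)` choices of the starting simplex. -/
theorem bern_smallCore_le (hd : 2 ≤ d) (h0 : 0 ≤ p) (h1 : p ≤ 1) {m M : ℕ} (hmM : m ≤ M)
    (hM : M * (d + 1) ≤ n) :
    bern p (topFaces n d)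
        {ω | ∃ K ⊆ ω, IsMinCore K ∧ K.card = m ∧ ¬ HasSimplexBoundary d K} ≤
      n ^ (d + 1) * ((2 * n) ^ (m - 1) * (M * (d + 1) / n) ^ (d + 1) * p ^ m) := by
  classical
  rcases Nat.eq_zero_or_pos n with rfl | hn
  · have hz : bern p (topFaces 0 d)
        {ω | ∃ K ⊆ ω, IsMinCore K ∧ K.card = m ∧ ¬ HasSimplexBoundary d K} ≤
        ∑ i ∈ (∅ : Finset ℕ), bern p (topFaces 0 d) ((fun _ => Set.univ) i) := by
      refine bern_le_sum h0 h1 _ _ _ ?_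
      rintro ω hω ⟨K, hK, ⟨⟨s, hs⟩, -⟩, -⟩
      have := mem_topFaces.1 (hω (hK hs))
      rw [Finset.eq_empty_of_isEmpty s] at this
      simp at this
    rw [sum_empty] at hz
    exact hz.trans (by positivity)
  have hn' : (0 : ℝ) < n := by exact_mod_cast hn
  -- Marking only inside `topFaces` makes the bound on old vertices valid for every family, not just
  -- for those met along a trace.
  obtain ⟨P, hPdef⟩ : ∃ P : Finset (Finset (Fin n)) → Fin n → Prop,
      ∀ S x, P S x ↔ S ⊆ topFaces n d ∧ x ∈ S.sup id := ⟨_, fun _ _ => Iff.rfl⟩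
  refine bern_minCore_le h0 h1 (P := P)
    (by positivity) ?_ (m := m) ?_ (d + 1) {K | ¬ HasSimplexBoundary d K} ?_
  · rw [div_le_one hn']
    exact_mod_cast hM
  · intro S hS
    rw [div_mul_cancel₀ _ hn'.ne']
    by_cases hSt : S ⊆ topFaces n d
    · have h2 : (univ.filter fun x => P S x) = S.sup id := by
        ext x; simp only [mem_filter, mem_univ, true_and, hPdef, hSt]
      rw [h2]
      have := (card_sup_id_le hSt).trans (Nat.mul_le_mul_right (d + 1) (hS.trans hmM))
      exact_mod_cast this
    · simp only [hPdef, hSt, false_and, filter_false, card_empty, Nat.cast_zero]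
      positivity
  · rintro K hb hKt hK rfl
    obtain ⟨S, x, hT⟩ := hK.exists_isTrace hKt
    refine ⟨S, x, hT, (hT.card_old_vertices hd hK hKt hb).trans_eq ?_⟩
    congr 1
    refine filter_congr fun j hj => ?_
    rw [mem_range] at hj
    simp only [hPdef, (hT.sub j (by omega)).1.trans hKt, true_and]

end Cores

/-! ### Heavy faces -/

section Heavy

variable {n d : ℕ} {η : ℝ}

/-- The density above which a face with `k` vertices is heavy. -/
noncomputable def density (d : ℕ) (η : ℝ) (k : ℕ) : ℝ := η ^ 3 ^ (d - k)

/-- The degree above which a face with `k` vertices is heavy. -/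
noncomputable def threshold (n d : ℕ) (η : ℝ) (k : ℕ) : ℝ := density d η k * (n : ℝ) ^ (d - k)

theorem density_pos (hη : 0 < η) (k : ℕ) : 0 < density d η k := pow_pos hη _

theorem density_le_one (hη : 0 < η) (hη1 : η ≤ 1) (k : ℕ) : density d η k ≤ 1 :=
  pow_le_one₀ hη.le hη1

theorem density_mono (hη : 0 < η) (hη1 : η ≤ 1) {k l : ℕ} (h : k ≤ l) :
    density d η k ≤ density d η l :=
  pow_le_pow_of_le_one hη.le hη1 (Nat.pow_le_pow_right (by norm_num) (by omega))

/-- This is why the exponents are powers of three: `3 ^ (e + 1) ≥ 1 + 2 * 3 ^ e`. Marked steps need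
only one of the two density factors on the right; counting scattered facets needs both. -/
theorem density_le_mul_sq (hη : 0 < η) (hη1 : η ≤ 1) {k : ℕ} (hk : k < d) :
    density d η k ≤ η * density d η (k + 1) ^ 2 := by
  obtain ⟨e, rfl⟩ : ∃ e, d = k + 1 + e := ⟨d - (k + 1), by omega⟩
  rw [density, density, ← pow_mul, ← pow_succ', show k + 1 + e - k = e + 1 by omega,
    show k + 1 + e - (k + 1) = e by omega]
  refine pow_le_pow_of_le_one hη.le hη1 ?_
  have : 1 ≤ 3 ^ e := Nat.one_le_pow _ _ (by norm_num)
  rw [pow_succ]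
  omega

theorem threshold_pos (hη : 0 < η) (hn : 0 < n) (k : ℕ) : 0 < threshold n d η k :=
  mul_pos (density_pos hη k) (pow_pos (by exact_mod_cast hn) _)

theorem threshold_self (k : ℕ) (hk : d ≤ k) : threshold n d η k = η := by
  simp [threshold, density, Nat.sub_eq_zero_of_le hk]

theorem threshold_le_mul (hη : 0 < η) (hη1 : η ≤ 1) {k : ℕ} (hk : k < d) :
    threshold n d η k ≤ η * n * threshold n d η (k + 1) := by
  have h1 := density_le_mul_sq hη hη1 hk
  have h2 := density_le_one (d := d) hη hη1 (k + 1)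
  have h3 := (density_pos (d := d) hη (k + 1)).le
  obtain ⟨e, he⟩ : ∃ e, d - k = e + 1 := ⟨d - k - 1, by omega⟩
  have he' : d - (k + 1) = e := by omega
  rw [threshold, threshold, he, he', pow_succ]
  calc density d η k * ((n : ℝ) ^ e * n) ≤ η * density d η (k + 1) ^ 2 * ((n : ℝ) ^ e * n) := by
        gcongr
    _ = η * n * (density d η (k + 1) * (n : ℝ) ^ e) * density d η (k + 1) := by ring
    _ ≤ η * n * (density d η (k + 1) * (n : ℝ) ^ e) * 1 := by gcongr
    _ = _ := mul_one _

/-- One attachment adds at most `d + 1` to a degree, so a face that has just become heavy has at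
most twice its threshold degree. -/
theorem le_threshold (hη : 0 < η) (hη1 : η ≤ 1) {k : ℕ} (hk : k < d)
    (hn : ((d : ℝ) + 1) ≤ η ^ 3 ^ d * n) : (d : ℝ) + 1 ≤ threshold n d η k := by
  have h1 : density d η 0 ≤ density d η k := density_mono hη hη1 (Nat.zero_le k)
  have hn1 : (1 : ℝ) ≤ n := by
    have hpos : 0 < n := by
      rcases Nat.eq_zero_or_pos n with rfl | h
      · simp only [Nat.cast_zero, mul_zero] at hn
        have : (0 : ℝ) ≤ d := Nat.cast_nonneg d
        linarith
      · exact h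
    exact_mod_cast hpos
  have h2 : (n : ℝ) ≤ (n : ℝ) ^ (d - k) := le_self_pow₀ hn1 (by omega)
  have h3 := (density_pos (d := d) hη 0).le
  refine hn.trans ?_
  rw [threshold]
  exact mul_le_mul h1 h2 (by positivity) (h3.trans h1)

/-! ### Degrees of faces and marked steps -/

/-- The number of facets of members of `S` that contain `ρ`. -/
def faceDegree (S : Finset (Finset (Fin n))) (ρ : Finset (Fin n)) : ℕ :=
  ((shadow S).filter fun τ => ρ ⊆ τ).card

/-- `ρ` lies in many facets of members of `S`. -/
def IsHeavy (d : ℕ) (η : ℝ) (S : Finset (Finset (Fin n))) (ρ : Finset (Fin n)) : Prop :=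
  threshold n d η ρ.card ≤ faceDegree S ρ

theorem faceDegree_mono {S S' : Finset (Finset (Fin n))} (h : S ⊆ S') (ρ : Finset (Fin n)) :
    faceDegree S ρ ≤ faceDegree S' ρ :=
  card_le_card (filter_subset_filter _ (shadow_monotone h))

theorem IsHeavy.mono {S S' : Finset (Finset (Fin n))} (h : S ⊆ S') {ρ : Finset (Fin n)}
    (hρ : IsHeavy d η S ρ) : IsHeavy d η S' ρ :=
  hρ.trans (by exact_mod_cast faceDegree_mono h ρ)

theorem card_of_mem_shadow {S : Finset (Finset (Fin n))} (hS : S ⊆ topFaces n d)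
    {τ : Finset (Fin n)} (hτ : τ ∈ shadow S) : τ.card = d := by
  obtain ⟨s, hs, a, ha, rfl⟩ := mem_shadow_iff.1 hτ
  rw [card_erase_of_mem ha, mem_topFaces.1 (hS hs)]; rfl

theorem card_shadow_le {S : Finset (Finset (Fin n))} (hS : S ⊆ topFaces n d) :
    (shadow S).card ≤ S.card * (d + 1) := by
  rw [shadow, sup_eq_biUnion]
  exact card_biUnion_le_card_mul _ _ _ fun s hs =>
    card_image_le.trans (mem_topFaces.1 (hS hs)).le

/-- At the top level the threshold is `η ≤ 1`, so one incidence is enough. This makes every facet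
already present heavy, which later certifies that unmarked steps create new facets. -/
theorem isHeavy_of_mem_shadow {S : Finset (Finset (Fin n))} (hS : S ⊆ topFaces n d)
    (hη1 : η ≤ 1) {τ : Finset (Fin n)} (hτ : τ ∈ shadow S) : IsHeavy d η S τ := by
  rw [IsHeavy, threshold_self _ (card_of_mem_shadow hS hτ).ge]
  have : 1 ≤ faceDegree S τ := card_pos.2 ⟨τ, mem_filter.2 ⟨hτ, subset_rfl⟩⟩
  exact hη1.trans (by exact_mod_cast this)

/-- Counting incidences between a family of faces containing `ρ` and the facets over `ρ`. -/
theorem sum_faceDegree_le {S : Finset (Finset (Fin n))} (ρ : Finset (Fin n)) {ι : Type*}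
    (R : Finset ι) (β : ι → Finset (Fin n)) (hR : ∀ i ∈ R, ρ ⊆ β i) {k : ℕ}
    (hk : ∀ τ ∈ shadow S, (R.filter fun i => β i ⊆ τ).card ≤ k) :
    ∑ i ∈ R, faceDegree S (β i) ≤ k * faceDegree S ρ := by
  have h1 : ∀ i ∈ R, faceDegree S (β i) =
      (((shadow S).filter fun τ => ρ ⊆ τ).filter fun τ => β i ⊆ τ).card := by
    intro i hi
    rw [filter_filter, faceDegree]
    congr 1
    exact filter_congr fun τ _ => ⟨fun h => ⟨(hR i hi).trans h, h⟩, fun h => h.2⟩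
  have h2 := sum_card_bipartiteAbove_eq_sum_card_bipartiteBelow
    (s := R) (t := (shadow S).filter fun τ => ρ ⊆ τ) (fun i τ => β i ⊆ τ)
  simp only [bipartiteAbove, bipartiteBelow] at h2
  rw [sum_congr rfl h1, h2, mul_comm, faceDegree, ← smul_eq_mul]
  exact sum_le_card_nsmul _ _ _ fun τ hτ => hk τ (mem_filter.1 hτ).1

/-- A facet has `d` vertices and is counted at most once for each of its subsets. -/
theorem sum_faceDegree_le_two_pow {S : Finset (Finset (Fin n))} (hS : S ⊆ topFaces n d)
    (ρ : Finset (Fin n)) (R : Finset (Finset (Fin n))) (hR : ∀ β ∈ R, ρ ⊆ β) :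
    ∑ β ∈ R, faceDegree S β ≤ 2 ^ d * faceDegree S ρ := by
  refine sum_faceDegree_le ρ R id hR fun τ hτ => ?_
  rw [← card_of_mem_shadow hS hτ, ← card_powerset]
  exact card_le_card fun β hβ => mem_powerset.2 (mem_filter.1 hβ).2

theorem faceDegree_empty (S : Finset (Finset (Fin n))) : faceDegree S ∅ = (shadow S).card := by
  simp [faceDegree]

/-- A new vertex `x` for the chosen free facet that makes a light face heavy. -/
def IsMarked (d : ℕ) (η : ℝ) (S : Finset (Finset (Fin n))) (x : Fin n) : Prop :=
  S ⊆ topFaces n d ∧ (freeFacet S).card = d ∧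
    ∃ ρ ⊆ freeFacet S, ¬ IsHeavy d η S ρ ∧ x ∉ ρ ∧ IsHeavy d η S (insert x ρ)

-- Each heavy extension consumes its threshold of facets over `ρ`, each facet is used at most `d`
-- times, and a light `ρ` has few facets. The ratio of consecutive thresholds gives the factor `η *
-- n`.
open scoped Classical in
theorem card_heavy_extensions_le (hη : 0 < η) (hη1 : η ≤ 1) (hn : 0 < n)
    {S : Finset (Finset (Fin n))} (hS : S ⊆ topFaces n d) {ρ : Finset (Fin n)}
    (hρ : ¬ IsHeavy d η S ρ) :
    ((univ.filter fun x => x ∉ ρ ∧ IsHeavy d η S (insert x ρ)).card : ℝ) ≤ d * η * n := by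
  set X := univ.filter fun x => x ∉ ρ ∧ IsHeavy d η S (insert x ρ) with hX
  rcases X.eq_empty_or_nonempty with hE | ⟨x₀, hx₀⟩
  · rw [hE]; simp only [card_empty, Nat.cast_zero]; positivity
  have hmem : ∀ x ∈ X, x ∉ ρ ∧ IsHeavy d η S (insert x ρ) := fun x hx => (mem_filter.1 hx).2
  have hlt : ρ.card < d := by
    obtain ⟨h1, h2⟩ := hmem x₀ hx₀
    have h3 : (0 : ℝ) < faceDegree S (insert x₀ ρ) := (threshold_pos hη hn _).trans_le h2
    have h4 : 0 < faceDegree S (insert x₀ ρ) := by exact_mod_cast h3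
    obtain ⟨τ, hτ⟩ := card_pos.1 h4
    obtain ⟨hτ1, hτ2⟩ := mem_filter.1 hτ
    have h5 := card_le_card hτ2
    rw [card_insert_of_notMem h1, card_of_mem_shadow hS hτ1] at h5
    omega
  have hsum : ∑ x ∈ X, faceDegree S (insert x ρ) ≤ d * faceDegree S ρ := by
    refine sum_faceDegree_le ρ X (fun x => insert x ρ) (fun x _ => subset_insert _ _)
      fun τ hτ => ?_
    rw [← card_of_mem_shadow hS hτ]
    exact card_le_card fun x hx => (mem_filter.1 hx).2 (mem_insert_self _ _)
  have hsum' : (∑ x ∈ X, (faceDegree S (insert x ρ) : ℝ)) ≤ d * faceDegree S ρ := by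
    exact_mod_cast hsum
  have hlow : X.card * threshold n d η (ρ.card + 1) ≤
      ∑ x ∈ X, (faceDegree S (insert x ρ) : ℝ) := by
    rw [← nsmul_eq_mul]
    refine card_nsmul_le_sum _ _ _ fun x hx => ?_
    have := (hmem x hx).2
    rwa [IsHeavy, card_insert_of_notMem (hmem x hx).1] at this
  have hρ' : (faceDegree S ρ : ℝ) ≤ threshold n d η ρ.card := (not_le.1 hρ).le
  have h6 := threshold_le_mul (n := n) hη hη1 hlt
  have hpos : 0 < threshold n d η (ρ.card + 1) := threshold_pos hη hn _
  refine le_of_mul_le_mul_right ?_ hpos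
  calc X.card * threshold n d η (ρ.card + 1) ≤ d * faceDegree S ρ := hlow.trans hsum'
    _ ≤ d * (η * n * threshold n d η (ρ.card + 1)) := by
        gcongr
        exact hρ'.trans h6
    _ = _ := by ring

open scoped Classical in
theorem card_marked_le (hη : 0 < η) (hη1 : η ≤ 1) (S : Finset (Finset (Fin n))) :
    ((univ.filter fun x => IsMarked d η S x).card : ℝ) ≤ 2 ^ d * d * η * n := by
  rcases Nat.eq_zero_or_pos n with rfl | hn
  · simp
  by_cases hS : S ⊆ topFaces n d ∧ (freeFacet S).card = d
  swap
  · have : (univ.filter fun x => IsMarked d η S x) = ∅ :=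
      filter_eq_empty_iff.2 fun x _ h => hS ⟨h.1, h.2.1⟩
    rw [this]
    simp only [card_empty, Nat.cast_zero]
    positivity
  have hsub : (univ.filter fun x => IsMarked d η S x) ⊆
      ((freeFacet S).powerset.filter fun ρ => ¬ IsHeavy d η S ρ).biUnion fun ρ =>
        univ.filter fun x => x ∉ ρ ∧ IsHeavy d η S (insert x ρ) := by
    intro x hx
    obtain ⟨-, -, ρ, h1, h2, h3⟩ := (mem_filter.1 hx).2
    exact mem_biUnion.2 ⟨ρ, mem_filter.2 ⟨mem_powerset.2 h1, h2⟩,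
      mem_filter.2 ⟨mem_univ _, h3⟩⟩
  have hc : ((univ.filter fun x => IsMarked d η S x).card : ℝ) ≤
      ∑ ρ ∈ (freeFacet S).powerset.filter fun ρ => ¬ IsHeavy d η S ρ,
        ((univ.filter fun x => x ∉ ρ ∧ IsHeavy d η S (insert x ρ)).card : ℝ) := by
    exact_mod_cast (card_le_card hsub).trans card_biUnion_le
  refine hc.trans ((sum_le_card_nsmul _ _ _ fun ρ hρ =>
    card_heavy_extensions_le hη hη1 hn hS.1 (mem_filter.1 hρ).2).trans ?_)
  rw [nsmul_eq_mul]
  have h2 : (((freeFacet S).powerset.filter fun ρ => ¬ IsHeavy d η S ρ).card : ℝ) ≤ 2 ^ d := by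
    have := (card_filter_le (freeFacet S).powerset fun ρ => ¬ IsHeavy d η S ρ)
    rw [card_powerset, hS.2] at this
    exact_mod_cast this
  calc _ ≤ 2 ^ d * (d * η * n) := mul_le_mul_of_nonneg_right h2 (by positivity)
    _ = _ := by ring

/-- Every vertex of `τ` is avoided by some heavy proper face of `τ`. -/
def IsScattered (d : ℕ) (η : ℝ) (S : Finset (Finset (Fin n))) (τ : Finset (Fin n)) : Prop :=
  ∀ v ∈ τ, ∃ ρ ⊂ τ, IsHeavy d η S ρ ∧ v ∉ ρ

theorem IsScattered.mono {S S' : Finset (Finset (Fin n))} (h : S ⊆ S') {τ : Finset (Fin n)}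
    (hτ : IsScattered d η S τ) : IsScattered d η S' τ := fun v hv => by
  obtain ⟨ρ, h1, h2, h3⟩ := hτ v hv
  exact ⟨ρ, h1, h2.mono h, h3⟩

open scoped Classical in
/-- The free facets of `S` none of whose proper faces is heavy in `H`. -/
noncomputable def lightFree (d : ℕ) (η : ℝ) (S H : Finset (Finset (Fin n))) :
    Finset (Finset (Fin n)) :=
  (shadow S).filter fun τ => IsFreeFacet S τ ∧ ∀ ρ ⊂ τ, ¬ IsHeavy d η H ρ

theorem IsFreeFacet.mem_shadow {S : Finset (Finset (Fin n))} {τ : Finset (Fin n)}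
    (h : IsFreeFacet S τ) : τ ∈ shadow S := by
  obtain ⟨σ, hσ, v, hv, rfl, -⟩ := h
  exact mem_shadow_iff.2 ⟨σ, hσ, v, hv, rfl⟩

theorem mem_lightFree {S H : Finset (Finset (Fin n))} {τ : Finset (Fin n)} :
    τ ∈ lightFree d η S H ↔ IsFreeFacet S τ ∧ ∀ ρ ⊂ τ, ¬ IsHeavy d η H ρ := by
  classical
  simp only [lightFree, mem_filter, and_iff_right_iff_imp]
  exact fun h => h.1.mem_shadow

theorem IsFreeFacet.insert {S : Finset (Finset (Fin n))} {τ s : Finset (Fin n)}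
    (h : IsFreeFacet S τ) (hs : ¬ τ ⊆ s) : IsFreeFacet (insert s S) τ := by
  obtain ⟨σ, hσ, v, hv, rfl, huniq⟩ := h
  refine ⟨σ, mem_insert_of_mem hσ, v, hv, rfl, fun σ' hσ' hsub => ?_⟩
  rcases mem_insert.1 hσ' with rfl | hσ'
  · exact absurd hsub hs
  · exact huniq σ' hσ' hsub

theorem eq_erase_of_subset {s t : Finset (Fin n)} (hs : s.card = d + 1) (ht : t.card = d)
    (h : t ⊆ s) : ∃ u ∈ s, t = s.erase u := by
  obtain ⟨u, hu, hut⟩ : ∃ u ∈ s, u ∉ t := by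
    by_contra hcon
    push Not at hcon
    have := card_le_card (show s ⊆ t from hcon)
    omega
  refine ⟨u, hu, eq_of_subset_of_card_le (fun w hw => mem_erase.2 ⟨fun hwu => hut (hwu ▸ hw),
    h hw⟩) ?_⟩
  rw [card_erase_of_mem hu]
  omega

/-! ### How one exploration step changes the light free facets -/

section Step

variable {S : Finset (Finset (Fin n))} {x : Fin n}

/-- Only facets of the attached simplex can stop being free; this crude loss is accepted at marked
and scattered steps. -/
theorem card_lightFree_le_add (hS : S ⊆ topFaces n d) (hc : (freeFacet S).card = d)
    (hx : x ∉ freeFacet S) :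
    (lightFree d η S S).card ≤ (lightFree d η (attach S x) S).card + (d + 1) := by
  set s := insert x (freeFacet S) with hs
  have hsc : s.card = d + 1 := by rw [hs, card_insert_of_notMem hx, hc]
  have hsub : lightFree d η S S ⊆ lightFree d η (attach S x) S ∪ s.image fun u => s.erase u := by
    intro t ht
    obtain ⟨h1, h2⟩ := mem_lightFree.1 ht
    by_cases hts : t ⊆ s
    · obtain ⟨u, hu, rfl⟩ := eq_erase_of_subset hsc (card_of_mem_shadow hS h1.mem_shadow) hts
      exact mem_union_right _ (mem_image_of_mem _ hu)
    · exact mem_union_left _ (mem_lightFree.2 ⟨h1.insert hts, h2⟩)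
  refine (card_le_card hsub).trans ((card_union_le _ _).trans ?_)
  exact Nat.add_le_add_left (card_image_le.trans hsc.le) _

/-- At an unmarked step, heaviness of `insert x ρ` passes to `ρ`. If `τ` is not scattered, some
vertex `v` lies in all its heavy proper faces, and then the facet opposite `v` is new and all its
proper faces are light. No other light free facet is lost, since a covered one would have a heavy
proper face. -/
theorem card_lightFree_lt (hd : 2 ≤ d) (hη1 : η ≤ 1) (hS : S ⊆ topFaces n d)
    (hc : (freeFacet S).card = d) (hx : x ∉ freeFacet S)
    (hm : ¬ IsMarked d η S x) (hsc : ¬ IsScattered d η S (freeFacet S)) :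
    (lightFree d η S S).card + 1 ≤ (lightFree d η (attach S x) S).card := by
  classical
  set τ := freeFacet S with hτ
  set s := insert x τ with hs
  have hscard : s.card = d + 1 := by rw [hs, card_insert_of_notMem hx, hc]
  have hlight : ∀ ρ ⊆ τ, IsHeavy d η S (insert x ρ) → IsHeavy d η S ρ := by
    intro ρ hρ h
    by_contra hcon
    exact hm ⟨hS, hc, ρ, hρ, hcon, fun hxρ => hx (hρ hxρ), h⟩
  have herase : ∀ v ∈ τ, s.erase v = insert x (τ.erase v) := fun v hv =>
    erase_insert_of_ne fun h => hx (h ▸ hv)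
  set V := τ.filter fun v => ∀ ρ ⊂ τ, IsHeavy d η S ρ → v ∈ ρ with hV
  have hnotin : ∀ v ∈ V, s.erase v ∉ shadow S := by
    intro v hv hmem
    obtain ⟨hvτ, h⟩ := mem_filter.1 hv
    have h1 := isHeavy_of_mem_shadow hS hη1 hmem
    rw [herase v hvτ] at h1
    have h2 := hlight _ (erase_subset _ _) h1
    exact notMem_erase v τ (h _ (erase_ssubset hvτ) h2)
  have hin : ∀ v ∈ V, s.erase v ∈ lightFree d η (attach S x) S := by
    intro v hv
    obtain ⟨hvτ, h⟩ := mem_filter.1 hv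
    have hvs : v ∈ s := mem_insert_of_mem hvτ
    refine mem_lightFree.2 ⟨⟨s, mem_insert_self _ _, v, hvs, rfl, fun σ' hσ' hsub => ?_⟩, ?_⟩
    · rcases mem_insert.1 hσ' with h' | hσ'
      · exact h'
      · refine absurd ?_ (hnotin v hv)
        obtain ⟨u, hu, heq⟩ := eq_erase_of_subset (mem_topFaces.1 (hS hσ'))
          (by rw [card_erase_of_mem hvs, hscard]; rfl) hsub
        exact mem_shadow_iff.2 ⟨σ', hσ', u, hu, heq.symm⟩
    · intro ρ hρ hheavy
      rw [herase v hvτ] at hρ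
      have hρ' : ρ.erase x ⊆ τ.erase v := subset_insert_iff.1 hρ.subset
      have hheavy' : IsHeavy d η S (ρ.erase x) := by
        by_cases hxρ : x ∈ ρ
        · exact hlight _ (hρ'.trans (erase_subset _ _)) (by rwa [insert_erase hxρ])
        · rwa [erase_eq_of_notMem hxρ]
      exact notMem_erase v τ
        (hρ' (h _ (hρ'.trans_ssubset (erase_ssubset hvτ)) hheavy'))
  have hkeep : (lightFree d η S S).erase τ ⊆ lightFree d η (attach S x) S := by
    intro t ht
    obtain ⟨hne, ht⟩ := mem_erase.1 ht
    obtain ⟨h1, h2⟩ := mem_lightFree.1 ht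
    refine mem_lightFree.2 ⟨h1.insert fun hts => ?_, h2⟩
    obtain ⟨u, hu, rfl⟩ := eq_erase_of_subset hscard (card_of_mem_shadow hS h1.mem_shadow) hts
    have huτ : u ∈ τ := by
      rcases mem_insert.1 hu with rfl | h
      · exact absurd (erase_insert hx) hne
      · exact h
    have h3 := isHeavy_of_mem_shadow hS hη1 h1.mem_shadow
    rw [herase u huτ] at h3
    refine h2 (τ.erase u) ?_ (hlight _ (erase_subset _ _) h3)
    rw [herase u huτ]
    exact ssubset_insert fun h => hx (mem_of_mem_erase h)
  have hdisj : Disjoint ((lightFree d η S S).erase τ) (V.image fun v => s.erase v) := by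
    rw [disjoint_right]
    intro t ht ht'
    obtain ⟨v, hv, rfl⟩ := mem_image.1 ht
    exact hnotin v hv (mem_lightFree.1 (mem_of_mem_erase ht')).1.mem_shadow
  have hcard : ((lightFree d η S S).erase τ).card + V.card ≤
      (lightFree d η (attach S x) S).card := by
    have himg : (V.image fun v => s.erase v).card = V.card := by
      refine card_image_of_injOn ((erase_injOn s).mono fun v hv => ?_)
      exact mem_insert_of_mem (mem_filter.1 (mem_coe.1 hv)).1
    rw [← himg, ← card_union_of_disjoint hdisj]
    exact card_le_card (union_subset hkeep fun t ht => by
      obtain ⟨v, hv, rfl⟩ := mem_image.1 ht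
      exact hin v hv)
  -- If `τ` itself was light it is lost, but all `d ≥ 2` of its vertices yield new facets. Otherwise
  -- nothing is lost and one vertex is enough.
  by_cases hτl : τ ∈ lightFree d η S S
  · have hVτ : V = τ := filter_true_of_mem fun v _ ρ hρ hh =>
      absurd hh ((mem_lightFree.1 hτl).2 ρ hρ)
    rw [card_erase_of_mem hτl, hVτ, hc] at hcard
    omega
  · rw [erase_eq_of_notMem hτl] at hcard
    have : 0 < V.card := by
      unfold IsScattered at hsc
      push Not at hsc
      obtain ⟨v, hv, h⟩ := hsc
      exact card_pos.2 ⟨v, mem_filter.2 ⟨hv, h⟩⟩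
    omega

open scoped Classical in
/-- The total degree of the heavy faces at the moment at which they become heavy. -/
noncomputable def heavyMass (d : ℕ) (η : ℝ) (S : Finset (Finset (Fin n))) : ℝ :=
  ∑ ρ ∈ univ.filter fun ρ : Finset (Fin n) => ρ.card < d ∧ IsHeavy d η S ρ,
    2 * threshold n d η ρ.card

theorem faceDegree_attach_le (hc : (freeFacet S).card = d) (hx : x ∉ freeFacet S)
    (ρ : Finset (Fin n)) : faceDegree (attach S x) ρ ≤ faceDegree S ρ + (d + 1) := by
  set s := insert x (freeFacet S) with hs
  have hsc : s.card = d + 1 := by rw [hs, card_insert_of_notMem hx, hc]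
  have hsub : ((shadow (attach S x)).filter fun τ => ρ ⊆ τ) ⊆
      ((shadow S).filter fun τ => ρ ⊆ τ) ∪ s.image fun u => s.erase u := by
    intro τ hτ
    obtain ⟨h1, h2⟩ := mem_filter.1 hτ
    obtain ⟨σ, hσ, a, ha, rfl⟩ := mem_shadow_iff.1 h1
    rcases mem_insert.1 hσ with rfl | hσ
    · exact mem_union_right _ (mem_image_of_mem _ ha)
    · exact mem_union_left _ (mem_filter.2 ⟨mem_shadow_iff.2 ⟨σ, hσ, a, ha, rfl⟩, h2⟩)
  refine (card_le_card hsub).trans ((card_union_le _ _).trans ?_)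
  exact Nat.add_le_add_left (card_image_le.trans hsc.le) _

/-- Updating the heavy faces can only spoil facets over newly heavy faces. Their number is at most
the sum of the degrees at the moment of becoming heavy, which `heavyMass` records. -/
theorem lightFree_add_heavyMass_le (hη : 0 < η) (hη1 : η ≤ 1)
    (hn : ((d : ℝ) + 1) ≤ η ^ 3 ^ d * n) (hS : S ⊆ topFaces n d)
    (hc : (freeFacet S).card = d) (hx : x ∉ freeFacet S) :
    ((lightFree d η (attach S x) S).card : ℝ) + heavyMass d η S ≤
      (lightFree d η (attach S x) (attach S x)).card + heavyMass d η (attach S x) := by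
  classical
  set S' := attach S x with hS'
  have hSS' : S ⊆ S' := subset_insert _ _
  have hS't : S' ⊆ topFaces n d := insert_subset
    (mem_topFaces.2 (by rw [card_insert_of_notMem hx, hc])) hS
  set A := univ.filter fun ρ : Finset (Fin n) => ρ.card < d ∧ IsHeavy d η S ρ with hA
  set A' := univ.filter fun ρ : Finset (Fin n) => ρ.card < d ∧ IsHeavy d η S' ρ with hA'
  have hAA' : A ⊆ A' := fun ρ hρ => by
    simp only [hA, hA', mem_filter, mem_univ, true_and] at hρ ⊢
    exact ⟨hρ.1, hρ.2.mono hSS'⟩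
  have hmass : heavyMass d η S' =
      heavyMass d η S + ∑ ρ ∈ A' \ A, 2 * threshold n d η ρ.card := by
    rw [heavyMass, heavyMass, ← sum_sdiff hAA', add_comm]
  have hsub : lightFree d η S' S ⊆ lightFree d η S' S' ∪
      (A' \ A).biUnion fun ρ => (shadow S').filter fun τ => ρ ⊆ τ := by
    intro t ht
    obtain ⟨h1, h2⟩ := mem_lightFree.1 ht
    by_cases h : ∀ ρ ⊂ t, ¬ IsHeavy d η S' ρ
    · exact mem_union_left _ (mem_lightFree.2 ⟨h1, h⟩)
    · push Not at h
      obtain ⟨ρ, hρ, hheavy⟩ := h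
      refine mem_union_right _ (mem_biUnion.2 ⟨ρ, ?_, mem_filter.2 ⟨h1.mem_shadow, hρ.subset⟩⟩)
      have hlt : ρ.card < d := by
        rw [← card_of_mem_shadow hS't h1.mem_shadow]
        exact card_lt_card hρ
      rw [mem_sdiff]
      simp only [hA, hA', mem_filter, mem_univ, true_and]
      exact ⟨⟨hlt, hheavy⟩, fun hh => h2 ρ hρ hh.2⟩
  have hcard : ((lightFree d η S' S).card : ℝ) ≤ (lightFree d η S' S').card +
      ∑ ρ ∈ A' \ A, (faceDegree S' ρ : ℝ) := by
    exact_mod_cast (card_le_card hsub).trans ((card_union_le _ _).trans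
      (Nat.add_le_add_left card_biUnion_le _))
  have hdeg : ∑ ρ ∈ A' \ A, (faceDegree S' ρ : ℝ) ≤
      ∑ ρ ∈ A' \ A, 2 * threshold n d η ρ.card := by
    refine sum_le_sum fun ρ hρ => ?_
    rw [mem_sdiff] at hρ
    simp only [hA, hA', mem_filter, mem_univ, true_and] at hρ
    obtain ⟨⟨h1, -⟩, h2⟩ := hρ
    have h3 : (faceDegree S ρ : ℝ) < threshold n d η ρ.card :=
      not_le.1 fun h => h2 ⟨h1, h⟩
    have h4 : (faceDegree S' ρ : ℝ) ≤ faceDegree S ρ + (d + 1) := by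
      exact_mod_cast faceDegree_attach_le hc hx ρ
    have h5 := le_threshold hη hη1 h1 hn
    linarith
  linarith

open scoped Classical in
/-- The scattered faces of `K` that lie in at least two members of `S`. -/
noncomputable def coveredScattered (d : ℕ) (η : ℝ) (K S : Finset (Finset (Fin n))) :
    Finset (Finset (Fin n)) :=
  (shadow S).filter fun τ => ¬ IsFreeFacet S τ ∧ IsScattered d η K τ

theorem coveredScattered_subset (K : Finset (Finset (Fin n))) :
    coveredScattered d η K S ⊆ coveredScattered d η K (attach S x) := by
  classical
  intro t ht
  obtain ⟨h1, h2, h3⟩ := mem_filter.1 ht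
  have hsub : S ⊆ attach S x := subset_insert _ _
  refine mem_filter.2 ⟨shadow_monotone hsub h1, fun hfree => h2 ?_, h3⟩
  obtain ⟨σ, hσ, v, hv, rfl, huniq⟩ := hfree
  obtain ⟨σ₁, hσ₁, a, ha, heq⟩ := mem_shadow_iff.1 h1
  have : σ₁ = σ := huniq σ₁ (hsub hσ₁) (heq ▸ erase_subset _ _)
  subst this
  exact ⟨σ₁, hσ₁, v, hv, rfl, fun σ' hσ' => huniq σ' (hsub hσ')⟩

/-- Attaching a second simplex over a scattered free facet ends its freeness for good, so each
scattered facet of `K` can be charged only once. -/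
theorem card_coveredScattered_lt {K : Finset (Finset (Fin n))}
    (hfree : IsFreeFacet S (freeFacet S)) (hnew : insert x (freeFacet S) ∉ S)
    (hK : IsScattered d η K (freeFacet S)) :
    (coveredScattered d η K S).card + 1 ≤ (coveredScattered d η K (attach S x)).card := by
  classical
  have hsub : S ⊆ attach S x := subset_insert _ _
  have h1 : freeFacet S ∉ coveredScattered d η K S := fun h =>
    (mem_filter.1 h).2.1 hfree
  have h2 : freeFacet S ∈ coveredScattered d η K (attach S x) := by
    refine mem_filter.2 ⟨shadow_monotone hsub hfree.mem_shadow, ?_, hK⟩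
    rintro ⟨σ, hσ, v, hv, heq, huniq⟩
    obtain ⟨σ₁, hσ₁, a, ha, heq₁, -⟩ := id hfree
    have e1 : σ₁ = σ := huniq σ₁ (hsub hσ₁) (heq₁ ▸ erase_subset _ _)
    have e2 : insert x (freeFacet S) = σ :=
      huniq _ (mem_insert_self _ _) (subset_insert _ _)
    exact hnew (by rw [e2, ← e1]; exact hσ₁)
  rw [← card_insert_of_notMem h1]
  exact card_le_card (insert_subset h2 (coveredScattered_subset K))

end Step

-- The potential is the number of light free facets plus `heavyMass` plus `d + 2` times the covered
-- scattered facets. An ordinary step raises it by at least one, a scattered step loses at most `d +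
-- 1` but gains `d + 2`, and a marked step is paid for directly. At the end a core has no free
-- facets.
open scoped Classical in
theorem IsTrace.card_le {K : Finset (Finset (Fin n))} (hd : 2 ≤ d) (hη : 0 < η) (hη1 : η ≤ 1)
    (hn : ((d : ℝ) + 1) ≤ η ^ 3 ^ d * n) (hK : IsMinCore K) (hKt : K ⊆ topFaces n d)
    {S : ℕ → Finset (Finset (Fin n))} {x : ℕ → Fin n} (hT : IsTrace d K S x) :
    (K.card : ℝ) - 1 ≤ (d + 2) *
      (((range (K.card - 1)).filter fun j => IsMarked d η (S j) (x j)).card +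
        ((shadow K).filter fun τ => IsScattered d η K τ).card) + heavyMass d η K := by
  have key : ∀ i < K.card, (i : ℝ) ≤ (d + 2) *
      ((range i).filter fun j => IsMarked d η (S j) (x j)).card +
      ((lightFree d η (S i) (S i)).card + heavyMass d η (S i) +
        (d + 2) * (coveredScattered d η K (S i)).card) := by
    intro i
    induction i with
    | zero =>
      intro _
      have : 0 ≤ heavyMass d η (S 0) := by
        refine sum_nonneg fun ρ _ => ?_
        have h1 := (density_pos (d := d) hη ρ.card).le
        unfold threshold
        positivity
      simp only [Nat.cast_zero]
      positivity
    | succ i ih =>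
      intro hi
      have h1 := ih (by omega)
      obtain ⟨hfree, hc, hx, hnew, hS⟩ := hT.step i hi
      obtain ⟨hsub, -⟩ := hT.sub i (by omega)
      have hSt := hsub.trans hKt
      have e1 := lightFree_add_heavyMass_le hη hη1 hn hSt hc hx
      have e2 : ((lightFree d η (S i) (S i)).card : ℝ) ≤
          (lightFree d η (attach (S i) (x i)) (S i)).card + (d + 1) := by
        exact_mod_cast card_lightFree_le_add hSt hc hx
      have e3 : ((coveredScattered d η K (S i)).card : ℝ) ≤
          (coveredScattered d η K (attach (S i) (x i))).card := by
        exact_mod_cast card_le_card (coveredScattered_subset K)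
      have hd0 : (0 : ℝ) ≤ d + 2 := by positivity
      have e3' := mul_le_mul_of_nonneg_left e3 hd0
      rw [hS, range_add_one, filter_insert]
      by_cases hm : IsMarked d η (S i) (x i)
      · rw [if_pos hm, card_insert_of_notMem (by simp)]
        push_cast
        linarith
      · rw [if_neg hm]
        by_cases hsc : IsScattered d η (S i) (freeFacet (S i))
        · have e4 : ((coveredScattered d η K (S i)).card : ℝ) + 1 ≤
              (coveredScattered d η K (attach (S i) (x i))).card := by
            exact_mod_cast card_coveredScattered_lt hfree hnew (hsc.mono hsub)
          have e4' := mul_le_mul_of_nonneg_left e4 hd0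
          push_cast
          linarith
        · have e5 : ((lightFree d η (S i) (S i)).card : ℝ) + 1 ≤
              (lightFree d η (attach (S i) (x i)) (S i)).card := by
            exact_mod_cast card_lightFree_lt hd hη1 hSt hc hx hm hsc
          push_cast
          linarith
  have hpos := card_pos.2 hK.1
  have h1 := key (K.card - 1) (by omega)
  rw [hT.last] at h1
  have h2 : lightFree d η K K = ∅ := by
    rw [eq_empty_iff_forall_notMem]
    intro t ht
    obtain ⟨σ, hσ, v, hv, rfl, huniq⟩ := (mem_lightFree.1 ht).1
    obtain ⟨σ', hσ', hne, hsub⟩ := hK.2.1 σ hσ v hv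
    exact hne (huniq σ' hσ' hsub)
  have h3 : ((coveredScattered d η K K).card : ℝ) ≤
      ((shadow K).filter fun τ => IsScattered d η K τ).card := by
    have : coveredScattered d η K K ⊆ (shadow K).filter fun τ => IsScattered d η K τ :=
      fun t ht => mem_filter.2 ⟨(mem_filter.1 ht).1, (mem_filter.1 ht).2.2⟩
    exact_mod_cast card_le_card this
  have h3' := mul_le_mul_of_nonneg_left h3 (show (0 : ℝ) ≤ d + 2 by positivity)
  rw [h2, card_empty, Nat.cast_sub (by omega)] at h1
  push_cast at h1
  linarith

end Heavy

/-! ### Scattered faces are rare -/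

section Scattered

variable {n d : ℕ} {η : ℝ} {p : ℝ}

theorem card_supersets_le (γ : Finset (Fin n)) :
    ((powersetCard d univ).filter fun τ => γ ⊆ τ).card ≤ n ^ (d - γ.card) := by
  have h : ((powersetCard d univ).filter fun τ => γ ⊆ τ).card ≤
      (powersetCard (d - γ.card) (univ : Finset (Fin n))).card := by
    refine card_le_card_of_injOn (fun τ => τ \ γ) (fun τ hτ => ?_) fun τ hτ τ' hτ' heq => ?_
    · obtain ⟨h1, h2⟩ := mem_filter.1 (mem_coe.1 hτ)
      rw [mem_coe, mem_powersetCard, card_sdiff_of_subset h2, (mem_powersetCard.1 h1).2]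
      exact ⟨subset_univ _, rfl⟩
    · have h2 := (mem_filter.1 (mem_coe.1 hτ)).2
      have h2' := (mem_filter.1 (mem_coe.1 hτ')).2
      simp only at heq
      rw [← sdiff_union_of_subset h2, heq, sdiff_union_of_subset h2']
  refine h.trans ?_
  rw [card_powersetCard, card_univ, Fintype.card_fin]
  exact Nat.choose_le_pow _ _

-- There are at most `n ^ (d - (α ∪ β).card)` such `d`-sets. Multiplied by the power of `n` on the
-- left this becomes `n ^ (d - β.card)`, and heaviness of `β` finishes; `β` is strictly larger than
-- the light intersection.
open scoped Classical in
theorem card_supersets_union_le (hη : 0 < η) (hη1 : η ≤ 1)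
    {K : Finset (Finset (Fin n))} {α β : Finset (Fin n)} (hβ : IsHeavy d η K β)
    (hlight : ¬ IsHeavy d η K (α ∩ β)) :
    (((powersetCard d univ).filter fun τ => α ∪ β ⊆ τ).card : ℝ) *
      (density d η ((α ∩ β).card + 1) * (n : ℝ) ^ (α.card - (α ∩ β).card)) ≤
      faceDegree K β := by
  rcases ((powersetCard d univ).filter fun τ => α ∪ β ⊆ τ).eq_empty_or_nonempty with h | ⟨τ, hτ⟩
  · rw [h]; simp
  obtain ⟨hτ1, hτ2⟩ := mem_filter.1 hτ
  have hc := card_le_card hτ2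
  rw [(mem_powersetCard.1 hτ1).2] at hc
  have hui := card_union_add_card_inter α β
  have hne : α ∩ β ≠ β := fun h => hlight (by rwa [h])
  have hlt : (α ∩ β).card < β.card :=
    card_lt_card (inter_subset_right.ssubset_of_ne hne)
  have hle : (α ∩ β).card ≤ α.card := card_le_card inter_subset_left
  have h1 : (((powersetCard d univ).filter fun τ => α ∪ β ⊆ τ).card : ℝ) ≤
      (n : ℝ) ^ (d - (α ∪ β).card) := by exact_mod_cast card_supersets_le (α ∪ β)
  have h2 : density d η ((α ∩ β).card + 1) ≤ density d η β.card := density_mono hη hη1 hlt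
  have h3 := (density_pos (d := d) hη ((α ∩ β).card + 1)).le
  calc _ ≤ (n : ℝ) ^ (d - (α ∪ β).card) *
        (density d η β.card * (n : ℝ) ^ (α.card - (α ∩ β).card)) := by gcongr
    _ = density d η β.card * (n : ℝ) ^ (d - (α ∪ β).card + (α.card - (α ∩ β).card)) := by
        rw [pow_add]; ring
    _ = threshold n d η β.card := by
        rw [threshold]; congr 2; omega
    _ ≤ _ := hβ

-- The degrees of all `β` over `ρ` add up to at most `2 ^ d` times the degree of the light `ρ`. One
-- density factor is absorbed by the weight `w` and one by the threshold of the heavy `α`, leaving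
-- the gain `η`.
open scoped Classical in
theorem sum_supersets_le (hη : 0 < η) (hη1 : η ≤ 1) (hn : 0 < n)
    {K : Finset (Finset (Fin n))} (hK : K ⊆ topFaces n d) {α ρ : Finset (Fin n)}
    (hαd : α.card < d) (hα : IsHeavy d η K α) (hρα : ρ ⊆ α) (hρ : ¬ IsHeavy d η K ρ) :
    ∑ β ∈ univ.filter fun β : Finset (Fin n) => IsHeavy d η K β ∧ α ∩ β = ρ,
      (((powersetCard d univ).filter fun τ => α ∪ β ⊆ τ).card : ℝ) ≤
      2 ^ d * η * faceDegree K α := by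
  set R := univ.filter fun β : Finset (Fin n) => IsHeavy d η K β ∧ α ∩ β = ρ with hR
  have hmem : ∀ β ∈ R, IsHeavy d η K β ∧ α ∩ β = ρ := fun β hβ => (mem_filter.1 hβ).2
  set w := density d η (ρ.card + 1) * (n : ℝ) ^ (α.card - ρ.card) with hw
  have hn' : (0 : ℝ) < n := by exact_mod_cast hn
  have hwpos : 0 < w := mul_pos (density_pos hη _) (pow_pos hn' _)
  have hlt : ρ.card < α.card :=
    card_lt_card (hρα.ssubset_of_ne fun h => hρ (by rwa [h]))
  have h1 : (∑ β ∈ R, (((powersetCard d univ).filter fun τ => α ∪ β ⊆ τ).card : ℝ)) * w ≤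
      ∑ β ∈ R, (faceDegree K β : ℝ) := by
    rw [sum_mul]
    refine sum_le_sum fun β hβ => ?_
    obtain ⟨hh, hi⟩ := hmem β hβ
    have := card_supersets_union_le (α := α) hη hη1 hh (by rwa [hi])
    rwa [hi] at this
  have h2 : (∑ β ∈ R, (faceDegree K β : ℝ)) ≤ 2 ^ d * faceDegree K ρ := by
    exact_mod_cast sum_faceDegree_le_two_pow hK ρ R fun β hβ => by
      rw [← (hmem β hβ).2]; exact inter_subset_right
  have h3 : (faceDegree K ρ : ℝ) ≤ threshold n d η ρ.card := (not_le.1 hρ).le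
  have h4 : threshold n d η ρ.card ≤ η * threshold n d η α.card * w := by
    have e1 := density_le_mul_sq (d := d) hη hη1 (hlt.trans hαd)
    have e2 : density d η (ρ.card + 1) ≤ density d η α.card := density_mono hη hη1 hlt
    have e3 := (density_pos (d := d) hη (ρ.card + 1)).le
    have e4 : d - ρ.card = (d - α.card) + (α.card - ρ.card) := by omega
    rw [threshold, threshold, e4, pow_add]
    calc density d η ρ.card * ((n : ℝ) ^ (d - α.card) * (n : ℝ) ^ (α.card - ρ.card))
        ≤ (η * density d η (ρ.card + 1) ^ 2) *
          ((n : ℝ) ^ (d - α.card) * (n : ℝ) ^ (α.card - ρ.card)) := by gcongr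
      _ = η * (density d η (ρ.card + 1) * (n : ℝ) ^ (d - α.card)) * w := by rw [hw]; ring
      _ ≤ _ := by gcongr
  have h5 : threshold n d η α.card ≤ faceDegree K α := hα
  refine le_of_mul_le_mul_right ?_ hwpos
  calc _ ≤ 2 ^ d * (faceDegree K ρ : ℝ) := h1.trans h2
    _ ≤ 2 ^ d * (η * threshold n d η α.card * w) := by gcongr; exact h3.trans h4
    _ ≤ 2 ^ d * (η * faceDegree K α * w) := by gcongr
    _ = _ := by ring

-- A scattered facet contains two heavy faces with light intersection. Choosing first `α`, then the
-- intersection, then `β`, and summing degrees costs a factor `2 ^ d` each time except for the gain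
-- `η`, hence `8 ^ d * η`.
open scoped Classical in
theorem card_scattered_le (hη : 0 < η) (hη1 : η ≤ 1) (hn : 0 < n) (hd : 0 < d)
    {K : Finset (Finset (Fin n))} (hK : K ⊆ topFaces n d)
    (hempty : ¬ IsHeavy d η K ∅) :
    (((shadow K).filter fun τ => IsScattered d η K τ).card : ℝ) ≤
      8 ^ d * η * (shadow K).card := by
  set H := univ.filter fun α : Finset (Fin n) => α.card < d ∧ IsHeavy d η K α with hH
  have hsub : ((shadow K).filter fun τ => IsScattered d η K τ) ⊆
      H.biUnion fun α => (α.powerset.filter fun ρ => ¬ IsHeavy d η K ρ).biUnion fun ρ =>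
        (univ.filter fun β : Finset (Fin n) => IsHeavy d η K β ∧ α ∩ β = ρ).biUnion fun β =>
          (powersetCard d univ).filter fun τ => α ∪ β ⊆ τ := by
    intro τ hτ
    obtain ⟨hτK, hτs⟩ := mem_filter.1 hτ
    have hτc := card_of_mem_shadow hK hτK
    obtain ⟨v₀, hv₀⟩ : τ.Nonempty := card_pos.1 (by omega)
    set Q := τ.powerset.filter fun ρ => ρ ⊂ τ ∧ IsHeavy d η K ρ with hQ
    have hQne : Q.Nonempty := by
      obtain ⟨ρ, h1, h2, -⟩ := hτs v₀ hv₀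
      exact ⟨ρ, mem_filter.2 ⟨mem_powerset.2 h1.subset, h1, h2⟩⟩
    obtain ⟨α, hα, hmin⟩ := exists_min_image Q card hQne
    obtain ⟨-, hατ, hαh⟩ := mem_filter.1 hα
    obtain ⟨v, hv⟩ : α.Nonempty := by
      rw [nonempty_iff_ne_empty]
      rintro rfl
      exact hempty hαh
    obtain ⟨β, hβτ, hβh, hvβ⟩ := hτs v (hατ.subset hv)
    have hαβ : α ∩ β ⊂ α := inter_subset_left.ssubset_of_ne fun h => by
      rw [← h] at hv
      exact hvβ (mem_inter.1 hv).2
    have hlight : ¬ IsHeavy d η K (α ∩ β) := fun h => by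
      have := hmin (α ∩ β) (mem_filter.2
        ⟨mem_powerset.2 (hαβ.subset.trans hατ.subset), hαβ.trans hατ, h⟩)
      exact absurd (card_lt_card hαβ) (not_lt.2 this)
    refine mem_biUnion.2 ⟨α, mem_filter.2 ⟨mem_univ _, ?_, hαh⟩,
      mem_biUnion.2 ⟨α ∩ β, mem_filter.2 ⟨mem_powerset.2 hαβ.subset, hlight⟩,
      mem_biUnion.2 ⟨β, mem_filter.2 ⟨mem_univ _, hβh, rfl⟩,
      mem_filter.2 ⟨mem_powersetCard.2 ⟨subset_univ _, hτc⟩,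
        union_subset hατ.subset hβτ.subset⟩⟩⟩⟩
    rw [← hτc]
    exact card_lt_card hατ
  have hc : (((shadow K).filter fun τ => IsScattered d η K τ).card : ℝ) ≤
      ∑ α ∈ H, ∑ ρ ∈ α.powerset.filter fun ρ => ¬ IsHeavy d η K ρ,
        ∑ β ∈ univ.filter fun β : Finset (Fin n) => IsHeavy d η K β ∧ α ∩ β = ρ,
          (((powersetCard d univ).filter fun τ => α ∪ β ⊆ τ).card : ℝ) := by
    have := (card_le_card hsub).trans (card_biUnion_le.trans (sum_le_sum fun α _ =>
      card_biUnion_le.trans (sum_le_sum fun ρ _ => card_biUnion_le)))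
    exact_mod_cast this
  refine hc.trans ?_
  have h1 : ∀ α ∈ H, ∑ ρ ∈ α.powerset.filter fun ρ => ¬ IsHeavy d η K ρ,
      ∑ β ∈ univ.filter fun β : Finset (Fin n) => IsHeavy d η K β ∧ α ∩ β = ρ,
        (((powersetCard d univ).filter fun τ => α ∪ β ⊆ τ).card : ℝ) ≤
      2 ^ d * (2 ^ d * η * faceDegree K α) := by
    intro α hα
    obtain ⟨-, h2, h3⟩ := mem_filter.1 hα
    refine (sum_le_card_nsmul _ _ (2 ^ d * η * faceDegree K α) fun ρ hρ => ?_).trans ?_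
    · obtain ⟨h4, h5⟩ := mem_filter.1 hρ
      exact sum_supersets_le hη hη1 hn hK h2 h3 (mem_powerset.1 h4) h5
    · rw [nsmul_eq_mul]
      refine mul_le_mul_of_nonneg_right ?_ (by positivity)
      have h6 : (α.powerset.filter fun ρ => ¬ IsHeavy d η K ρ).card ≤ 2 ^ d :=
        (card_filter_le _ _).trans ((card_powerset α).trans_le
          (Nat.pow_le_pow_right (by norm_num) h2.le))
      exact_mod_cast h6
  refine (sum_le_sum h1).trans ?_
  have h2 : (∑ α ∈ H, (faceDegree K α : ℝ)) ≤ 2 ^ d * (shadow K).card := by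
    rw [← faceDegree_empty K]
    exact_mod_cast sum_faceDegree_le_two_pow hK ∅ H fun α _ => empty_subset _
  rw [← mul_sum, ← mul_sum]
  calc (2 : ℝ) ^ d * (2 ^ d * η * ∑ α ∈ H, (faceDegree K α : ℝ))
      ≤ 2 ^ d * (2 ^ d * η * (2 ^ d * (shadow K).card)) := by gcongr
    _ = _ := by
      rw [show (8 : ℝ) = 2 * 2 * 2 by norm_num, mul_pow, mul_pow]; ring

/-! ### Choosing the scale of heaviness -/

/-- The terms below the cutoff form the tail of a sequence that at least halves each time, and this
tail starts at a value of at most `D`. -/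
theorem sum_truncated_le (J : ℕ) : ∀ (a : ℕ → ℝ) (D : ℝ), 0 ≤ D → (∀ j, 0 ≤ a j) →
    (∀ j, a (j + 1) ≤ a j / 2) → ∑ j ∈ range J, (if a j ≤ D then a j else 0) ≤ 2 * D := by
  have hgeom : ∀ (J : ℕ) (a : ℕ → ℝ), (∀ j, 0 ≤ a j) → (∀ j, a (j + 1) ≤ a j / 2) →
      ∑ j ∈ range J, a j ≤ 2 * a 0 := by
    intro J
    induction J with
    | zero => intro a h0 _; simpa using h0 0
    | succ J ih =>
      intro a h0 h1
      rw [sum_range_succ']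
      have := ih (fun j => a (j + 1)) (fun j => h0 _) fun j => h1 _
      have := h1 0
      simp only [zero_add] at *
      linarith
  induction J with
  | zero => intro a D hD _ _; simpa using hD
  | succ J ih =>
    intro a D hD h0 h1
    by_cases h : a 0 ≤ D
    · refine (sum_le_sum fun j _ => ?_).trans ((hgeom (J + 1) a h0 h1).trans (by linarith))
      split_ifs
      · exact le_rfl
      · exact h0 j
    · rw [sum_range_succ', if_neg h, add_zero]
      exact ih (fun j => a (j + 1)) D hD (fun j => h0 _) fun j => h1 _

theorem threshold_div_two (hη : 0 < η) (k : ℕ) :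
    threshold n d (η / 2) k ≤ threshold n d η k / 2 := by
  have h1 : density d (η / 2) k ≤ density d η k / 2 := by
    rw [density, density, div_pow]
    have h3 : 1 ≤ 3 ^ (d - k) := Nat.one_le_pow _ _ (by norm_num)
    have h2 : (2 : ℝ) ≤ 2 ^ 3 ^ (d - k) := le_self_pow₀ (by norm_num) (by omega)
    have := pow_pos hη (3 ^ (d - k))
    gcongr
  rw [threshold, threshold]
  calc _ ≤ density d η k / 2 * (n : ℝ) ^ (d - k) := by gcongr
    _ = _ := by ring

/-- For a fixed face, only scales with threshold at most its degree contribute, and thresholds at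
least halve with the scale. So all scales together cost a constant times the degree, independently
of `J`. -/
theorem sum_heavyMass_le {η₀ : ℝ} (hη : 0 < η₀) (J : ℕ) {K : Finset (Finset (Fin n))}
    (hK : K ⊆ topFaces n d) :
    ∑ j ∈ range J, heavyMass d (η₀ / 2 ^ j) K ≤ 4 * (2 ^ d * (shadow K).card) := by
  classical
  set R := univ.filter fun ρ : Finset (Fin n) => ρ.card < d with hR
  have h1 : ∀ j, heavyMass d (η₀ / 2 ^ j) K = ∑ ρ ∈ R,
      2 * (if threshold n d (η₀ / 2 ^ j) ρ.card ≤ faceDegree K ρ then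
        threshold n d (η₀ / 2 ^ j) ρ.card else 0) := by
    intro j
    have h2 : (univ.filter fun ρ : Finset (Fin n) =>
        ρ.card < d ∧ IsHeavy d (η₀ / 2 ^ j) K ρ) =
        R.filter fun ρ => threshold n d (η₀ / 2 ^ j) ρ.card ≤ faceDegree K ρ := by
      ext ρ
      simp only [hR, mem_filter, mem_univ, true_and]
      rfl
    rw [heavyMass, h2, sum_filter]
    exact sum_congr rfl fun ρ _ => by split_ifs <;> simp
  simp only [h1]
  rw [sum_comm]
  have h2 : ∀ ρ ∈ R, ∑ j ∈ range J,
      2 * (if threshold n d (η₀ / 2 ^ j) ρ.card ≤ faceDegree K ρ then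
        threshold n d (η₀ / 2 ^ j) ρ.card else 0) ≤ 4 * (faceDegree K ρ : ℝ) := by
    intro ρ _
    rw [← mul_sum]
    have := sum_truncated_le J (fun j => threshold n d (η₀ / 2 ^ j) ρ.card)
      (faceDegree K ρ : ℝ) (by positivity) (fun j => ?_) fun j => ?_
    · linarith
    · have h3 := density_pos (d := d) (show 0 < η₀ / 2 ^ j by positivity) ρ.card
      simp only [threshold]
      positivity
    · rw [pow_succ, ← div_div]
      exact threshold_div_two (by positivity) _
  refine (sum_le_sum h2).trans ?_
  rw [← mul_sum]
  have h3 : (∑ ρ ∈ R, (faceDegree K ρ : ℝ)) ≤ 2 ^ d * (shadow K).card := by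
    rw [← faceDegree_empty K]
    exact_mod_cast sum_faceDegree_le_two_pow hK ∅ R fun α _ => empty_subset _
  linarith

/-! ### Large cores -/

open scoped Classical in
/-- At one of `J` scales, a positive fraction of the steps that explore `K` is marked. -/
theorem IsMinCore.exists_scale (hd : 2 ≤ d) {η₀ : ℝ} (hη : 0 < η₀) (hη1 : η₀ ≤ 1)
    (hη8 : 8 * (d + 2) * (8 ^ d * η₀ * (d + 1)) ≤ 1) {J : ℕ}
    (hJ : (16 * 2 ^ d * (d + 1) : ℝ) ≤ J)
    (hn : ((d : ℝ) + 1) ≤ (η₀ / 2 ^ J) ^ 3 ^ d * n) {K : Finset (Finset (Fin n))}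
    (hK : IsMinCore K) (hKt : K ⊆ topFaces n d) (hK2 : 2 ≤ K.card)
    (hKs : (K.card : ℝ) * (d + 1) < (η₀ / 2 ^ J) ^ 3 ^ d * (n : ℝ) ^ d) :
    ∃ j ∈ range J, ∃ S x, IsTrace d K S x ∧ (K.card : ℝ) ≤ 8 * (d + 2) *
      ((range (K.card - 1)).filter fun i => IsMarked d (η₀ / 2 ^ j) (S i) (x i)).card := by
  have hn0 : 0 < n := by
    rcases Nat.eq_zero_or_pos n with rfl | h
    · simp only [Nat.cast_zero, mul_zero] at hn
      have : (0 : ℝ) ≤ d := Nat.cast_nonneg d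
      linarith
    · exact h
  have hsh : ((shadow K).card : ℝ) ≤ K.card * (d + 1) := by exact_mod_cast card_shadow_le hKt
  have hJpos : (0 : ℝ) < J := lt_of_lt_of_le (by positivity) hJ
  have hmpos : (0 : ℝ) ≤ K.card := Nat.cast_nonneg _
  -- Pigeonhole: the total over the scales is at most `J` times a quarter of the size of `K`.
  obtain ⟨j, hj, hmass⟩ : ∃ j ∈ range J, heavyMass d (η₀ / 2 ^ j) K ≤ (K.card : ℝ) / 4 := by
    by_contra hcon
    push Not at hcon
    have hne : (range J).Nonempty := by
      rw [nonempty_range_iff]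
      rintro rfl
      simp at hJpos
    have h1 := sum_lt_sum_of_nonempty hne hcon
    rw [sum_const, card_range, nsmul_eq_mul] at h1
    have h2 := sum_heavyMass_le (n := n) hη J hKt
    have h3 : 4 * (2 ^ d * ((shadow K).card : ℝ)) ≤ (16 * 2 ^ d * (d + 1)) * (K.card / 4) := by
      calc 4 * (2 ^ d * ((shadow K).card : ℝ)) ≤ 4 * (2 ^ d * (K.card * (d + 1))) := by gcongr
        _ = _ := by ring
    have h4 : (16 * 2 ^ d * (d + 1) : ℝ) * (K.card / 4) ≤ J * (K.card / 4) := by gcongr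
    linarith
  set η := η₀ / 2 ^ j with hηdef
  have hηpos : 0 < η := by positivity
  have hηle : η ≤ η₀ := div_le_self hη.le (one_le_pow₀ (by norm_num))
  have hηmin : η₀ / 2 ^ J ≤ η :=
    div_le_div_of_nonneg_left hη.le (by positivity)
      (pow_le_pow_right₀ (by norm_num) (mem_range.1 hj).le)
  have hpow : (η₀ / 2 ^ J) ^ 3 ^ d ≤ η ^ 3 ^ d := pow_le_pow_left₀ (by positivity) hηmin _
  obtain ⟨S, x, hT⟩ := hK.exists_isTrace hKt
  refine ⟨j, hj, S, x, hT, ?_⟩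
  have hempty : ¬ IsHeavy d η K ∅ := by
    rw [IsHeavy, faceDegree_empty, card_empty, not_le, threshold, density, Nat.sub_zero]
    refine (hsh.trans_lt hKs).trans_le ?_
    gcongr
  have h1 := hT.card_le hd hηpos (hηle.trans hη1)
    (hn.trans (mul_le_mul_of_nonneg_right hpow (Nat.cast_nonneg _))) hK hKt
  have h2 := card_scattered_le hηpos (hηle.trans hη1) hn0 (by omega) hKt hempty
  have h3 : ((d : ℝ) + 2) * ((shadow K).filter fun τ => IsScattered d η K τ).card ≤
      K.card / 8 := by
    calc ((d : ℝ) + 2) * ((shadow K).filter fun τ => IsScattered d η K τ).card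
        ≤ (d + 2) * (8 ^ d * η₀ * (K.card * (d + 1))) := by
          gcongr
          refine h2.trans ?_
          gcongr
      _ = (8 * (d + 2) * (8 ^ d * η₀ * (d + 1))) * (K.card / 8) := by ring
      _ ≤ 1 * (K.card / 8) := by gcongr
      _ = _ := one_mul _
  -- From size two on, `K.card - 1` is at least half of `K.card`; removing a quarter and an eighth
  -- leaves an eighth for the marked steps.
  have h4 : (2 : ℝ) ≤ K.card := by exact_mod_cast hK2
  rw [mul_add] at h1
  linarith

theorem IsMinCore.two_le_card {K : Finset (Finset (Fin n))} (hK : IsMinCore K)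
    (hKt : K ⊆ topFaces n d) : 2 ≤ K.card := by
  obtain ⟨σ, hσ⟩ := hK.1
  obtain ⟨v, hv⟩ : σ.Nonempty := card_pos.1 (by rw [mem_topFaces.1 (hKt hσ)]; omega)
  obtain ⟨σ', hσ', hne, -⟩ := hK.2.1 σ hσ v hv
  exact one_lt_card.2 ⟨σ', hσ', σ, hσ, hne⟩

theorem bern_largeCore_le (hd : 2 ≤ d) (h0 : 0 ≤ p) (h1 : p ≤ 1) {η₀ κ : ℝ} (hη : 0 < η₀)
    (hη1 : η₀ ≤ 1) (hη8 : 8 * (d + 2) * (8 ^ d * η₀ * (d + 1)) ≤ 1)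
    (hκ : 2 ^ d * d * η₀ ≤ κ) (hκ1 : κ ≤ 1) {J : ℕ} (hJ : (16 * 2 ^ d * (d + 1) : ℝ) ≤ J)
    (hn : ((d : ℝ) + 1) ≤ (η₀ / 2 ^ J) ^ 3 ^ d * n) {m q : ℕ} (hq : 8 * (d + 2) * (q - 1) < m)
    (hms : (m : ℝ) * (d + 1) < (η₀ / 2 ^ J) ^ 3 ^ d * (n : ℝ) ^ d) :
    bern p (topFaces n d) {ω | ∃ K ⊆ ω, IsMinCore K ∧ K.card = m} ≤
      J * (n ^ (d + 1) * ((2 * n) ^ (m - 1) * κ ^ q * p ^ m)) := by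
  classical
  have hκ0 : 0 ≤ κ := le_trans (by positivity) hκ
  set C : ℕ → Set (Finset (Finset (Fin n))) := fun j => {K | ∃ S x, IsTrace d K S x ∧
    q ≤ ((range (m - 1)).filter fun i => IsMarked d (η₀ / 2 ^ j) (S i) (x i)).card} with hC
  refine (bern_le_sum h0 h1 (range J) _
    (fun j => {ω | ∃ K ⊆ ω, IsMinCore K ∧ K.card = m ∧ K ∈ C j}) ?_).trans ?_
  · rintro ω hω ⟨K, hKω, hK, rfl⟩
    have hKt := hKω.trans hω
    obtain ⟨j, hj, S, x, hT, hle⟩ := hK.exists_scale hd hη hη1 hη8 hJ hn hKt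
      (hK.two_le_card hKt) hms
    refine ⟨j, hj, K, hKω, hK, rfl, S, x, hT, ?_⟩
    have hle' : K.card ≤ 8 * (d + 2) *
      ((range (K.card - 1)).filter fun i => IsMarked d (η₀ / 2 ^ j) (S i) (x i)).card := by
      exact_mod_cast hle
    -- If `q = 0` nothing is to be shown; otherwise the hypothesis on `q - 1` gives strictly more
    -- than `q - 1` marked steps.
    have := lt_of_mul_lt_mul_left (hq.trans_le hle') (Nat.zero_le _)
    omega
  · refine (sum_le_card_nsmul _ _ _ fun j _ => ?_).trans_eq (by rw [card_range, nsmul_eq_mul])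
    have hηj : η₀ / 2 ^ j ≤ η₀ := div_le_self hη.le (one_le_pow₀ (by norm_num))
    refine bern_minCore_le h0 h1 (P := IsMarked d (η₀ / 2 ^ j)) hκ0 hκ1 (fun S _ => ?_) q (C j) ?_
    · refine (card_marked_le (by positivity) (hηj.trans hη1) S).trans ?_
      refine mul_le_mul_of_nonneg_right (le_trans ?_ hκ) (Nat.cast_nonneg _)
      gcongr
    · rintro K ⟨S, x, hT, h⟩ - - -
      exact ⟨S, x, hT, h⟩

end Scattered

open Filter Topology

/-! ### Few simplices survive below the threshold -/

section SurvivalLimit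

variable {d : ℕ} {c : ℝ}

/-- The limit of `branchBound` for `p = c / n`. -/
noncomputable def branchLimit (d : ℕ) (c : ℝ) : ℕ → ℝ
  | 0 => 1
  | r + 1 => 1 - Real.exp (-c * branchLimit d c r ^ d)

theorem tendsto_branchBound (r : ℕ) :
    Tendsto (fun n : ℕ => branchBound n d (c / n) r) atTop (𝓝 (branchLimit d c r)) := by
  induction r with
  | zero => exact tendsto_const_nhds
  | succ r ih =>
    have h : Tendsto (fun n : ℕ => (n : ℝ) * -(c / n * branchBound n d (c / n) r ^ d)) atTop
        (𝓝 (-c * branchLimit d c r ^ d)) := by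
      refine ((ih.pow d).const_mul (-c)).congr' ?_
      filter_upwards [eventually_gt_atTop 0] with n hn
      have : (n : ℝ) ≠ 0 := by positivity
      field_simp
    have := (Real.tendsto_one_add_pow_exp_of_tendsto h).const_sub 1
    simpa only [branchBound, branchLimit, sub_eq_add_neg] using this

theorem branchLimit_mem (hc : 0 ≤ c) (r : ℕ) : 0 ≤ branchLimit d c r ∧ branchLimit d c r ≤ 1 := by
  induction r with
  | zero => simp [branchLimit]
  | succ r ih =>
    have h1 : -c * branchLimit d c r ^ d ≤ 0 := by
      have := mul_nonneg hc (pow_nonneg ih.1 d)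
      linarith
    have h2 := Real.exp_le_one_iff.2 h1
    have h3 := (Real.exp_pos (-c * branchLimit d c r ^ d)).le
    simp only [branchLimit]
    constructor <;> linarith

theorem antitone_branchLimit (hc : 0 ≤ c) : Antitone (branchLimit d c) := by
  refine antitone_nat_of_succ_le fun r => ?_
  induction r with
  | zero => exact (branchLimit_mem hc 1).2
  | succ r ih =>
    simp only [branchLimit] at ih ⊢
    have h0 := (branchLimit_mem (d := d) hc (r + 1)).1
    simp only [branchLimit] at h0
    have := mul_le_mul_of_nonneg_left (pow_le_pow_left₀ h0 ih d) hc
    have := Real.exp_le_exp.2 (show -c * branchLimit d c r ^ d ≤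
      -c * (1 - Real.exp (-c * branchLimit d c r ^ d)) ^ d by linarith)
    linarith

/-- The sequence decreases to a fixed point `l`; if `l` were positive, `x = 1 - l` would be a
forbidden solution. -/
theorem tendsto_branchLimit (hc : 0 ≤ c)
    (hfix : ∀ x : ℝ, x < 1 → Real.exp (-c * (1 - x) ^ d) - x ≠ 0) :
    Tendsto (branchLimit d c) atTop (𝓝 0) := by
  obtain ⟨l, hl⟩ : ∃ l, Tendsto (branchLimit d c) atTop (𝓝 l) :=
    ⟨_, tendsto_atTop_ciInf (antitone_branchLimit hc)
      ⟨0, by rintro _ ⟨r, rfl⟩; exact (branchLimit_mem hc r).1⟩⟩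
  have h1 : Tendsto (fun r => branchLimit d c (r + 1)) atTop
      (𝓝 (1 - Real.exp (-c * l ^ d))) := by
    simp only [branchLimit]
    exact (((hl.pow d).const_mul (-c)).rexp).const_sub 1
  have h2 := tendsto_nhds_unique ((tendsto_add_atTop_iff_nat 1).2 hl) h1
  have h0 : 0 ≤ l := ge_of_tendsto' hl fun r => (branchLimit_mem hc r).1
  rcases h0.eq_or_lt with h | h
  · rwa [← h] at hl
  · refine absurd ?_ (hfix (1 - l) (by linarith))
    rw [sub_sub_cancel]
    linarith

theorem eventually_bern_survivors_le (hc : 0 ≤ c)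
    (hfix : ∀ x : ℝ, x < 1 → Real.exp (-c * (1 - x) ^ d) - x ≠ 0) {δ ε : ℝ} (hδ : 0 < δ)
    (hε : 0 < ε) : ∃ r, ∀ᶠ n : ℕ in atTop, bern (c / n) (topFaces n d)
      {ω | δ * (n : ℝ) ^ d < ((survivors^[r] ω).card : ℝ)} < ε := by
  obtain ⟨r, hr⟩ : ∃ r, c * branchLimit d c r / δ < ε := by
    have h := ((tendsto_branchLimit hc hfix).const_mul c).div_const δ
    rw [mul_zero, zero_div] at h
    exact (h.eventually_lt_const hε).exists
  refine ⟨r, ?_⟩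
  set A : ℝ := (∑ k ∈ range (branchSize d r), (branchSize d r * (d + 1) * c) ^ k) *
    (branchSize d r * (d + 1)) ^ (d + 1) with hA
  have hlim : Tendsto (fun n : ℕ => (c * branchBound n d (c / n) r + A * c * (c / n)) / δ) atTop
      (𝓝 ((c * branchLimit d c r + A * c * 0) / δ)) :=
    (((tendsto_branchBound r).const_mul c).add
      ((tendsto_const_div_atTop_nhds_zero_nat c).const_mul (A * c))).div_const δ
  rw [mul_zero, add_zero] at hlim
  have hhalf : ∀ᶠ n : ℕ in atTop, c / n < 1 / 2 :=
    (tendsto_const_div_atTop_nhds_zero_nat c).eventually_lt_const (by norm_num)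
  filter_upwards [hlim.eventually_lt_const hr, hhalf, eventually_gt_atTop 0] with n h1 h2 h3
  have hn : (0 : ℝ) < n := by exact_mod_cast h3
  have hp : 0 ≤ c / n := by positivity
  refine lt_of_le_of_lt ?_ h1
  refine (bern_markov hp (by linarith) (fun ω _ => Nat.cast_nonneg _)
    (by positivity)).trans ?_
  rw [div_le_div_iff₀ (by positivity) hδ]
  have h4 := expect_card_survivors_le (n := n) (d := d) hp h2.le r
  rw [mul_div_cancel₀ c hn.ne'] at h4
  refine (mul_le_mul_of_nonneg_right h4 hδ.le).trans_eq ?_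
  rw [← hA]
  field_simp
  ring

end SurvivalLimit

/-! ### Small cores without the boundary of a simplex do not occur -/

section CoreLimit

variable {d : ℕ} {c : ℝ}

theorem tendsto_log_atTop {b : ℕ} (hb : 1 < b) : Tendsto (Nat.log b) atTop atTop :=
  tendsto_atTop_atTop.2 fun k => ⟨b ^ k, fun _ h => Nat.le_log_of_pow_le hb h⟩

theorem two_mul_pow_mul_div_pow {n : ℕ} (hn0 : 0 < n) (c : ℝ) (m : ℕ) :
    (2 * n : ℝ) ^ m * (c / n) ^ m = (2 * c) ^ m := by
  have hn : (0 : ℝ) < n := by exact_mod_cast hn0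
  rw [← mul_pow]
  congr 1
  field_simp

/-- After the cancellation of `n ^ (d + 1)`, what remains is `(2 * c) ^ m / (2 * n)`. Since `m ≤ M`
and `b ^ M` is at most the square root of `n`, this is at most `1 / b ^ M`. -/
theorem bern_smallCores_le (hd : 2 ≤ d) (hc : 0 ≤ c) {n M : ℕ} (hn0 : 0 < n)
    (hp1 : c / n ≤ 1) {b : ℝ} (hb1 : 1 ≤ b) (hcb : 2 * c ≤ b) (hbM : (b ^ M) ^ 2 ≤ n)
    (hMd : M * (d + 1) ≤ n) :
    bern (c / n) (topFaces n d) {ω | ∃ m ∈ Ico 1 (M + 1), ∃ K ⊆ ω, IsMinCore K ∧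
      K.card = m ∧ ¬ HasSimplexBoundary d K} ≤
      ((d : ℝ) + 1) ^ (d + 1) * ((M : ℝ) ^ (d + 2) / b ^ M) := by
  have hn : (0 : ℝ) < n := by exact_mod_cast hn0
  have hp0 : 0 ≤ c / n := by positivity
  have hb0 : 0 < b := by linarith
  refine (bern_le_sum hp0 hp1 (Ico 1 (M + 1)) _ (fun m => {ω | ∃ K ⊆ ω, IsMinCore K ∧
      K.card = m ∧ ¬ HasSimplexBoundary d K}) (fun ω _ h => h)).trans ?_
  have hterm : ∀ m ∈ Ico 1 (M + 1), bern (c / n) (topFaces n d) {ω | ∃ K ⊆ ω, IsMinCore K ∧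
      K.card = m ∧ ¬ HasSimplexBoundary d K} ≤
      ((d : ℝ) + 1) ^ (d + 1) * ((M : ℝ) ^ (d + 1) / b ^ M) := by
    intro m hm
    rw [mem_Ico] at hm
    refine (bern_smallCore_le hd hp0 hp1 (show m ≤ M by omega) hMd).trans ?_
    have h1 : (2 * n : ℝ) ^ (m - 1) * (c / n) ^ m * (2 * n) = (2 * c) ^ m := by
      rw [← two_mul_pow_mul_div_pow hn0 c m]
      obtain ⟨k, rfl⟩ : ∃ k, m = k + 1 := ⟨m - 1, by omega⟩
      rw [Nat.add_sub_cancel, pow_succ (2 * n : ℝ)]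
      ring
    have h2 : (2 * c) ^ m ≤ b ^ M :=
      (pow_le_pow_left₀ (by positivity) hcb m).trans (pow_le_pow_right₀ hb1 (by omega))
    have h3 : (2 * n : ℝ) ^ (m - 1) * (c / n) ^ m ≤ 1 / b ^ M := by
      rw [le_div_iff₀ (by positivity)]
      have h4 : 0 ≤ (2 * n : ℝ) ^ (m - 1) * (c / n) ^ m := by positivity
      refine le_of_mul_le_mul_right ?_ (show (0 : ℝ) < b ^ M by positivity)
      calc (2 * n : ℝ) ^ (m - 1) * (c / n) ^ m * b ^ M * b ^ M
          = (2 * n : ℝ) ^ (m - 1) * (c / n) ^ m * (b ^ M) ^ 2 := by ring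
        _ ≤ (2 * n : ℝ) ^ (m - 1) * (c / n) ^ m * (2 * n) := by gcongr; linarith
        _ ≤ 1 * b ^ M := by rw [h1, one_mul]; exact h2
    have h5 : (n : ℝ) ^ (d + 1) * ((2 * n) ^ (m - 1) * (M * (d + 1) / n) ^ (d + 1) *
        (c / n) ^ m) = ((d : ℝ) + 1) ^ (d + 1) * ((M : ℝ) ^ (d + 1) *
        ((2 * n : ℝ) ^ (m - 1) * (c / n) ^ m)) := by
      rw [div_pow, mul_pow (M : ℝ)]
      field_simp
    rw [h5, div_eq_mul_one_div ((M : ℝ) ^ (d + 1))]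
    gcongr
  refine (sum_le_sum hterm).trans_eq ?_
  rw [sum_const, Nat.card_Ico, Nat.add_sub_cancel, nsmul_eq_mul]
  ring
-- At least `m / L` steps are marked and each gains `ξ ^ L`, so every simplex effectively gains `ξ`.
-- The sum becomes geometric with ratio `θ` and starts late enough to beat `n ^ (d + 1)`.
theorem bern_largeCores_le (hd : 2 ≤ d) (hc : 0 ≤ c) {n M J L : ℕ} (hn0 : 0 < n)
    (hp1 : c / n ≤ 1) (hL : L = 8 * (d + 2)) {η ξ θ δ : ℝ} (hη0 : 0 < η) (hη1 : η ≤ 1)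
    (hη8 : 8 * (d + 2) * (8 ^ d * η * (d + 1)) ≤ 1) (hηκ : 2 ^ d * d * η ≤ ξ ^ L)
    (hξ0 : 0 < ξ) (hξ1 : ξ ≤ 1) (hJ' : (16 * 2 ^ d * (d + 1) : ℝ) ≤ J)
    (hdμ : (d : ℝ) + 1 ≤ (η / 2 ^ J) ^ 3 ^ d * n) (hδ : δ * (d + 1) < (η / 2 ^ J) ^ 3 ^ d)
    (hθ0 : 0 ≤ θ) (hθ2 : θ ≤ 1 / 2) (hcξ : 2 * c * ξ ≤ θ)
    (hθM : θ ^ (M + 1) ≤ ((n : ℝ) ^ (d + 2))⁻¹) :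
    bern (c / n) (topFaces n d) {ω | ∃ m ∈ (Ico (M + 1) ((topFaces n d).card + 1)).filter
      (fun m : ℕ => (m : ℝ) ≤ δ * (n : ℝ) ^ d), ∃ K ⊆ ω, IsMinCore K ∧ K.card = m} ≤
      2 * J / n := by
  have hn : (0 : ℝ) < n := by exact_mod_cast hn0
  have hp0 : 0 ≤ c / n := by positivity
  have hκ1 : ξ ^ L ≤ 1 := pow_le_one₀ hξ0.le hξ1
  set μ : ℝ := (η / 2 ^ J) ^ 3 ^ d with hμ
  refine (bern_le_sum hp0 hp1 _ _ (fun m => {ω | ∃ K ⊆ ω, IsMinCore K ∧ K.card = m})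
    (fun ω _ h => h)).trans ?_
  have hterm : ∀ m ∈ (Ico (M + 1) ((topFaces n d).card + 1)).filter
      (fun m : ℕ => (m : ℝ) ≤ δ * (n : ℝ) ^ d),
      bern (c / n) (topFaces n d) {ω | ∃ K ⊆ ω, IsMinCore K ∧ K.card = m} ≤
      J * (n : ℝ) ^ (d + 1) * θ ^ m := by
    intro m hm
    rw [mem_filter, mem_Ico] at hm
    obtain ⟨⟨hm1, -⟩, hm2⟩ := hm
    have hLpos : 0 < L := by omega
    have hq : 8 * (d + 2) * (((m - 1) / L + 1) - 1) < m := by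
      rw [Nat.add_sub_cancel, ← hL]
      have := Nat.mul_div_le (m - 1) L
      omega
    have hqm : m ≤ L * ((m - 1) / L + 1) := by
      have := Nat.lt_mul_div_succ (m - 1) hLpos
      omega
    have hms : (m : ℝ) * (d + 1) < μ * (n : ℝ) ^ d := by
      have hnd : 0 < (n : ℝ) ^ d := by positivity
      calc (m : ℝ) * (d + 1) ≤ δ * (n : ℝ) ^ d * (d + 1) := by gcongr
        _ = δ * (d + 1) * (n : ℝ) ^ d := by ring
        _ < μ * (n : ℝ) ^ d := by gcongr
    refine (bern_largeCore_le hd hp0 hp1 hη0 hη1 hη8 hηκ hκ1 hJ' hdμ hq hms).trans ?_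
    have h1 : (ξ ^ L) ^ ((m - 1) / L + 1) ≤ ξ ^ m := by
      rw [← pow_mul]
      exact pow_le_pow_of_le_one hξ0.le hξ1 hqm
    have h2n : (1 : ℝ) ≤ 2 * n := by
      have : (1 : ℝ) ≤ n := by exact_mod_cast hn0
      linarith
    have h2 : (2 * n : ℝ) ^ (m - 1) ≤ (2 * n) ^ m := pow_le_pow_right₀ h2n (by omega)
    have h3 : (2 * n : ℝ) ^ (m - 1) * (ξ ^ L) ^ ((m - 1) / L + 1) * (c / n) ^ m ≤ θ ^ m := by
      calc (2 * n : ℝ) ^ (m - 1) * (ξ ^ L) ^ ((m - 1) / L + 1) * (c / n) ^ m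
          ≤ (2 * n : ℝ) ^ m * ξ ^ m * (c / n) ^ m := by gcongr
        _ = (2 * n : ℝ) ^ m * (c / n) ^ m * ξ ^ m := by ring
        _ = (2 * c * ξ) ^ m := by rw [two_mul_pow_mul_div_pow hn0 c, ← mul_pow]
        _ ≤ θ ^ m := by gcongr
    rw [mul_assoc (J : ℝ)]
    gcongr
  refine (sum_le_sum hterm).trans ?_
  rw [← mul_sum]
  have hgeom : ∑ m ∈ (Ico (M + 1) ((topFaces n d).card + 1)).filter
      (fun m : ℕ => (m : ℝ) ≤ δ * (n : ℝ) ^ d), θ ^ m ≤ 2 * θ ^ (M + 1) := by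
    refine (sum_le_sum_of_subset_of_nonneg (filter_subset _ _)
      fun m _ _ => pow_nonneg hθ0 m).trans ?_
    refine (geom_sum_Ico_le_of_lt_one hθ0 (by linarith)).trans ?_
    rw [div_le_iff₀ (by linarith)]
    nlinarith [pow_nonneg hθ0 (M + 1)]
  calc (J : ℝ) * (n : ℝ) ^ (d + 1) * _ ≤ J * (n : ℝ) ^ (d + 1) * (2 * ((n : ℝ) ^ (d + 2))⁻¹) := by
        refine mul_le_mul_of_nonneg_left (hgeom.trans ?_) (by positivity)
        linarith
    _ = 2 * J / n := by
        rw [pow_succ (n : ℝ) (d + 1)]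
        field_simp

theorem exists_tendsto_bern_core (hd : 2 ≤ d) (hc : 0 ≤ c) :
    ∃ δ > 0, Tendsto (fun n : ℕ => bern (c / n) (topFaces n d)
      {ω | ∃ K ⊆ ω, IsMinCore K ∧ (K.card : ℝ) ≤ δ * (n : ℝ) ^ d ∧ ¬ HasSimplexBoundary d K})
      atTop (𝓝 0) := by
  set b : ℕ := ⌈2 * c⌉₊ + 2 with hb
  have hb2 : (2 : ℝ) ≤ b := by rw [hb]; push_cast; linarith [Nat.cast_nonneg (α := ℝ) ⌈2 * c⌉₊]
  have hb1 : (1 : ℝ) < b := by linarith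
  have hb0 : (0 : ℝ) < b := by linarith
  have hcb : 2 * c ≤ b := by
    rw [hb]; push_cast; linarith [Nat.le_ceil (2 * c)]
  set L : ℕ := 8 * (d + 2) with hL
  -- The exponent is `2 * (d + 2) + 1`: one factor `b` absorbs `2 * c`, and the rest is `θ`, whose
  -- power `M + 1` beats `n ^ (d + 2)`.
  set ξ : ℝ := ((b : ℝ) ^ (2 * d + 5))⁻¹ with hξ
  have hξ0 : 0 < ξ := by positivity
  have hξ1 : ξ ≤ 1 := inv_le_one_of_one_le₀ (one_le_pow₀ hb1.le)
  set κ : ℝ := ξ ^ L with hκ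
  have hκ0 : 0 < κ := by positivity
  have hκ1 : κ ≤ 1 := pow_le_one₀ hξ0.le hξ1
  -- Dividing by this one constant makes `η` small enough both for the scattered facets and for the
  -- marked vertices.
  set D : ℝ := 8 * (d + 2) * 8 ^ d * (d + 1) with hD
  have hD1 : 2 ^ d * d ≤ D := by
    have h8 : (2 : ℝ) ^ d ≤ 8 ^ d := by gcongr; norm_num
    have hd0 : (0 : ℝ) ≤ d := Nat.cast_nonneg d
    calc (2 : ℝ) ^ d * d ≤ 8 ^ d * (8 * (d + 2) * (d + 1)) := by
          gcongr
          nlinarith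
      _ = D := by rw [hD]; ring
  have hDone : 1 ≤ D := by
    have h8 : (1 : ℝ) ≤ 8 ^ d := one_le_pow₀ (by norm_num)
    have hd0 : (0 : ℝ) ≤ d := Nat.cast_nonneg d
    calc (1 : ℝ) = 1 * 1 := by ring
      _ ≤ 8 ^ d * (8 * (d + 2) * (d + 1)) := by
          gcongr
          nlinarith
      _ = D := by rw [hD]; ring
  have hD0 : 0 < D := by linarith
  set η : ℝ := κ / D with hη
  have hη0 : 0 < η := by positivity
  have hη1 : η ≤ 1 := (div_le_self hκ0.le hDone).trans hκ1
  have hη8 : 8 * (d + 2) * (8 ^ d * η * (d + 1)) ≤ 1 := by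
    have : 8 * (d + 2) * (8 ^ d * η * (d + 1)) = η * D := by rw [hD]; ring
    rw [this, hη, div_mul_cancel₀ _ hD0.ne']
    exact hκ1
  have hηκ : 2 ^ d * d * η ≤ κ := by
    calc 2 ^ d * d * η ≤ D * η := by gcongr
      _ = κ := by rw [hη, mul_div_cancel₀ _ hD0.ne']
  set J : ℕ := 16 * 2 ^ d * (d + 1) with hJ
  have hJ' : (16 * 2 ^ d * (d + 1) : ℝ) ≤ J := by rw [hJ]; push_cast; exact le_rfl
  set μ : ℝ := (η / 2 ^ J) ^ 3 ^ d with hμ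
  have hμ0 : 0 < μ := by positivity
  -- The factor `1 / 2` provides the strict inequality that keeps the empty face light.
  set δ : ℝ := μ / 2 / (d + 1) with hδ
  have hδ0 : 0 < δ := by positivity
  refine ⟨δ, hδ0, ?_⟩
  -- With base `b ^ 2`, one has `b ^ (2 * M) ≤ n < b ^ (2 * (M + 1))`: the left bound serves small
  -- cores, the right one large cores.
  set M : ℕ → ℕ := fun n => Nat.log (b ^ 2) n with hM
  have hb2' : 1 < b ^ 2 := by
    have : 2 ≤ b := by omega
    nlinarith
  have hMtop : Tendsto M atTop atTop := tendsto_log_atTop hb2'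
  have hlim1 : Tendsto (fun n : ℕ => ((d : ℝ) + 1) ^ (d + 1) *
      ((M n : ℝ) ^ (d + 2) / (b : ℝ) ^ M n)) atTop (𝓝 0) := by
    have := ((tendsto_pow_const_div_const_pow_of_one_lt (d + 2) hb1).comp hMtop).const_mul
      (((d : ℝ) + 1) ^ (d + 1))
    rwa [mul_zero] at this
  have hlim2 : Tendsto (fun n : ℕ => 2 * (J : ℝ) / n) atTop (𝓝 0) :=
    tendsto_const_div_atTop_nhds_zero_nat _
  have hlim3 : Tendsto (fun n : ℕ => ((M n : ℝ) ^ 1 / (b : ℝ) ^ M n) * (d + 1)) atTop (𝓝 0) := by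
    have := ((tendsto_pow_const_div_const_pow_of_one_lt 1 hb1).comp hMtop).mul_const
      ((d : ℝ) + 1)
    rwa [zero_mul] at this
  have hlim4 : Tendsto (fun n : ℕ => ((d : ℝ) + 1) / μ / n) atTop (𝓝 0) :=
    tendsto_const_div_atTop_nhds_zero_nat _
  have hp1 : ∀ᶠ n : ℕ in atTop, c / n < 1 :=
    (tendsto_const_div_atTop_nhds_zero_nat c).eventually_lt_const one_pos
  have hsum := hlim1.add hlim2
  rw [add_zero] at hsum
  refine tendsto_of_tendsto_of_tendsto_of_le_of_le' tendsto_const_nhds hsum ?_ ?_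
  · filter_upwards [hp1] with n h1
    exact bern_nonneg (by positivity) h1.le _
  filter_upwards [hp1, eventually_gt_atTop 0, hlim3.eventually_lt_const one_pos,
    hlim4.eventually_lt_const one_pos] with n hp1 hn0 hMn hμn
  have hn : (0 : ℝ) < n := by exact_mod_cast hn0
  have hp0 : 0 ≤ c / n := by positivity
  have hbM : ((b : ℝ) ^ M n) ^ 2 ≤ n := by
    have h1 := Nat.pow_log_le_self (b ^ 2) hn0.ne'
    have h2 : (((b ^ 2) ^ M n : ℕ) : ℝ) ≤ n := by exact_mod_cast h1
    rwa [Nat.cast_pow, Nat.cast_pow, ← pow_mul, mul_comm, pow_mul] at h2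
  have hbM1 : 1 ≤ (b : ℝ) ^ M n := one_le_pow₀ hb1.le
  have hbM' : (b : ℝ) ^ M n ≤ n := by nlinarith
  have hMd : M n * (d + 1) ≤ n := by
    have h1 : (M n : ℝ) * (d + 1) ≤ (b : ℝ) ^ M n := by
      rw [pow_one, div_mul_eq_mul_div, div_lt_one (by positivity)] at hMn
      exact hMn.le
    exact_mod_cast h1.trans hbM'
  have hdμ : (d : ℝ) + 1 ≤ μ * n := by
    rw [div_lt_one hn, div_lt_iff₀ hμ0] at hμn
    linarith
  have hcover : bern (c / n) (topFaces n d) {ω | ∃ K ⊆ ω, IsMinCore K ∧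
      (K.card : ℝ) ≤ δ * (n : ℝ) ^ d ∧ ¬ HasSimplexBoundary d K} ≤
      bern (c / n) (topFaces n d) {ω | ∃ m ∈ Ico 1 (M n + 1), ∃ K ⊆ ω, IsMinCore K ∧
        K.card = m ∧ ¬ HasSimplexBoundary d K} +
      bern (c / n) (topFaces n d) {ω | ∃ m ∈ (Ico (M n + 1) ((topFaces n d).card + 1)).filter
        (fun m : ℕ => (m : ℝ) ≤ δ * (n : ℝ) ^ d), ∃ K ⊆ ω, IsMinCore K ∧ K.card = m} := by
    refine (bern_mono hp0 hp1.le ?_).trans (bern_union_le hp0 hp1.le _ _)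
    rintro ω hω ⟨K, hKω, hK, hKδ, hb⟩
    have hpos := card_pos.2 hK.1
    rcases le_or_gt K.card (M n) with h | h
    · exact Or.inl ⟨K.card, mem_Ico.2 ⟨hpos, by omega⟩, K, hKω, hK, rfl, hb⟩
    · have := card_le_card (hKω.trans hω)
      exact Or.inr ⟨K.card, mem_filter.2 ⟨mem_Ico.2 ⟨h, by omega⟩, hKδ⟩, K, hKω, hK, rfl⟩
  refine hcover.trans (add_le_add
    (bern_smallCores_le hd hc hn0 hp1.le hb1.le hcb hbM hMd) ?_)
  set θ : ℝ := ((b : ℝ) ^ (2 * (d + 2)))⁻¹ with hθ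
  have hθ0 : 0 ≤ θ := by positivity
  have hθ2 : θ ≤ 1 / 2 := by
    rw [hθ, one_div]
    exact inv_anti₀ (by norm_num) (hb2.trans (le_self_pow₀ hb1.le (by omega)))
  have hcξ : 2 * c * ξ ≤ θ := by
    have : θ = b * ξ := by
      rw [hθ, hξ, show 2 * d + 5 = 2 * (d + 2) + 1 by ring, pow_succ]
      field_simp
    rw [this]
    gcongr
  have hθM : θ ^ (M n + 1) ≤ ((n : ℝ) ^ (d + 2))⁻¹ := by
    have h1 : (n : ℝ) ≤ ((b : ℝ) ^ 2) ^ (M n + 1) := by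
      exact_mod_cast (Nat.lt_pow_succ_log_self hb2' n).le
    have h2 : θ ^ (M n + 1) = ((((b : ℝ) ^ 2) ^ (M n + 1)) ^ (d + 2))⁻¹ := by
      rw [hθ, inv_pow]
      congr 1
      rw [← pow_mul, ← pow_mul, ← pow_mul]
      congr 1
      ring
    rw [h2]
    exact inv_anti₀ (by positivity) (pow_le_pow_left₀ hn.le h1 _)
  have hδμ : δ * (d + 1) < μ := by
    rw [hδ, div_mul_cancel₀ _ (by positivity)]
    linarith
  exact bern_largeCores_le hd hc hn0 hp1.le hL hη0 hη1 hη8 hηκ hξ0 hξ1 hJ' hdμ hδμ hθ0 hθ2 hcξ hθM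

end CoreLimit

/-! ### The probability that no boundary of a simplex occurs -/

section Poisson

variable {n d : ℕ} {p : ℝ}

/-- The facets of `T`. -/
def facets (T : Finset (Fin n)) : Finset (Finset (Fin n)) := T.image fun v => T.erase v

theorem hasSimplexBoundary_iff {ω : Finset (Finset (Fin n))} :
    HasSimplexBoundary d ω ↔ ∃ T ∈ powersetCard (d + 2) univ, facets T ⊆ ω := by
  simp [HasSimplexBoundary, mem_powersetCard, facets, image_subset_iff]

theorem card_facets {T : Finset (Fin n)} : (facets T).card = T.card :=
  card_image_of_injOn (erase_injOn T)

theorem facets_subset {T : Finset (Fin n)} (hT : T.card = d + 2) : facets T ⊆ topFaces n d := by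
  intro t ht
  obtain ⟨v, hv, rfl⟩ := mem_image.1 ht
  rw [mem_topFaces, card_erase_of_mem hv, hT]; rfl

theorem card_facets_inter_le {T T' : Finset (Fin n)} (hT : T.card = d + 2)
    (hT' : T'.card = d + 2) (hne : T ≠ T') : (facets T ∩ facets T').card ≤ 1 := by
  have hlt : (T ∩ T').card ≤ d + 1 := by
    by_contra hcon
    have h1 : T ∩ T' = T := eq_of_subset_of_card_le inter_subset_left (by omega)
    have h2 : T ∩ T' = T' := eq_of_subset_of_card_le inter_subset_right (by omega)
    exact hne (h1.symm.trans h2)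
  have huniq : ∀ t ∈ facets T ∩ facets T', t = T ∩ T' := by
    intro t ht
    obtain ⟨h1, h2⟩ := mem_inter.1 ht
    have hc := mem_topFaces.1 (facets_subset hT h1)
    obtain ⟨v, -, rfl⟩ := mem_image.1 h1
    obtain ⟨w, -, hw⟩ := mem_image.1 h2
    exact eq_of_subset_of_card_le
      (subset_inter (erase_subset _ _) (hw ▸ erase_subset _ _)) (by omega)
  exact card_le_one.2 fun a ha b hb => (huniq a ha).trans (huniq b hb).symm

theorem card_neighbours_le {T : Finset (Fin n)} (hT : T.card = d + 2)
    (𝒯 : Finset (Finset (Fin n))) :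
    (𝒯.filter fun T' => ¬ Disjoint (facets T) (facets T')).card ≤ (d + 2) * n := by
  have hsub : (𝒯.filter fun T' => ¬ Disjoint (facets T) (facets T')) ⊆
      T.biUnion fun v => univ.image fun x => insert x (T.erase v) := by
    intro T' hT'
    obtain ⟨h1, h2⟩ := mem_filter.1 hT'
    obtain ⟨t, ht, ht'⟩ := not_disjoint_iff.1 h2
    obtain ⟨v, hv, rfl⟩ := mem_image.1 ht
    obtain ⟨w, hw, hwt⟩ := mem_image.1 ht'
    refine mem_biUnion.2 ⟨v, hv, mem_image.2 ⟨w, mem_univ _, ?_⟩⟩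
    rw [← hwt]
    exact insert_erase hw
  refine (card_le_card hsub).trans ?_
  rw [← hT]
  exact card_biUnion_le_card_mul _ _ _ fun v _ =>
    card_image_le.trans ((card_univ).trans (Fintype.card_fin n)).le

theorem bern_noBoundary_ge (h0 : 0 ≤ p) (h1 : p ≤ 1) :
    (1 - p ^ (d + 2)) ^ n.choose (d + 2) ≤
      bern p (topFaces n d) {ω | ¬ HasSimplexBoundary d ω} := by
  have h := bern_biInter_ge (G := topFaces n d) h0 h1 (powersetCard (d + 2) univ)
    (A := fun T : Finset (Fin n) => {ω | facets T ⊆ ω}ᶜ)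
    fun T _ => IsUpperSet.compl fun a b hab h => h.trans hab
  have h2 : ∀ T ∈ powersetCard (d + 2) (univ : Finset (Fin n)),
      bern p (topFaces n d) {ω | facets T ⊆ ω}ᶜ = 1 - p ^ (d + 2) := by
    intro T hT
    have hc := (mem_powersetCard.1 hT).2
    rw [bern_compl, bern_superset (facets_subset hc), card_facets, hc]
  rw [prod_congr rfl h2, prod_const, card_powersetCard, card_univ, Fintype.card_fin] at h
  refine h.trans_eq (bern_congr fun ω _ => ?_)
  simp only [Set.mem_ofPred_eq, Set.mem_compl_iff, hasSimplexBoundary_iff]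
  push Not
  rfl

/-- Add the sets `T` one at a time. The boundary of `T` is independent of the sets sharing no facet
with it; the others are at most `(d + 2) * n`, and with `T` each spans at least `2 * d + 3`
simplices. Hence avoiding `T` costs a factor `1 - p ^ (d + 2)` up to a small additive error. -/
theorem bern_noFacets_le (h0 : 0 ≤ p) (h1 : p ≤ 1) (𝒯 : Finset (Finset (Fin n)))
    (h𝒯 : ∀ T ∈ 𝒯, T.card = d + 2) :
    bern p (topFaces n d) {ω | ∀ T ∈ 𝒯, ¬ facets T ⊆ ω} ≤
      (1 - p ^ (d + 2)) ^ 𝒯.card + 𝒯.card * ((d + 2) * n * p ^ (2 * d + 3)) := by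
  have hπ : p ^ (d + 2) ≤ 1 := pow_le_one₀ h0 h1
  have hπ0 : 0 ≤ p ^ (d + 2) := pow_nonneg h0 _
  induction 𝒯 using Finset.induction_on with
  | empty => simpa using bern_le_one h0 h1 _
  | insert T 𝒯 hT ih =>
    have ih := ih fun T' hT' => h𝒯 T' (mem_insert_of_mem hT')
    have hTc := h𝒯 T (mem_insert_self _ _)
    set D : Set (Finset (Finset (Fin n))) := {ω | ∀ T ∈ 𝒯, ¬ facets T ⊆ ω} with hD
    set D' : Set (Finset (Finset (Fin n))) :=
      {ω | ∀ T' ∈ 𝒯, Disjoint (facets T) (facets T') → ¬ facets T' ⊆ ω} with hD'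
    set E : Set (Finset (Finset (Fin n))) := {ω | facets T ⊆ ω} with hE
    set 𝒩 := 𝒯.filter fun T' => ¬ Disjoint (facets T) (facets T') with h𝒩
    have e1 : bern p (topFaces n d) {ω | ∀ T' ∈ insert T 𝒯, ¬ facets T' ⊆ ω} +
        bern p (topFaces n d) (E ∩ D) = bern p (topFaces n d) D := by
      have h2 := bern_union_add_inter (p := p) (G := topFaces n d)
        {ω | ∀ T' ∈ insert T 𝒯, ¬ facets T' ⊆ ω} (E ∩ D)
      have h3 : {ω | ∀ T' ∈ insert T 𝒯, ¬ facets T' ⊆ ω} ∪ E ∩ D = D := by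
        ext ω
        simp only [Set.mem_union, Set.mem_ofPred_eq, forall_mem_insert, Set.mem_inter_iff, hE, hD]
        tauto
      have h4 : {ω | ∀ T' ∈ insert T 𝒯, ¬ facets T' ⊆ ω} ∩ (E ∩ D) = ∅ := by
        ext ω
        simp only [Set.mem_ofPred_eq, forall_mem_insert, Set.mem_inter_iff, hE, hD,
          Set.mem_empty_iff_false, iff_false]
        tauto
      have h5 : bern p (topFaces n d) (∅ : Set (Finset (Finset (Fin n)))) = 0 := by
        rw [bern, Set.indicator_empty]
        exact expect_const 0
      rw [h3, h4, h5] at h2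
      linarith
    have e2 : bern p (topFaces n d) (E ∩ D') = p ^ (d + 2) * bern p (topFaces n d) D' := by
      rw [hE, bern_superset_inter (facets_subset hTc) D' ?_, card_facets, hTc]
      intro e he ω
      simp only [hD', Set.mem_ofPred_eq]
      refine forall₃_congr fun T' _ hdis => ?_
      rw [subset_insert_iff_of_notMem (disjoint_left.1 hdis he)]
    have e3 : bern p (topFaces n d) D ≤ bern p (topFaces n d) D' :=
      bern_mono h0 h1 fun ω _ h T' hT' _ => h T' hT'
    have e4 : bern p (topFaces n d) (E ∩ D') ≤ bern p (topFaces n d) (E ∩ D) +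
        bern p (topFaces n d) {ω | ∃ T' ∈ 𝒩, facets T ∪ facets T' ⊆ ω} := by
      refine (bern_mono h0 h1 ?_).trans (bern_union_le h0 h1 _ _)
      rintro ω - ⟨h2, h3⟩
      by_cases h4 : ω ∈ D
      · exact Or.inl ⟨h2, h4⟩
      · simp only [hD, Set.mem_ofPred_eq] at h4
        push Not at h4
        obtain ⟨T', hT', h5⟩ := h4
        exact Or.inr ⟨T', mem_filter.2 ⟨hT', fun h => h3 T' hT' h h5⟩, union_subset h2 h5⟩
    have e5 : bern p (topFaces n d) {ω | ∃ T' ∈ 𝒩, facets T ∪ facets T' ⊆ ω} ≤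
        (d + 2) * n * p ^ (2 * d + 3) := by
      refine (bern_le_sum h0 h1 𝒩 _ (fun T' => {ω | facets T ∪ facets T' ⊆ ω})
        (fun ω _ h => h)).trans ?_
      refine (sum_le_card_nsmul _ _ (p ^ (2 * d + 3)) fun T' hT' => ?_).trans ?_
      · have hT'𝒯 := (mem_filter.1 hT').1
        have hT'c := h𝒯 T' (mem_insert_of_mem hT'𝒯)
        rw [bern_superset (union_subset (facets_subset hTc) (facets_subset hT'c))]
        refine pow_le_pow_of_le_one h0 h1 ?_
        have h2 := card_facets_inter_le hTc hT'c fun h => hT (h ▸ hT'𝒯)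
        have h3 := card_union_add_card_inter (facets T) (facets T')
        rw [card_facets, card_facets, hTc, hT'c] at h3
        omega
      · rw [nsmul_eq_mul]
        refine mul_le_mul_of_nonneg_right ?_ (pow_nonneg h0 _)
        exact_mod_cast card_neighbours_le hTc 𝒯
    have e6 := mul_le_mul_of_nonneg_left e3 hπ0
    have e7 := mul_le_mul_of_nonneg_left ih (sub_nonneg.2 hπ)
    have e8 : (1 - p ^ (d + 2)) * ((𝒯.card : ℝ) * ((d + 2) * n * p ^ (2 * d + 3))) ≤
        𝒯.card * ((d + 2) * n * p ^ (2 * d + 3)) :=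
      mul_le_of_le_one_left (by positivity) (by linarith)
    rw [card_insert_of_notMem hT, pow_succ']
    push_cast
    linarith

theorem tendsto_choose_mul_pow (k : ℕ) (c : ℝ) :
    Tendsto (fun n : ℕ => (n.choose k : ℝ) * (c / n) ^ k) atTop (𝓝 (c ^ k / k.factorial)) := by
  refine ProbabilityTheory.tendsto_choose_mul_pow_atTop k (tendsto_const_nhds.congr' ?_)
  filter_upwards [eventually_gt_atTop 0] with n hn
  have : (n : ℝ) ≠ 0 := by positivity
  field_simp

theorem tendsto_bern_noBoundary (d : ℕ) (hd : 0 < d) {c : ℝ} (hc : 0 ≤ c) :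
    Tendsto (fun n : ℕ => bern (c / n) (topFaces n d) {ω | ¬ HasSimplexBoundary d ω}) atTop
      (𝓝 (Real.exp (-(c ^ (d + 2) / (d + 2).factorial)))) := by
  have hlim := tendsto_choose_mul_pow (d + 2) c
  have hp0 := tendsto_const_div_atTop_nhds_zero_nat c
  have hπ : Tendsto (fun n : ℕ => 1 - (c / n) ^ (d + 2)) atTop (𝓝 1) := by
    have := (hp0.pow (d + 2)).const_sub 1
    simpa using this
  have hlow : Tendsto (fun n : ℕ => Real.exp (-((n.choose (d + 2) : ℝ) * (c / n) ^ (d + 2) /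
      (1 - (c / n) ^ (d + 2))))) atTop (𝓝 (Real.exp (-(c ^ (d + 2) / (d + 2).factorial)))) := by
    have := (hlim.div hπ one_ne_zero).neg.rexp
    rwa [div_one] at this
  have hup : Tendsto (fun n : ℕ => Real.exp (-((n.choose (d + 2) : ℝ) * (c / n) ^ (d + 2))) +
      (d + 2) * c ^ (2 * d + 3) / n) atTop
      (𝓝 (Real.exp (-(c ^ (d + 2) / (d + 2).factorial)))) := by
    have := hlim.neg.rexp.add
      (tendsto_const_div_atTop_nhds_zero_nat (((d : ℝ) + 2) * c ^ (2 * d + 3)))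
    rwa [add_zero] at this
  refine tendsto_of_tendsto_of_tendsto_of_le_of_le' hlow hup ?_ ?_
  · filter_upwards [hp0.eventually_lt_const one_pos, hπ.eventually_const_lt one_half_lt_one]
      with n h1 h2
    refine le_trans ?_ (bern_noBoundary_ge (by positivity) h1.le)
    set π := (c / (n : ℝ)) ^ (d + 2) with hπdef
    have hpos : 0 < 1 - π := by linarith
    -- This exponential lower bound for `1 - π` turns the Harris product into a function of
    -- `n.choose (d + 2) * π`, whose limit is known.
    have h3 : Real.exp (-(π / (1 - π))) ≤ 1 - π := by
      rw [← Real.le_log_iff_exp_le hpos]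
      refine le_trans (le_of_eq ?_) (Real.one_sub_inv_le_log_of_pos hpos)
      field_simp
      ring
    calc Real.exp (-((n.choose (d + 2) : ℝ) * π / (1 - π)))
        = Real.exp (-(π / (1 - π))) ^ n.choose (d + 2) := by
          rw [← Real.exp_nat_mul]; ring_nf
      _ ≤ _ := pow_le_pow_left₀ (Real.exp_pos _).le h3 _
  · filter_upwards [hp0.eventually_lt_const one_pos, eventually_gt_atTop 0] with n h1 hn
    have hn' : (0 : ℝ) < n := by exact_mod_cast hn
    have hp : 0 ≤ c / n := by positivity
    have h2 := bern_noFacets_le (n := n) (d := d) hp h1.le (powersetCard (d + 2) univ)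
      fun T hT => (mem_powersetCard.1 hT).2
    have h3 : bern (c / n) (topFaces n d) {ω | ¬ HasSimplexBoundary d ω} =
        bern (c / n) (topFaces n d) {ω | ∀ T ∈ powersetCard (d + 2) (univ : Finset (Fin n)),
          ¬ facets T ⊆ ω} := by
      refine bern_congr fun ω _ => ?_
      simp only [Set.mem_ofPred_eq, hasSimplexBoundary_iff]
      push Not
      rfl
    rw [card_powersetCard, card_univ, Fintype.card_fin] at h2
    rw [h3]
    refine h2.trans (add_le_add ?_ ?_)
    · have hπ1 : (c / n) ^ (d + 2) ≤ 1 := pow_le_one₀ hp h1.le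
      have h4 := Real.one_sub_le_exp_neg ((c / n) ^ (d + 2))
      calc _ ≤ Real.exp (-(c / n) ^ (d + 2)) ^ n.choose (d + 2) :=
            pow_le_pow_left₀ (by linarith) h4 _
        _ = _ := by rw [← Real.exp_nat_mul]; congr 1; ring
    · have h5 : (n.choose (d + 2) : ℝ) ≤ (n : ℝ) ^ (d + 2) := by
        exact_mod_cast Nat.choose_le_pow n (d + 2)
      have hn1 : (1 : ℝ) ≤ n := by exact_mod_cast hn
      calc (n.choose (d + 2) : ℝ) * ((d + 2) * n * (c / n) ^ (2 * d + 3))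
          ≤ (n : ℝ) ^ (d + 2) * ((d + 2) * n * (c / n) ^ (2 * d + 3)) := by gcongr
        _ = (d + 2) * c ^ (2 * d + 3) / (n : ℝ) ^ d := by
            rw [div_pow, show 2 * d + 3 = (d + 2) + 1 + d by ring, pow_add (n : ℝ),
              pow_add (n : ℝ)]
            field_simp
            ring
        _ ≤ (d + 2) * c ^ (2 * d + 3) / n := by
            gcongr
            exact le_self_pow₀ hn1 hd.ne'

end Poisson

/-! ### Complexes between the skeleta and their sets of top-dimensional simplices -/

section Bridge

variable {n d : ℕ} {p : ℝ}

theorem mem_simplices {Y : PreAbstractSimplicialComplex (Fin n)} {i : ℕ} {s : Finset (Fin n)} :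
    s ∈ simplices Y i ↔ s ∈ Y ∧ s.card = i + 1 := by
  simp [simplices]

theorem simplices_subset (Y : PreAbstractSimplicialComplex (Fin n)) (d : ℕ) :
    simplices Y d ⊆ topFaces n d := fun _ hs => mem_topFaces.2 (mem_simplices.1 hs).2

/-- The complex with full `(d-1)`-skeleton and the `d`-simplices `ω`. -/
def ofTopFaces (d : ℕ) (ω : Finset (Finset (Fin n))) (hω : ω ⊆ topFaces n d) :
    PreAbstractSimplicialComplex (Fin n) where
  faces := {s | s.Nonempty ∧ (s.card ≤ d ∨ s ∈ ω)}
  isRelLowerSet_faces := by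
    rintro s ⟨hs, h⟩
    refine ⟨hs, fun t hts ht => ⟨ht, ?_⟩⟩
    have hle : t.card ≤ s.card := card_le_card hts
    rcases h with h | h
    · exact Or.inl (hle.trans h)
    · have hc := mem_topFaces.1 (hω h)
      rcases hle.eq_or_lt with he | hl
      · rw [eq_of_subset_of_card_le hts he.ge]
        exact Or.inr h
      · exact Or.inl (by omega)

theorem mem_ofTopFaces {ω : Finset (Finset (Fin n))} {hω : ω ⊆ topFaces n d}
    {s : Finset (Fin n)} : s ∈ ofTopFaces d ω hω ↔ s.Nonempty ∧ (s.card ≤ d ∨ s ∈ ω) := Iff.rfl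

theorem simplices_ofTopFaces {ω : Finset (Finset (Fin n))} (hω : ω ⊆ topFaces n d) :
    simplices (ofTopFaces d ω hω) d = ω := by
  ext s
  rw [mem_simplices, mem_ofTopFaces]
  constructor
  · rintro ⟨⟨-, h | h⟩, hc⟩
    · omega
    · exact h
  · intro h
    have hc := mem_topFaces.1 (hω h)
    exact ⟨⟨card_pos.1 (by omega), Or.inr h⟩, hc⟩

theorem isBetweenSkeleta_ofTopFaces {ω : Finset (Finset (Fin n))} (hω : ω ⊆ topFaces n d) :
    IsBetweenSkeleta d (ofTopFaces d ω hω) := by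
  refine ⟨fun s hs hc => ⟨hs, Or.inl hc⟩, ?_⟩
  rintro s ⟨-, h | h⟩
  · omega
  · exact (mem_topFaces.1 (hω h)).le

theorem mem_sampleSpace {Y : PreAbstractSimplicialComplex (Fin n)} :
    Y ∈ sampleSpace n d ↔ IsBetweenSkeleta d Y := by
  simp [sampleSpace]

theorem nonempty_of_mem {Y : PreAbstractSimplicialComplex (Fin n)} {s : Finset (Fin n)}
    (hs : s ∈ Y) : s.Nonempty := (Y.isRelLowerSet_faces hs).1

theorem IsBetweenSkeleta.ofTopFaces_simplices {Y : PreAbstractSimplicialComplex (Fin n)}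
    (hY : IsBetweenSkeleta d Y) : ofTopFaces d (simplices Y d) (simplices_subset Y d) = Y := by
  refine PreAbstractSimplicialComplex.ext (Set.ext fun s => ?_)
  change s ∈ ofTopFaces d (simplices Y d) _ ↔ s ∈ Y
  rw [mem_ofTopFaces, mem_simplices]
  constructor
  · rintro ⟨hne, h | h⟩
    · exact hY.1 s hne h
    · exact h.1
  · intro hs
    refine ⟨nonempty_of_mem hs, ?_⟩
    have := hY.2 s hs
    by_cases h : s.card ≤ d
    · exact Or.inl h
    · exact Or.inr ⟨hs, by omega⟩

/-- The top-dimensional simplices determine a complex between the skeleta, and any set of them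
occurs; the weights agree. -/
theorem prob_eq_bern (A : PreAbstractSimplicialComplex (Fin n) → Prop)
    (B : Set (Finset (Finset (Fin n))))
    (h : ∀ Y, IsBetweenSkeleta d Y → (A Y ↔ simplices Y d ∈ B)) :
    prob n d p A = bern p (topFaces n d) B := by
  classical
  unfold prob bern expect
  rw [sum_filter]
  refine sum_bij' (fun Y _ => simplices Y d)
    (fun ω hω => ofTopFaces d ω (mem_powerset.1 hω)) ?_ ?_ ?_ ?_ ?_
  · exact fun Y _ => mem_powerset.2 (simplices_subset Y d)
  · exact fun ω hω => mem_sampleSpace.2 (isBetweenSkeleta_ofTopFaces _)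
  · exact fun Y hY => (mem_sampleSpace.1 hY).ofTopFaces_simplices
  · exact fun ω hω => simplices_ofTopFaces _
  · intro Y hY
    have h1 := h Y (mem_sampleSpace.1 hY)
    have h2 : (topFaces n d).card = n.choose (d + 1) := by
      rw [topFaces, card_powersetCard, card_univ, Fintype.card_fin]
    by_cases hA : A Y
    · simp [Set.indicator, hA, h1.1 hA, weight, h2]
    · have hB : simplices Y d ∉ B := fun hB => hA (h1.2 hB)
      simp [Set.indicator, hA, hB]

theorem IsBetweenSkeleta.containsSimplexBoundary_iff {Y : PreAbstractSimplicialComplex (Fin n)}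
    (hY : IsBetweenSkeleta d Y) :
    ContainsSimplexBoundary d Y ↔ HasSimplexBoundary d (simplices Y d) := by
  constructor
  · rintro ⟨s, hs, h⟩
    refine ⟨s, hs, fun v hv => ?_⟩
    have hc : (s.erase v).card = d + 1 := by rw [card_erase_of_mem hv, hs]; rfl
    exact mem_simplices.2 ⟨h _ (erase_ssubset hv) (card_pos.1 (by omega)), hc⟩
  · rintro ⟨s, hs, h⟩
    refine ⟨s, hs, fun t hts ht => ?_⟩
    have hlt := card_lt_card hts
    by_cases hd : t.card ≤ d
    · exact hY.1 t ht hd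
    · obtain ⟨u, hu, rfl⟩ := eq_erase_of_subset (d := d + 1) hs (by omega) hts.subset
      exact (mem_simplices.1 (h u hu)).1

/-! ### Collapsing and cores -/

theorem simplices_collapseStep (Y : PreAbstractSimplicialComplex (Fin n)) :
    simplices (collapseStep d Y) d = survivors (simplices Y d) := by
  ext s
  rw [mem_simplices, survivors, mem_filter]
  constructor
  · rintro ⟨⟨hs, hfree⟩, hc⟩
    refine ⟨mem_simplices.2 ⟨hs, hc⟩, fun v hv => ?_⟩
    by_contra hcon
    push Not at hcon
    refine hfree (s.erase v) ⟨by rw [card_erase_of_mem hv, hc]; rfl, s,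
      ⟨mem_simplices.2 ⟨hs, hc⟩, erase_subset _ _⟩, fun σ hσ => ?_⟩ (erase_subset _ _)
    by_contra hne
    exact hcon σ hσ.1 hne hσ.2
  · rintro ⟨hs, h⟩
    obtain ⟨hsY, hc⟩ := mem_simplices.1 hs
    refine ⟨⟨hsY, ?_⟩, hc⟩
    rintro τ ⟨hτ, σ, -, huniq⟩ hτs
    obtain ⟨u, hu, rfl⟩ := eq_erase_of_subset hc hτ hτs
    obtain ⟨σ', hσ', hne, hsub⟩ := h u hu
    exact hne ((huniq σ' ⟨hσ', hsub⟩).trans (huniq s ⟨hs, hτs⟩).symm)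

theorem simplices_iterate_collapseStep (Y : PreAbstractSimplicialComplex (Fin n)) (i : ℕ) :
    simplices ((collapseStep d)^[i] Y) d = survivors^[i] (simplices Y d) := by
  induction i with
  | zero => rfl
  | succ i ih =>
    rw [Function.iterate_succ_apply', Function.iterate_succ_apply', simplices_collapseStep, ih]

theorem antitone_iterate_survivors (ω : Finset (Finset (Fin n))) :
    Antitone fun i => survivors^[i] ω := by
  refine antitone_nat_of_succ_le fun i => ?_
  rw [Function.iterate_succ_apply']
  exact survivors_subset _

/-- The iterates decrease, so they are constant from the first index of least size on, and a stable
family has no free facet. -/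
theorem exists_core_of_survivors (ω : Finset (Finset (Fin n))) :
    ∃ K, IsCore K ∧ (∀ r, K ⊆ survivors^[r] ω) ∧ ∀ s, (∀ r, s ∈ survivors^[r] ω) → s ∈ K := by
  obtain ⟨i, hi⟩ : ∃ i, ∀ j, (survivors^[i] ω).card ≤ (survivors^[j] ω).card :=
    ⟨Function.argmin (fun i => (survivors^[i] ω).card),
      fun j => Function.argmin_le (fun i => (survivors^[i] ω).card) j⟩
  have hstable : ∀ j, i ≤ j → survivors^[j] ω = survivors^[i] ω := fun j hj =>
    eq_of_subset_of_card_le (antitone_iterate_survivors ω hj) (hi j)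
  refine ⟨survivors^[i] ω, ?_, fun r => ?_, fun s hs => hs i⟩
  · intro σ hσ
    have h := hstable (i + 1) (by omega)
    rw [Function.iterate_succ_apply'] at h
    rw [← h] at hσ
    exact (mem_filter.1 hσ).2
  · rcases le_total i r with h | h
    · exact (hstable r h).ge
    · exact antitone_iterate_survivors ω h

theorem mem_collapseLimit {Y : PreAbstractSimplicialComplex (Fin n)} {s : Finset (Fin n)} :
    s ∈ collapseLimit d Y ↔ ∀ i, s ∈ (collapseStep d)^[i] Y := Iff.rfl

theorem IsBetweenSkeleta.isCollapsible_iff {Y : PreAbstractSimplicialComplex (Fin n)}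
    (hY : IsBetweenSkeleta d Y) :
    IsCollapsible d Y ↔ ∀ s, ∃ i, s ∉ survivors^[i] (simplices Y d) := by
  constructor
  · intro h s
    by_contra hcon
    push Not at hcon
    have hmem : ∀ i, s ∈ simplices ((collapseStep d)^[i] Y) d := fun i => by
      rw [simplices_iterate_collapseStep]; exact hcon i
    have h1 := h s (mem_collapseLimit.2 fun i => (mem_simplices.1 (hmem i)).1)
    have h2 := (mem_simplices.1 (hmem 0)).2
    omega
  · intro h s hs
    by_contra hcon
    rw [mem_collapseLimit] at hs
    have h1 := hY.2 s (hs 0)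
    obtain ⟨i, hi⟩ := h s
    rw [← simplices_iterate_collapseStep] at hi
    exact hi (mem_simplices.2 ⟨hs i, by omega⟩)

/-! ### Homology -/

variable {F : Type*} [Field F]

theorem incidence_erase {s : Finset (Fin n)} {v : Fin n} (hv : v ∈ s) :
    incidence F s (s.erase v) = (-1) ^ (s.filter (· < v)).card := by
  unfold incidence
  rw [sum_eq_single v]
  · simp
  · intro w hw hne
    exact if_neg fun h => hne (erase_injOn s hw hv h)
  · exact fun h => absurd hv h

theorem incidence_eq_zero {s t : Finset (Fin n)} (h : ¬ t ⊆ s) : incidence F s t = 0 := by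
  unfold incidence
  exact sum_eq_zero fun v _ => if_neg fun he : s.erase v = t => h (he ▸ erase_subset _ _)

theorem boundary_apply (Y : PreAbstractSimplicialComplex (Fin n)) (i : ℕ)
    (z : Chains F Y (i + 1)) (t : simplices Y i) :
    boundary F Y i z t = ∑ s : simplices Y (i + 1), incidence F s.1 t.1 * z s := by
  simp [boundary, Matrix.mulVec, dotProduct]

theorem IsBetweenSkeleta.subsingleton_homology_iff {e : ℕ}
    {Y : PreAbstractSimplicialComplex (Fin n)} (hY : IsBetweenSkeleta (e + 1) Y) :
    Subsingleton (Homology F Y (e + 1)) ↔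
      ∀ z : Chains F Y (e + 1), boundary F Y e z = 0 → z = 0 := by
  have hempty : IsEmpty (simplices Y (e + 1 + 1)) := ⟨fun s => by
    obtain ⟨h1, h2⟩ := mem_simplices.1 s.2
    have := hY.2 _ h1
    omega⟩
  rw [Submodule.Quotient.subsingleton_iff, Submodule.eq_top_iff']
  constructor
  · intro h z hz
    obtain ⟨w, hw⟩ := h ⟨z, hz⟩
    have h2 : boundary F Y (e + 1) w = z := hw
    rw [← h2, Subsingleton.elim w 0, map_zero]
  · rintro h ⟨z, hz⟩
    refine ⟨0, ?_⟩
    rw [map_zero]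
    exact (h z hz).symm

/-- A simplex removed in round `i + 1` is the only remaining one over some facet, so the vanishing
of the boundary there kills its coefficient. Induction on the rounds kills the whole cycle. -/
theorem IsCollapsible.subsingleton_homology (hd : 1 ≤ d)
    {Y : PreAbstractSimplicialComplex (Fin n)} (hY : IsBetweenSkeleta d Y)
    (h : IsCollapsible d Y) : Subsingleton (Homology F Y d) := by
  obtain ⟨e, rfl⟩ : ∃ e, d = e + 1 := ⟨d - 1, by omega⟩
  rw [hY.subsingleton_homology_iff]
  rw [hY.isCollapsible_iff] at h
  intro z hz
  have key : ∀ i, ∀ s : simplices Y (e + 1), s.1 ∉ survivors^[i] (simplices Y (e + 1)) →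
      z s = 0 := by
    intro i
    induction i with
    | zero => exact fun s hs => absurd s.2 hs
    | succ i ih =>
      intro s hs
      by_cases hsi : s.1 ∈ survivors^[i] (simplices Y (e + 1))
      swap
      · exact ih s hsi
      rw [Function.iterate_succ_apply', survivors, mem_filter] at hs
      push Not at hs
      obtain ⟨v, hv, hv'⟩ := hs hsi
      obtain ⟨hsY, hsc⟩ := mem_simplices.1 s.2
      have hc : (s.1.erase v).card = e + 1 := by rw [card_erase_of_mem hv, hsc]; rfl
      have ht : s.1.erase v ∈ simplices Y e :=
        mem_simplices.2 ⟨hY.1 _ (card_pos.1 (by omega)) hc.le, hc⟩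
      have h0 := congrFun hz ⟨s.1.erase v, ht⟩
      rw [boundary_apply, sum_eq_single s] at h0
      · simp only [Pi.zero_apply, incidence_erase hv, mul_eq_zero] at h0
        exact h0.resolve_left (pow_ne_zero _ (by simp))
      · intro s' _ hne
        by_cases hs' : s'.1 ∈ survivors^[i] (simplices Y (e + 1))
        · rw [incidence_eq_zero (hv' s'.1 hs' fun h => hne (Subtype.ext h)), zero_mul]
        · rw [ih s' hs', mul_zero]
      · exact fun h => absurd (mem_univ _) h
  funext s
  obtain ⟨i, hi⟩ := h s.1
  exact key i s hi

theorem sign_swap {T : Finset (Fin n)} {v w : Fin n} (hv : v ∈ T) (hvw : v < w) :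
    (-1 : F) ^ ((T.erase v).filter (· < w)).card * (-1) ^ (T.filter (· < v)).card +
      (-1) ^ ((T.erase w).filter (· < v)).card * (-1) ^ (T.filter (· < w)).card = 0 := by
  have h1 : (T.erase w).filter (· < v) = T.filter (· < v) := by
    ext u
    simp only [mem_filter, mem_erase]
    constructor
    · exact fun h => ⟨h.1.2, h.2⟩
    · exact fun h => ⟨⟨(h.2.trans hvw).ne, h.1⟩, h.2⟩
  have h2 : T.filter (· < w) = insert v ((T.erase v).filter (· < w)) := by
    ext u
    simp only [mem_filter, mem_erase, mem_insert]
    by_cases huv : u = v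
    · subst huv; simp [hv, hvw]
    · simp [huv]
  have h3 : v ∉ (T.erase v).filter (· < w) := by simp
  rw [h1, h2, card_insert_of_notMem h3, pow_succ]
  ring

/-- This is `∂∂ = 0` for a single simplex: removing `v` and `w` in the two possible orders gives
opposite signs. -/
theorem sum_incidence_mul_incidence (T t : Finset (Fin n)) :
    ∑ v ∈ T, incidence F (T.erase v) t * incidence F T (T.erase v) = 0 := by
  have h1 : ∀ v ∈ T, incidence F (T.erase v) t * incidence F T (T.erase v) =
      ∑ w ∈ T.erase v, if (T.erase v).erase w = t then
        (-1 : F) ^ ((T.erase v).filter (· < w)).card * (-1) ^ (T.filter (· < v)).card else 0 := by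
    intro v hv
    rw [incidence_erase hv, incidence, sum_mul]
    exact sum_congr rfl fun w _ => by split_ifs <;> simp
  rw [sum_congr rfl h1, sum_sigma' T (fun v => T.erase v) (fun v w =>
    if (T.erase v).erase w = t then
      (-1 : F) ^ ((T.erase v).filter (· < w)).card * (-1) ^ (T.filter (· < v)).card else 0)]
  refine sum_involution (fun a _ => ⟨a.2, a.1⟩) ?_ ?_ ?_ ?_
  · rintro ⟨v, w⟩ ha
    obtain ⟨hv, hw⟩ := mem_sigma.1 ha
    obtain ⟨hne, hw⟩ := mem_erase.1 hw
    simp only at hv hw hne ⊢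
    rw [erase_right_comm (a := w)]
    split_ifs
    · rcases lt_or_gt_of_ne hne with h | h
      · rw [add_comm]; exact sign_swap hw h
      · exact sign_swap hv h
    · simp
  · rintro ⟨v, w⟩ ha _ heq
    obtain ⟨-, hw⟩ := mem_sigma.1 ha
    simp only [Sigma.mk.injEq] at heq
    exact (mem_erase.1 hw).1 heq.1
  · rintro ⟨v, w⟩ ha
    obtain ⟨hv, hw⟩ := mem_sigma.1 ha
    obtain ⟨hne, hw⟩ := mem_erase.1 hw
    exact mem_sigma.2 ⟨hw, mem_erase.2 ⟨Ne.symm hne, hv⟩⟩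
  · exact fun _ _ => rfl

/-- The boundary of the missing simplex is a cycle with coefficients `±1` and, as there are no `(d +
1)`-simplices, not a boundary. -/
theorem not_subsingleton_homology (hd : 1 ≤ d) {Y : PreAbstractSimplicialComplex (Fin n)}
    (hY : IsBetweenSkeleta d Y) (h : ContainsSimplexBoundary d Y) :
    ¬ Subsingleton (Homology F Y d) := by
  obtain ⟨T, hT, hTY⟩ := hY.containsSimplexBoundary_iff.1 h
  obtain ⟨e, rfl⟩ : ∃ e, d = e + 1 := ⟨d - 1, by omega⟩
  rw [hY.subsingleton_homology_iff]
  intro hker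
  have hz := hker (fun s => incidence F T s.1) ?_
  · obtain ⟨v, hv⟩ : T.Nonempty := card_pos.1 (by omega)
    have h1 := congrFun hz ⟨T.erase v, hTY v hv⟩
    simp only [incidence_erase hv, Pi.zero_apply] at h1
    exact pow_ne_zero _ (by simp) h1
  · funext t
    rw [boundary_apply, Pi.zero_apply,
      sum_coe_sort (simplices Y (e + 1)) fun s => incidence F s t.1 * incidence F T s,
      ← sum_incidence_mul_incidence T t.1,
      ← sum_image (f := fun s => incidence F s t.1 * incidence F T s)
        (g := fun v => T.erase v) (s := T) (erase_injOn T)]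
    symm
    refine sum_subset (fun s hs => ?_) fun s hs hs' => ?_
    · obtain ⟨v, hv, rfl⟩ := mem_image.1 hs
      exact hTY v hv
    · rw [incidence_eq_zero (s := T), mul_zero]
      intro hsT
      obtain ⟨u, hu, rfl⟩ := eq_erase_of_subset hT (mem_simplices.1 hs).2 hsT
      exact hs' (mem_image_of_mem _ hu)

end Bridge

/-! ### Collapsibility below the threshold -/

section Threshold

variable {n d : ℕ} {p c : ℝ}

theorem weight_nonneg (h0 : 0 ≤ p) (h1 : p ≤ 1) (Y : PreAbstractSimplicialComplex (Fin n)) :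
    0 ≤ weight d p Y :=
  mul_nonneg (pow_nonneg h0 _) (pow_nonneg (by linarith) _)

theorem prob_mono (h0 : 0 ≤ p) (h1 : p ≤ 1) {A B : PreAbstractSimplicialComplex (Fin n) → Prop}
    (h : ∀ Y, IsBetweenSkeleta d Y → A Y → B Y) : prob n d p A ≤ prob n d p B := by
  classical
  refine sum_le_sum_of_subset_of_nonneg (fun Y hY => ?_) fun Y _ _ => weight_nonneg h0 h1 Y
  obtain ⟨h2, h3⟩ := mem_filter.1 hY
  exact mem_filter.2 ⟨h2, h Y (mem_sampleSpace.1 h2) h3⟩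

theorem exp_sub_ne_zero_of_lt_gammaConst (hc0 : 0 ≤ c) (hc : c < gammaConst d) (x : ℝ)
    (hx : x < 1) : Real.exp (-c * (1 - x) ^ d) - x ≠ 0 :=
  fun h => notMem_of_lt_csInf hc ⟨0, fun _ hγ => hγ.1⟩ ⟨hc0, x, hx, h⟩

theorem eventually_div_mem_Icc (hc0 : 0 ≤ c) :
    ∀ᶠ n : ℕ in atTop, 0 ≤ c / (n : ℝ) ∧ c / (n : ℝ) ≤ 1 := by
  filter_upwards [(tendsto_const_div_atTop_nhds_zero_nat c).eventually_lt_const one_pos] with n hn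
  exact ⟨by positivity, hn.le⟩

/-- First `δ` is taken from the core theorem, then the number of rounds `r` from `δ`. If few
simplices survive `r` rounds, the minimal core inside the remainder is too small to occur. -/
theorem tendsto_bern_survivors (hd : 2 ≤ d) (hc0 : 0 ≤ c) (hc : c < gammaConst d) :
    Tendsto (fun n : ℕ => bern (c / n) (topFaces n d)
      {ω | (∃ s, ∀ i, s ∈ survivors^[i] ω) ∧ ¬ HasSimplexBoundary d ω}) atTop (𝓝 0) := by
  obtain ⟨δ, hδ, hcore⟩ := exists_tendsto_bern_core hd hc0
  rw [Metric.tendsto_nhds]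
  intro ε hε
  obtain ⟨r, hr⟩ := eventually_bern_survivors_le (d := d) hc0
    (exp_sub_ne_zero_of_lt_gammaConst hc0 hc) hδ (half_pos hε)
  filter_upwards [hr, hcore.eventually_lt_const (half_pos hε), eventually_div_mem_Icc hc0]
    with n h1 h2 ⟨hp0, hp1⟩
  rw [Real.dist_eq, sub_zero, abs_of_nonneg (bern_nonneg hp0 hp1 _)]
  refine lt_of_le_of_lt ((bern_mono hp0 hp1 fun ω _ hω => ?_).trans
    (bern_union_le hp0 hp1 _ _)) ((add_lt_add h1 h2).trans_eq (add_halves ε))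
  obtain ⟨⟨s, hs⟩, hb⟩ := hω
  obtain ⟨K, hK, hsub, hmem⟩ := exists_core_of_survivors ω
  obtain ⟨K', hK', hmin⟩ := hK.exists_isMinCore ⟨s, hmem s hs⟩
  by_cases hcard : δ * (n : ℝ) ^ d < ((survivors^[r] ω).card : ℝ)
  · exact Or.inl hcard
  · have hsub' := hK'.trans (hsub r)
    have hKω := hsub'.trans (iterate_survivors_subset ω r)
    refine Or.inr ⟨K', hKω, hmin, le_trans ?_ (not_lt.1 hcard), ?_⟩
    · exact_mod_cast card_le_card hsub'
    · rintro ⟨T, hT, h⟩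
      exact hb ⟨T, hT, fun v hv => hKω (h v hv)⟩

theorem tendsto_prob_noBoundary (hd : 0 < d) (hc0 : 0 ≤ c) :
    Tendsto (fun n : ℕ => prob n d (c / n) fun Y => ¬ ContainsSimplexBoundary d Y) atTop
      (𝓝 (Real.exp (-(c ^ (d + 2) / (d + 2).factorial)))) := by
  refine (tendsto_bern_noBoundary d hd hc0).congr fun n => Eq.symm ?_
  exact prob_eq_bern _ _ fun Y hY => not_congr hY.containsSimplexBoundary_iff

theorem tendsto_prob_isCollapsible (hd : 2 ≤ d) (hc0 : 0 ≤ c) (hc : c < gammaConst d) :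
    Tendsto (fun n : ℕ => prob n d (c / n) fun Y =>
      IsCollapsible d Y ∧ ¬ ContainsSimplexBoundary d Y) atTop
      (𝓝 (Real.exp (-(c ^ (d + 2) / (d + 2).factorial)))) := by
  have hlow := (tendsto_prob_noBoundary (by omega : 0 < d) hc0).sub
    (tendsto_bern_survivors hd hc0 hc)
  rw [sub_zero] at hlow
  refine tendsto_of_tendsto_of_tendsto_of_le_of_le' hlow
    (tendsto_prob_noBoundary (by omega : 0 < d) hc0) ?_ ?_
  · filter_upwards [eventually_div_mem_Icc hc0] with n ⟨hp0, hp1⟩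
    rw [sub_le_iff_le_add,
      prob_eq_bern (n := n) (d := d) (fun Y => ¬ ContainsSimplexBoundary d Y)
        {ω | ¬ HasSimplexBoundary d ω} fun Y hY => not_congr hY.containsSimplexBoundary_iff,
      prob_eq_bern (n := n) (d := d) (fun Y => IsCollapsible d Y ∧ ¬ ContainsSimplexBoundary d Y)
        {ω | (∀ s, ∃ i, s ∉ survivors^[i] ω) ∧ ¬ HasSimplexBoundary d ω} fun Y hY =>
          and_congr hY.isCollapsible_iff (not_congr hY.containsSimplexBoundary_iff)]
    refine (bern_mono hp0 hp1 fun ω _ hω => ?_).trans (bern_union_le hp0 hp1 _ _)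
    by_cases h : ∃ s, ∀ i, s ∈ survivors^[i] ω
    · exact Or.inr ⟨h, hω⟩
    · push Not at h
      exact Or.inl ⟨h, hω⟩
  · filter_upwards [eventually_div_mem_Icc hc0] with n ⟨hp0, hp1⟩
    exact prob_mono hp0 hp1 fun Y _ h => h.2

/-- Vanishing homology is squeezed between collapsibility without simplex boundaries and the mere
absence of simplex boundaries. -/
theorem tendsto_prob_homology (F : Type*) [Field F] (hd : 2 ≤ d) (hc0 : 0 ≤ c)
    (hc : c < gammaConst d) :
    Tendsto (fun n : ℕ => prob n d (c / n) fun Y => Subsingleton (Homology F Y d)) atTop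
      (𝓝 (Real.exp (-(c ^ (d + 2) / (d + 2).factorial)))) := by
  refine tendsto_of_tendsto_of_tendsto_of_le_of_le' (tendsto_prob_isCollapsible hd hc0 hc)
    (tendsto_prob_noBoundary (by omega : 0 < d) hc0) ?_ ?_
  · filter_upwards [eventually_div_mem_Icc hc0] with n ⟨hp0, hp1⟩
    exact prob_mono hp0 hp1 fun Y hY h => h.1.subsingleton_homology (by omega) hY
  · filter_upwards [eventually_div_mem_Icc hc0] with n ⟨hp0, hp1⟩
    exact prob_mono hp0 hp1 fun Y hY h hb => not_subsingleton_homology (by omega) hY hb h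

theorem prob_homology_and_noBoundary (F : Type*) [Field F] (hd : 1 ≤ d) (n : ℕ) (p : ℝ) :
    (prob n d p fun Y => Subsingleton (Homology F Y d) ∧ ¬ ContainsSimplexBoundary d Y) =
      prob n d p fun Y => Subsingleton (Homology F Y d) := by
  unfold prob
  refine sum_congr (ext fun Y => ?_) fun _ _ => rfl
  simp only [mem_filter]
  exact and_congr_right fun hY => and_iff_left_of_imp fun h hb =>
    not_subsingleton_homology hd (mem_sampleSpace.1 hY) hb h

end Threshold

end LinialMeshulam

/-! ### The main theorem -/

theorem theorem3 (d : ℕ) (hd : 2 ≤ d) (F : Type*) [Field F] (c : ℝ) (hc0 : 0 ≤ c)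
    (hc : c < LinialMeshulam.gammaConst d) :
    Filter.Tendsto
        (fun n : ℕ => LinialMeshulam.condProb n d (c / n)
          (fun Y => LinialMeshulam.IsCollapsible d Y)
          (fun Y => ¬ LinialMeshulam.ContainsSimplexBoundary d Y))
        Filter.atTop (nhds 1) ∧
      Filter.Tendsto
        (fun n : ℕ => LinialMeshulam.condProb n d (c / n)
          (fun Y => Subsingleton (LinialMeshulam.Homology F Y d))
          (fun Y => ¬ LinialMeshulam.ContainsSimplexBoundary d Y))
        Filter.atTop (nhds 1) ∧
      Filter.Tendsto
        (fun n : ℕ => LinialMeshulam.prob n d (c / n)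
          (fun Y => ¬ LinialMeshulam.ContainsSimplexBoundary d Y))
        Filter.atTop (nhds (Real.exp (-(c ^ (d + 2) / ((d + 2).factorial : ℝ))))) ∧
      Filter.Tendsto
        (fun n : ℕ => LinialMeshulam.prob n d (c / n)
          (fun Y => Subsingleton (LinialMeshulam.Homology F Y d)))
        Filter.atTop (nhds (Real.exp (-(c ^ (d + 2) / ((d + 2).factorial : ℝ))))) := by
  have hB := LinialMeshulam.tendsto_prob_noBoundary (by omega : 0 < d) hc0
  have hH := LinialMeshulam.tendsto_prob_homology F hd hc0 hc
  have hne : Real.exp (-(c ^ (d + 2) / ((d + 2).factorial : ℝ))) ≠ 0 := Real.exp_ne_zero _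
  refine ⟨?_, ?_, hB, hH⟩
  · have h := (LinialMeshulam.tendsto_prob_isCollapsible hd hc0 hc).div hB hne
    rw [div_self hne] at h
    exact h
  · have h := hH.div hB hne
    rw [div_self hne] at h
    refine h.congr fun n => ?_
    simp only [LinialMeshulam.condProb, Pi.div_apply]
    rw [LinialMeshulam.prob_homology_and_noBoundary F (by omega)]
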